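/- **Theorem 7.6.** Let $d$ be a dimension and let $(l,Q,\nu)$ be a Lévy triplet in $\mathbb R^d$: $l\in\mathbb R^d$, $Q\in\mathbb R^{d\times d}$ is symmetric positive semidefinite, and $\nu$ is a measure on $\mathbb R^d\setminus\{0\}$ with $\int_{y\ne0}\min\{|y|^2,1\}\,\nu(dy)<\infty$. Then the integrals in $$\psi(\xi)=-i\,l\cdot\xi+\tfrac12\,\xi\cdot Q\xi+\int_{y\neq 0}\Big[1-e^{i y\cdot\xi}+i\,\xi\cdot y\,\mathbf 1_{(0,1)}(|y|)\Big]\nu(dy),\qquad \xi\in\mathbb R^d,$$ converge absolutely, and there exist a probability space and on it a Lévy process $X=(X_t)_{t\ge0}$ with values in $\mathbb R^d$ (i.e. $X_0=0$ a.s.; $X_t-X_s\sim X_{t-s}-X_0$ and $X_t-X_s$ is independent of $\sigma(X_r,\,r\le s)$ for $s\le t$; $X_t\to X_0$ in probability as $t\to0$) such that all paths of $X$ are càdlàg and $X$ has characteristic exponent $\psi$, i.e. $\psi$ is continuous and $\mathbb E\,e^{i\xi\cdot X_t}=e^{-t\psi(\xi)}$ for all $t\ge 0$ and $\xi\in\mathbb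 R^d$. Moreover, $X$ can be chosen as follows. Put $A_0=\{|y|\ge1\}$ and $A_n=\{\frac1{n+1}\le|y|<\frac1n\}$ for $n\ge1$. On the same probability space there are independent processes $W,C^0,C^1,C^2,\dots$, where $W$ is a standard $d$-dimensional Wiener process and $C^n$ is a compound Poisson process with intensity $\nu(A_n)<\infty$ and jump distribution $\nu(\,\cdot\cap A_n)/\nu(A_n)$ (with $C^n\equiv0$ if $\nu(A_n)=0$), such that the compensated processes $\widetilde C^n_t=C^n_t-t\int_{A_n}y\,\nu(dy)$, $n\ge1$, are square integrable and $$X_t=t\,l+\sqrt Q\,W_t+C^0_t+\sum_{n=1}^\infty\widetilde C^n_t,$$ the series converging in $L^2$ locally uniformly in time: for every $T\ge0$, $$\lim_{m\to\infty}\mathbb E\Big[\sup_{t\le T}\Big|X_t-t\,l-\sqrt Q\,W_t-C^0_t-\sum_{n=1}^m\widetilde C^n_t\Big|^2\Big]=0 .$$ Here a compound Poisson process with intensity $\lambda>0$ and jump distribution $\mu$ is a process $C_t=H_1+\dots+H_{N_t}$ with iid $H_k\sim\mu$ independent of a Poisson process $N$ whose waiting times are iid and exponentially distributed with rate $\lambda$.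 -/

import Mathlib

open MeasureTheory ProbabilityTheory Filter Topology
open scoped NNReal ENNReal RealInnerProductSpace MatrixOrder

noncomputable section

namespace LevyConstruction

/-- A Lévy measure on `ℝ^d \ {0}`, encoded as a Borel measure on `ℝ^d` that does not charge `0`,
with `∫ min(|y|², 1) ν(dy) < ∞`. Finiteness of this integral makes `ν` finite on every set bounded
away from `0`, so `ν` is automatically a Radon measure on `ℝ^d \ {0}`. -/
structure IsLevyMeasure {d : ℕ} (ν : Measure (EuclideanSpace ℝ (Fin d))) : Prop where
  zero : ν {0} = 0
  lintegral_lt_top : ∫⁻ y, ENNReal.ofReal (min (‖y‖ ^ 2) 1) ∂ν < ∞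

/-- The integrand `1 - exp(i y·ξ) + i ξ·y 1_{(0,1)}(|y|)` of the Lévy–Khintchine formula. -/
def levyKhintchineIntegrand {d : ℕ} (ξ y : EuclideanSpace ℝ (Fin d)) : ℂ :=
  1 - Complex.exp (Complex.I * (⟪y, ξ⟫ : ℂ))
    + Complex.I * (⟪ξ, y⟫ : ℂ) * (Set.Ioo (0 : ℝ) 1).indicator (fun _ => (1 : ℂ)) ‖y‖

/-- The Lévy–Khintchine expression
`ψ(ξ) = -i l·ξ + ½ ξ·Qξ + ∫ (1 - exp(i y·ξ) + i ξ·y 1_{(0,1)}(|y|)) ν(dy)`. -/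
def levyKhintchineExponent {d : ℕ} (l : EuclideanSpace ℝ (Fin d)) (Q : Matrix (Fin d) (Fin d) ℝ)
    (ν : Measure (EuclideanSpace ℝ (Fin d))) (ξ : EuclideanSpace ℝ (Fin d)) : ℂ :=
  -(Complex.I * (⟪l, ξ⟫ : ℂ))
    + 1 / 2 * (⟪ξ, Matrix.toEuclideanCLM (𝕜 := ℝ) Q ξ⟫ : ℂ)
    + ∫ y, levyKhintchineIntegrand ξ y ∂ν

section Processes

variable {d : ℕ} {Ω : Type*} [MeasurableSpace Ω]

/-- A Lévy process: it starts at zero, has stationary increments, each increment is independent of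
the past `σ(X_r, r ≤ s)`, and it is continuous in probability at time `0`. -/
structure IsLevyProcess (X : ℝ≥0 → Ω → EuclideanSpace ℝ (Fin d)) (P : Measure Ω) : Prop where
  measurable : ∀ t, Measurable (X t)
  zero : ∀ᵐ ω ∂P, X 0 ω = 0
  stationary : ∀ s t : ℝ≥0, s ≤ t →
    IdentDistrib (fun ω => X t ω - X s ω) (fun ω => X (t - s) ω - X 0 ω) P P
  indep : ∀ s t : ℝ≥0, s ≤ t →
    Indep (MeasurableSpace.comap (fun ω => X t ω - X s ω) inferInstance)
      (⨆ r : Set.Iic s, MeasurableSpace.comap (X r) inferInstance) P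
  continuous_in_prob : ∀ ε : ℝ, 0 < ε →
    Tendsto (fun t : ℝ≥0 => P {ω | ε < ‖X t ω - X 0 ω‖}) (𝓝 0) (𝓝 0)

/-- Right-continuous on `[0, ∞)` with left limits on `(0, ∞)`. -/
def IsCadlag (f : ℝ≥0 → EuclideanSpace ℝ (Fin d)) : Prop :=
  (∀ t, ContinuousWithinAt f (Set.Ici t) t) ∧ ∀ t, 0 < t → ∃ x, Tendsto f (𝓝[<] t) (𝓝 x)

/-- `ψ` is the characteristic exponent of `X`: the continuous function with
`E exp(i ξ·X_t) = exp(-t ψ(ξ))`. -/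
def HasCharExponent (X : ℝ≥0 → Ω → EuclideanSpace ℝ (Fin d)) (P : Measure Ω)
    (ψ : EuclideanSpace ℝ (Fin d) → ℂ) : Prop :=
  Continuous ψ ∧ ∀ (t : ℝ≥0) (ξ : EuclideanSpace ℝ (Fin d)),
    ∫ ω, Complex.exp (Complex.I * (⟪ξ, X t ω⟫ : ℂ)) ∂P = Complex.exp (-(((t : ℝ) : ℂ) * ψ ξ))

/-- A standard Wiener process in `ℝ^d`: its coordinates are independent real Brownian motions. -/
structure IsWienerProcess (W : ℝ≥0 → Ω → EuclideanSpace ℝ (Fin d)) (P : Measure Ω) : Prop where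
  measurable : ∀ t, Measurable (W t)
  brownian : ∀ i : Fin d, IsBrownianReal (fun t ω => W t ω i) P
  indep : iIndepFun (fun (i : Fin d) (ω : Ω) (t : ℝ≥0) => W t ω i) P

/-- A Poisson process with rate `r > 0`: `N_t` counts the `k` with `σ_0 + ⋯ + σ_k ≤ t`, where the
waiting times `σ_k` are independent and exponentially distributed with rate `r` (mean `1 / r`).
Equality with the extended cardinality includes that this set is finite. -/
def IsPoissonProcess (N : ℝ≥0 → Ω → ℕ) (r : ℝ) (P : Measure Ω) : Prop :=
  0 < r ∧ (∀ t, Measurable (N t)) ∧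
    ∃ σ : ℕ → Ω → ℝ, (∀ k, Measurable (σ k)) ∧ iIndepFun σ P ∧
      (∀ k, P.map (σ k) = expMeasure r) ∧
      ∀ᵐ ω ∂P, ∀ t : ℝ≥0,
        (N t ω : ℕ∞) = {k : ℕ | ∑ i ∈ Finset.range (k + 1), σ i ω ≤ (t : ℝ)}.encard

/-- A compound Poisson process `C_t = H_1 + ⋯ + H_{N_t}` with intensity `r > 0` and jump
distribution `μ`: the `H_k` are iid with law `μ` and independent of the Poisson process `N`. -/
def IsCompoundPoisson (C : ℝ≥0 → Ω → EuclideanSpace ℝ (Fin d)) (r : ℝ)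
    (μ : Measure (EuclideanSpace ℝ (Fin d))) (P : Measure Ω) : Prop :=
  ∃ (N : ℝ≥0 → Ω → ℕ) (H : ℕ → Ω → EuclideanSpace ℝ (Fin d)),
    IsPoissonProcess N r P ∧ (∀ k, Measurable (H k)) ∧ iIndepFun H P ∧ (∀ k, P.map (H k) = μ) ∧
      IndepFun (fun (ω : Ω) (t : ℝ≥0) => N t ω) (fun (ω : Ω) (k : ℕ) => H k ω) P ∧
      ∀ (t : ℝ≥0) (ω : Ω), C t ω = ∑ k ∈ Finset.range (N t ω), H k ω

/-- The compound Poisson process with finite jump measure `ρ`: intensity `ρ(ℝ^d)` and jump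
distribution `ρ / ρ(ℝ^d)`; if `ρ = 0`, there are no jumps and the process vanishes. -/
def IsCompoundPoissonOf (C : ℝ≥0 → Ω → EuclideanSpace ℝ (Fin d))
    (ρ : Measure (EuclideanSpace ℝ (Fin d))) (P : Measure Ω) : Prop :=
  ρ Set.univ < ∞ ∧
    ((ρ = 0 ∧ ∀ t ω, C t ω = 0) ∨
      (ρ ≠ 0 ∧ IsCompoundPoisson C (ρ Set.univ).toReal ((ρ Set.univ)⁻¹ • ρ) P))

end Processes

/-- The shells `A_0 = {|y| ≥ 1}` and `A_n = {1/(n+1) ≤ |y| < 1/n}`, `n ≥ 1`. -/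
def shell (d : ℕ) : ℕ → Set (EuclideanSpace ℝ (Fin d))
  | 0 => {y | 1 ≤ ‖y‖}
  | n + 1 => {y | 1 / ((n : ℝ) + 2) ≤ ‖y‖ ∧ ‖y‖ < 1 / ((n : ℝ) + 1)}

/-- The compensated process `C_t - t ∫_{A} y ν(dy)`. -/
def compensated {d : ℕ} {Ω : Type*} (ν : Measure (EuclideanSpace ℝ (Fin d)))
    (A : Set (EuclideanSpace ℝ (Fin d))) (C : ℝ≥0 → Ω → EuclideanSpace ℝ (Fin d))
    (t : ℝ≥0) (ω : Ω) : EuclideanSpace ℝ (Fin d) :=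
  C t ω - (t : ℝ) • ∫ y in A, y ∂ν

end LevyConstruction

end

set_option linter.unusedSectionVars false

/-! Cut `ν` along the shells. On each shell `ν` is finite, so its jumps form a compound Poisson
process, and the Gaussian part is `√Q W`. All of these are realised independently on one product
space, so the exponents add. Since the integrand is at most a constant times `min (‖y‖ ^ 2) 1`
(`norm_levyKhintchineIntegrand_le`), the shell contributions sum to the Lévy–Khintchine integral.

The small jumps need not be absolutely summable, and compensation cures this. For `n ≥ 1` the
compensated shells are independent, centred and have second moment `t ∫_{A_n} ‖y‖² dν`, which is
summable in `n`. Doob's `L²` inequality (`exists_majorant_lintegral_le`) makes the partial sums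
Cauchy in `E sup ‖·‖²`. A subsequence then converges locally uniformly almost surely, which keeps
paths càdlàg, and Fatou carries the `L²` bound over to the whole sequence
(`exists_cadlag_limit_process`).

The Lévy property travels in Fourier form. `HasLevyIncrements` factorises the joint characteristic
function of an increment and finitely many past values. This form is stable under independent sums
and pointwise limits, and uniqueness of characteristic functions turns it back into independence and
stationarity.

Two building blocks are constructed from scratch. For compound Poisson processes, cutting the iid
sequences after the `n` arrivals before time `s` and using the memorylessness of the exponential law
shows that the future is a fresh copy independent of the past (`markedLaw_past_inter_increment`).
Brownian motion is the image of the indicators of `[0, t]` under an isometry of `L²` into Gaussian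
variables, made continuous by Kolmogorov's chaining with fourth moments. -/

namespace LevyConstruction

/-! ### Lévy increments in Fourier form -/

section LevyIncrements

variable {E Ω : Type*} [NormedAddCommGroup E] [InnerProductSpace ℝ E] [MeasurableSpace E]
  [MeasurableSpace Ω]

/-- The process `Y` has independent stationary increments with characteristic exponent `ψ`,
phrased through the joint characteristic functions of an increment and the past. -/
structure HasLevyIncrements (Y : ℝ≥0 → Ω → E) (P : Measure Ω) (ψ : E → ℂ) : Prop where
  measurable : ∀ t, Measurable (Y t)
  integral_eq : ∀ s t : ℝ≥0, s ≤ t → ∀ (ξ : E) (I : Finset (Set.Iic s)) (η : Set.Iic s → E),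
    ∫ ω, Complex.exp ((⟪Y t ω - Y s ω, ξ⟫ + ∑ r ∈ I, ⟪Y r ω, η r⟫ : ℝ) * Complex.I) ∂P
      = Complex.exp (-(((t : ℝ) - s : ℝ) * ψ ξ))
        * ∫ ω, Complex.exp ((∑ r ∈ I, ⟪Y r ω, η r⟫ : ℝ) * Complex.I) ∂P

variable [BorelSpace E] [SecondCountableTopology E] {P : Measure Ω} [IsProbabilityMeasure P]
  {Y Z : ℝ≥0 → Ω → E} {ψ φ : E → ℂ}

lemma HasLevyIncrements.integral_increment (h : HasLevyIncrements Y P ψ) {s t : ℝ≥0}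
    (hst : s ≤ t) (ξ : E) :
    ∫ ω, Complex.exp ((⟪Y t ω - Y s ω, ξ⟫ : ℝ) * Complex.I) ∂P
      = Complex.exp (-(((t : ℝ) - s : ℝ) * ψ ξ)) := by
  simpa using h.integral_eq s t hst ξ ∅ 0

lemma HasLevyIncrements.charFun_increment (h : HasLevyIncrements Y P ψ) {s t : ℝ≥0}
    (hst : s ≤ t) (ξ : E) :
    charFun (P.map (fun ω => Y t ω - Y s ω)) ξ = Complex.exp (-(((t : ℝ) - s : ℝ) * ψ ξ)) := by
  rw [← h.integral_increment hst, charFun_apply,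
    integral_map (by have := h.measurable; fun_prop) (by fun_prop)]

/-- Independence from the past can be tested on finitely many past times. Packed into an `ℓ²`
product, these turn the sum of pairings into one inner product, and the defining identity becomes
the factorisation of a joint characteristic function. -/
lemma HasLevyIncrements.indepFun [CompleteSpace E] (h : HasLevyIncrements Y P ψ) {s t : ℝ≥0}
    (hst : s ≤ t) :
    IndepFun (fun ω => Y t ω - Y s ω) (fun ω (r : Set.Iic s) => Y r ω) P := by
  have hm : Measurable fun ω => Y t ω - Y s ω := (h.measurable t).sub (h.measurable s)
  refine IndepFun.indepFun_process hm (fun r => h.measurable r) fun I => ?_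
  have hI : Measurable fun ω => WithLp.toLp 2 (fun i : I => Y i ω) :=
    (WithLp.measurable_toLp 2 _).comp (measurable_pi_lambda _ fun i => h.measurable _)
  suffices IndepFun (fun ω => Y t ω - Y s ω) (fun ω => WithLp.toLp 2 (fun i : I => Y i ω)) P from
    this.comp measurable_id (WithLp.measurable_ofLp 2 _)
  have hp : Measurable fun ω =>
      WithLp.toLp 2 (Y t ω - Y s ω, WithLp.toLp 2 (fun i : I => Y i ω)) :=
    (WithLp.measurable_toLp 2 _).comp (hm.prodMk hI)
  rw [indepFun_iff_charFun_prod hm.aemeasurable hI.aemeasurable]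
  intro x
  classical
  have key := h.integral_eq s t hst x.fst I
    (fun r => if hr : r ∈ I then x.snd ⟨r, hr⟩ else 0)
  have hsum : ∀ ω, ∑ r ∈ I, ⟪Y r ω, (if hr : r ∈ I then x.snd ⟨r, hr⟩ else 0)⟫
      = ⟪WithLp.toLp 2 (fun i : I => Y i ω), x.snd⟫ := by
    intro ω
    rw [PiLp.inner_apply, ← Finset.sum_coe_sort]
    exact Finset.sum_congr rfl fun i _ => by simp
  simp only [hsum] at key
  rw [h.charFun_increment hst, charFun_apply, charFun_apply, integral_map hp.aemeasurable (by fun_prop),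
    integral_map hI.aemeasurable (by fun_prop)]
  simpa [WithLp.prod_inner_apply] using key

lemma HasLevyIncrements.of_indepFun (hm : ∀ t, Measurable (Y t))
    (hind : ∀ s t : ℝ≥0, s ≤ t →
      IndepFun (fun ω => Y t ω - Y s ω) (fun ω (r : Set.Iic s) => Y r ω) P)
    (hint : ∀ s t : ℝ≥0, s ≤ t → ∀ ξ : E,
      ∫ ω, Complex.exp ((⟪Y t ω - Y s ω, ξ⟫ : ℝ) * Complex.I) ∂P
        = Complex.exp (-(((t : ℝ) - s : ℝ) * ψ ξ))) :
    HasLevyIncrements Y P ψ where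
  measurable := hm
  integral_eq s t hst ξ I η := by
    have hcomp := (hind s t hst).comp
      (φ := fun y => Complex.exp ((⟪y, ξ⟫ : ℝ) * Complex.I))
      (ψ := fun f : Set.Iic s → E => Complex.exp ((∑ r ∈ I, ⟪f r, η r⟫ : ℝ) * Complex.I))
      (by fun_prop) (by fun_prop)
    have h1 := hm t
    have h2 := hm s
    have h3 := fun r : Set.Iic s => hm r
    have hmul := hcomp.integral_fun_mul_eq_mul_integral
      (Measurable.aestronglyMeasurable (by simp only [Function.comp_def]; fun_prop))
      (Measurable.aestronglyMeasurable (by simp only [Function.comp_def]; fun_prop))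
    simp only [Function.comp_def] at hmul
    rw [← hint s t hst ξ, ← hmul]
    refine integral_congr_ae (.of_forall fun ω => ?_)
    simp [← Complex.exp_add, add_mul]

/-- Both exponents in the defining identity are additive functionals of the path, so each side
factorises over the two independent processes. -/
lemma HasLevyIncrements.add (hY : HasLevyIncrements Y P ψ) (hZ : HasLevyIncrements Z P φ)
    (h : IndepFun (fun ω t => Y t ω) (fun ω t => Z t ω) P) :
    HasLevyIncrements (fun t ω => Y t ω + Z t ω) P (fun ξ => ψ ξ + φ ξ) where
  measurable t := (hY.measurable t).add (hZ.measurable t)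
  integral_eq s t hst ξ I η := by
    have hYm := measurable_pi_lambda _ hY.measurable
    have hZm := measurable_pi_lambda _ hZ.measurable
    have split : ∀ (F : (ℝ≥0 → E) → ℝ), Measurable F →
        (∀ f g : ℝ≥0 → E, F (f + g) = F f + F g) →
        ∫ ω, Complex.exp (F (fun t => Y t ω + Z t ω) * Complex.I) ∂P
          = (∫ ω, Complex.exp (F (fun t => Y t ω) * Complex.I) ∂P)
            * ∫ ω, Complex.exp (F (fun t => Z t ω) * Complex.I) ∂P := by
      intro F hF hadd
      have hF' : Measurable fun f => Complex.exp (F f * Complex.I) := by fun_prop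
      have := (h.comp hF' hF').integral_fun_mul_eq_mul_integral
        (hF'.comp hYm).aestronglyMeasurable (hF'.comp hZm).aestronglyMeasurable
      simp only [Function.comp_def] at this
      rw [← this]
      refine integral_congr_ae (.of_forall fun ω => ?_)
      have : (fun t => Y t ω + Z t ω) = (fun t => Y t ω) + (fun t => Z t ω) := rfl
      simp only [this, hadd, ← Complex.exp_add]
      push_cast
      ring_nf
    have e1 := split (fun f => ⟪f t - f s, ξ⟫ + ∑ r ∈ I, ⟪f r, η r⟫) (by fun_prop) (by
      intro f g
      simp only [Pi.add_apply, inner_add_left, Finset.sum_add_distrib, inner_sub_left]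
      ring)
    have e2 := split (fun f => ∑ r ∈ I, ⟪f r, η r⟫) (by fun_prop) (by
      intro f g
      simp only [Pi.add_apply, inner_add_left, Finset.sum_add_distrib])
    rw [e1, e2, hY.integral_eq s t hst, hZ.integral_eq s t hst]
    rw [mul_add, neg_add, Complex.exp_add]
    ring

/-- The integrands have modulus one and depend on finitely many times, so dominated convergence
applies. This is what the Fourier form is for: independence passes to the limit without further
argument. -/
lemma HasLevyIncrements.of_tendsto {X : ℕ → ℝ≥0 → Ω → E} {ψs : ℕ → E → ℂ}
    (hX : ∀ n, HasLevyIncrements (X n) P (ψs n)) (hY : ∀ t, Measurable (Y t))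
    (hlim : ∀ᵐ ω ∂P, ∀ t, Tendsto (fun n => X n t ω) atTop (𝓝 (Y t ω)))
    (hψ : ∀ ξ, Tendsto (fun n => ψs n ξ) atTop (𝓝 (ψ ξ))) : HasLevyIncrements Y P ψ where
  measurable := hY
  integral_eq s t hst ξ I η := by
    have lim : ∀ F : (ℝ≥0 → E) → ℝ, Measurable F → Continuous F →
        Tendsto (fun n => ∫ ω, Complex.exp (F (fun t => X n t ω) * Complex.I) ∂P) atTop
          (𝓝 (∫ ω, Complex.exp (F (fun t => Y t ω) * Complex.I) ∂P)) := by
      intro F hF hFc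
      refine tendsto_integral_of_dominated_convergence (fun _ => 1) ?_ (integrable_const _) ?_ ?_
      · intro n
        have hm := measurable_pi_lambda _ (hX n).measurable
        have hF' : Measurable fun f => Complex.exp (F f * Complex.I) := by fun_prop
        exact (hF'.comp hm).aestronglyMeasurable
      · exact fun n => .of_forall fun ω => by rw [Complex.norm_exp_ofReal_mul_I]
      · filter_upwards [hlim] with ω hω
        have hc : Continuous fun f => Complex.exp (F f * Complex.I) := by fun_prop
        exact (hc.tendsto _).comp (tendsto_pi_nhds.2 hω)
    have e1 := lim (fun f => ⟪f t - f s, ξ⟫ + ∑ r ∈ I, ⟪f r, η r⟫) (by fun_prop) (by fun_prop)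
    have e2 := lim (fun f => ∑ r ∈ I, ⟪f r, η r⟫) (by fun_prop) (by fun_prop)
    refine tendsto_nhds_unique e1 ?_
    simp only [(hX _).integral_eq s t hst]
    exact (Complex.continuous_exp.tendsto _ |>.comp ((hψ ξ).const_mul _).neg).mul e2

/-- The deterministic drift `t ↦ t • v`. -/
lemma hasLevyIncrements_drift (v : E) :
    HasLevyIncrements (fun (t : ℝ≥0) (_ : Ω) => (t : ℝ) • v) P
      (fun ξ => -(Complex.I * (⟪v, ξ⟫ : ℝ))) where
  measurable t := measurable_const
  integral_eq s t hst ξ I η := by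
    simp only [integral_const, probReal_univ, one_smul, ← Complex.exp_add]
    congr 1
    rw [← sub_smul, inner_smul_left]
    push_cast
    simp
    ring

variable {d : ℕ} {X : ℝ≥0 → Ω → EuclideanSpace ℝ (Fin d)}
  {χ : EuclideanSpace ℝ (Fin d) → ℂ}

/-- The characteristic function of an increment sees only `t - s`, which gives stationarity.
Continuity in probability follows from almost sure continuity at `0`, tested along sequences. -/
lemma HasLevyIncrements.isLevyProcess (h : HasLevyIncrements X P χ) (h0 : ∀ᵐ ω ∂P, X 0 ω = 0)
    (hc : ∀ᵐ ω ∂P, ContinuousWithinAt (fun t => X t ω) (Set.Ici 0) 0) : IsLevyProcess X P where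
  measurable := h.measurable
  zero := h0
  stationary s t hst := by
    have hm := h.measurable
    refine ⟨by fun_prop, by fun_prop, ?_⟩
    have : IsProbabilityMeasure (P.map fun ω => X t ω - X s ω) :=
      Measure.isProbabilityMeasure_map (by fun_prop)
    have : IsProbabilityMeasure (P.map fun ω => X (t - s) ω - X 0 ω) :=
      Measure.isProbabilityMeasure_map (by fun_prop)
    refine Measure.ext_of_charFun (funext fun ξ => ?_)
    rw [h.charFun_increment hst, h.charFun_increment (zero_le : (0 : ℝ≥0) ≤ t - s), NNReal.coe_sub hst]
    simp
  indep s t hst := by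
    have := h.indepFun hst
    rw [IndepFun_iff_Indep] at this
    convert this using 1
    simp only [MeasurableSpace.pi, MeasurableSpace.comap_iSup, MeasurableSpace.comap_comp]
    rfl
  continuous_in_prob ε hε := by
    rw [tendsto_iff_seq_tendsto]
    intro u hu
    have hm := h.measurable
    have hlim : TendstoInMeasure P (fun n ω => X (u n) ω - X 0 ω) atTop (fun _ => 0) := by
      refine tendstoInMeasure_of_tendsto_ae (fun n => Measurable.aestronglyMeasurable
        (by fun_prop)) ?_
      filter_upwards [hc] with ω hω
      have h1 : Tendsto (fun t => X t ω) (𝓝 0) (𝓝 (X 0 ω)) := by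
        have : Set.Ici (0 : ℝ≥0) = Set.univ := Set.eq_univ_of_forall fun t => zero_le (a := t)
        rw [ContinuousWithinAt, this, nhdsWithin_univ] at hω
        exact hω
      simpa using (h1.comp hu).sub_const (X 0 ω)
    have := tendstoInMeasure_iff_norm.1 hlim ε hε
    refine tendsto_of_tendsto_of_tendsto_of_le_of_le tendsto_const_nhds this
      (fun _ => zero_le) fun n => measure_mono fun ω hω => ?_
    have h2 : ε < ‖X (u n) ω - X 0 ω‖ := hω
    simpa using h2.le

end LevyIncrements


/-! ### Doob's maximal inequality in `L²` -/

section MaximalInequality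

/-- Running maximum of a nonnegative sequence. -/
noncomputable def runningMax (x : ℕ → ℝ) : ℕ → ℝ
  | 0 => x 0
  | n + 1 => max (runningMax x n) (x (n + 1))

lemma le_runningMax (x : ℕ → ℝ) {k n : ℕ} (h : k ≤ n) : x k ≤ runningMax x n := by
  induction n with
  | zero => simp [Nat.le_zero.1 h, runningMax]
  | succ n ih =>
    rcases Nat.le_succ_iff.1 h with h | rfl
    · exact (ih h).trans (le_max_left _ _)
    · exact le_max_right _ _

lemma runningMax_congr {x y : ℕ → ℝ} {n : ℕ} (h : ∀ k ≤ n, x k = y k) :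
    runningMax x n = runningMax y n := by
  induction n with
  | zero => simp [runningMax, h]
  | succ n ih => simp only [runningMax, h (n + 1) le_rfl, ih fun k hk => h k (hk.trans n.le_succ)]

/-- A pathwise form of Doob's inequality: for a nonnegative submartingale the sum has nonnegative
mean and can be dropped after integration. By induction, twice the sum is at most `2 S x - S ^ 2`,
with `S` the running maximum; the rest is `(2 x - S) ^ 2 ≥ 0`. -/
lemma runningMax_sq_add_le (x : ℕ → ℝ) (n : ℕ) :
    runningMax x n ^ 2 + 4 * ∑ k ∈ Finset.range n, runningMax x k * (x (k + 1) - x k)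
      ≤ 4 * x n ^ 2 := by
  have key : ∀ n, 2 * ∑ k ∈ Finset.range n, runningMax x k * (x (k + 1) - x k)
      ≤ 2 * runningMax x n * x n - runningMax x n ^ 2 := by
    intro n
    induction n with
    | zero => simp [runningMax]; nlinarith [sq_nonneg (x 0)]
    | succ n ih =>
      rw [Finset.sum_range_succ, runningMax]
      rcases le_total (runningMax x n) (x (n + 1)) with h | h
      · rw [max_eq_right h]; nlinarith [sq_nonneg (x (n + 1) - runningMax x n)]
      · rw [max_eq_left h]; nlinarith
  nlinarith [key n, sq_nonneg (2 * x n - runningMax x n)]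

variable {E Ω : Type*} [NormedAddCommGroup E] [InnerProductSpace ℝ E] [MeasurableSpace E]
  [MeasurableSpace Ω] [BorelSpace E] [SecondCountableTopology E] [CompleteSpace E]
  {P : Measure Ω} [IsProbabilityMeasure P]

lemma integrable_inner_of_memLp {f g : Ω → E} (hf : MemLp f 2 P) (hg : MemLp g 2 P) :
    Integrable (fun ω => ⟪f ω, g ω⟫) P :=
  (hf.norm.integrable_mul hg.norm).mono (hf.1.inner hg.1) (.of_forall fun ω => by
    simpa using abs_real_inner_le_norm (f ω) (g ω))

lemma measurable_runningMax {x : ℕ → Ω → ℝ} (hx : ∀ k, Measurable (x k)) (n : ℕ) :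
    Measurable fun ω => runningMax (fun k => x k ω) n := by
  induction n with
  | zero => exact hx 0
  | succ n ih => exact ih.max (hx (n + 1))

lemma memLp_runningMax {x : ℕ → Ω → ℝ} (hx : ∀ k, MemLp (x k) 2 P) (n : ℕ) :
    MemLp (fun ω => runningMax (fun k => x k ω) n) 2 P := by
  induction n with
  | zero => exact hx 0
  | succ n ih => exact ih.sup (hx (n + 1))

/-- **Doob's `L²` maximal inequality** for a sequence whose centred increments are independent of
the past. -/
lemma integral_runningMax_sq_le {M : ℕ → Ω → E} (hM : ∀ k, MemLp (M k) 2 P)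
    (hm : ∀ k, Measurable (M k))
    (hind : ∀ k, IndepFun (fun ω (j : Set.Iic k) => M j ω) (fun ω => M (k + 1) ω - M k ω) P)
    (hmean : ∀ k, ∫ ω, (M (k + 1) ω - M k ω) ∂P = 0) (n : ℕ) :
    ∫ ω, runningMax (fun k => ‖M k ω‖) n ^ 2 ∂P ≤ 4 * ∫ ω, ‖M n ω‖ ^ 2 ∂P := by
  set S : ℕ → Ω → ℝ := fun n ω => runningMax (fun k => ‖M k ω‖) n with hS
  have hSL : ∀ n, MemLp (S n) 2 P := memLp_runningMax fun k => (hM k).norm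
  have hSnn : ∀ n ω, 0 ≤ S n ω := fun n ω =>
    (norm_nonneg (M n ω)).trans (le_runningMax (fun k => ‖M k ω‖) le_rfl)
  have hprod : ∀ k, Integrable (fun ω => S k ω * (‖M (k + 1) ω‖ - ‖M k ω‖)) P := fun k =>
    (hSL k).integrable_mul ((hM (k + 1)).norm.sub (hM k).norm)
  have hstep : ∀ k, 0 ≤ ∫ ω, S k ω * (‖M (k + 1) ω‖ - ‖M k ω‖) ∂P := by
    intro k
    -- By convexity of the norm, its increment dominates the inner product of the unit vector along
    -- `M k` with the increment of `M`. Weighted by `S k`, that unit vector is a function of the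
    -- past, so the inner product has mean zero. Where `M k = 0`, the convention `0⁻¹ = 0` makes `V`
    -- vanish.
    set V : Ω → E := fun ω => (S k ω * ‖M k ω‖⁻¹) • M k ω with hV
    have hVm : Measurable V := by
      have := measurable_runningMax (fun k => (hm k).norm) k
      have := hm k
      exact (Measurable.mul ‹_› (by fun_prop)).smul (hm k)
    have hunit : ∀ ω, ‖‖M k ω‖⁻¹ • M k ω‖ ≤ 1 := by
      intro ω
      rw [norm_smul, norm_inv, norm_norm]
      exact inv_mul_le_one
    have hVL : MemLp V 2 P := by
      refine (hSL k).mono hVm.aestronglyMeasurable (.of_forall fun ω => ?_)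
      simp only [hV]
      rw [mul_smul, norm_smul]
      exact mul_le_of_le_one_right (norm_nonneg _) (hunit ω)
    have hDL := (hM (k + 1)).sub (hM k)
    have hVD : IndepFun V (fun ω => M (k + 1) ω - M k ω) P := by
      refine (hind k).comp (φ := fun f : Set.Iic k → E =>
        (runningMax (fun j => ‖if h : j ≤ k then f ⟨j, h⟩ else 0‖) k
          * ‖f ⟨k, Set.mem_Iic.2 le_rfl⟩‖⁻¹) • f ⟨k, Set.mem_Iic.2 le_rfl⟩) (ψ := id) ?_ measurable_id |>.congr
          (.of_forall fun ω => ?_) (.of_forall fun ω => rfl)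
      · have h1 : Measurable fun f : Set.Iic k → E =>
            runningMax (fun j => ‖if h : j ≤ k then f ⟨j, h⟩ else 0‖) k := by
          refine measurable_runningMax (x := fun j (f : Set.Iic k → E) =>
            ‖if h : j ≤ k then f ⟨j, h⟩ else 0‖) (fun j => Measurable.norm ?_) k
          split_ifs
          · fun_prop
          · fun_prop
        fun_prop
      · simp only [Function.comp, hV, hS]
        rw [runningMax_congr (y := fun k => ‖M k ω‖)]
        intro j hj
        simp [hj]
    have hzero : ∫ ω, ⟪V ω, M (k + 1) ω - M k ω⟫ ∂P = 0 := by
      have h := hVD.integral_bilin (hVL.integrable one_le_two) (hDL.integrable one_le_two)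
        (innerSL ℝ)
      rw [hmean, map_zero] at h
      exact h
    rw [← hzero]
    refine integral_mono (integrable_inner_of_memLp hVL hDL) (hprod k) fun ω => ?_
    simp only [hV, mul_smul, real_inner_smul_left, inner_sub_right, ← mul_sub]
    refine mul_le_mul_of_nonneg_left ?_ (hSnn k ω)
    have h1 : ⟪M k ω, M k ω⟫ = ‖M k ω‖ ^ 2 := real_inner_self_eq_norm_sq _
    have h2 : ‖M k ω‖⁻¹ * ⟪M k ω, M (k + 1) ω⟫ ≤ ‖M (k + 1) ω‖ := by
      rw [← real_inner_smul_left]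
      exact (real_inner_le_norm _ _).trans (mul_le_of_le_one_left (norm_nonneg _) (hunit ω))
    have h3 : ‖M k ω‖⁻¹ * ‖M k ω‖ ^ 2 = ‖M k ω‖ := by
      rcases eq_or_ne ‖M k ω‖ 0 with h | h
      · simp [h]
      · field_simp
    rw [h1, mul_sub, h3]
    linarith
  have hsum : 0 ≤ ∫ ω, ∑ k ∈ Finset.range n, S k ω * (‖M (k + 1) ω‖ - ‖M k ω‖) ∂P := by
    rw [integral_finsetSum _ fun k _ => hprod k]
    exact Finset.sum_nonneg fun k _ => hstep k
  have hle : ∫ ω, (S n ω ^ 2 + 4 * ∑ k ∈ Finset.range n, S k ω * (‖M (k + 1) ω‖ - ‖M k ω‖)) ∂P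
      ≤ ∫ ω, 4 * ‖M n ω‖ ^ 2 ∂P :=
    integral_mono ((hSL n).integrable_sq.add
      ((integrable_finsetSum _ fun k _ => hprod k).const_mul 4))
      ((hM n).norm.integrable_sq.const_mul 4)
      fun ω => runningMax_sq_add_le (fun k => ‖M k ω‖) n
  rw [integral_add (hSL n).integrable_sq
    ((integrable_finsetSum _ fun k _ => hprod k).const_mul 4),
    integral_const_mul, integral_const_mul] at hle
  linarith

/-- **Doob's `L²` maximal inequality** in continuous time, with a measurable majorant of the
running supremum. -/
lemma exists_majorant_lintegral_le {M : ℝ≥0 → Ω → E} (hM : ∀ t, MemLp (M t) 2 P)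
    (hm : ∀ t, Measurable (M t))
    (hind : ∀ s t : ℝ≥0, s ≤ t →
      IndepFun (fun ω => M t ω - M s ω) (fun ω (r : Set.Iic s) => M r ω) P)
    (hmean : ∀ s t : ℝ≥0, s ≤ t → ∫ ω, (M t ω - M s ω) ∂P = 0)
    (hrc : ∀ᵐ ω ∂P, ∀ t, ContinuousWithinAt (fun t => M t ω) (Set.Ici t) t) (T : ℝ≥0) :
    ∃ g : Ω → ℝ≥0∞, Measurable g ∧ (∀ᵐ ω ∂P, ∀ t ≤ T, ‖M t ω‖ₑ ^ 2 ≤ g ω) ∧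
      ∫⁻ ω, g ω ∂P ≤ 4 * ∫⁻ ω, ‖M T ω‖ₑ ^ 2 ∂P := by
  -- `n + 1` equal steps, so that `T` itself is the grid point of index `n + 1`.
  set grid : ℕ → ℕ → ℝ≥0 := fun n k => T * k / (n + 1) with hgrid
  have hmono : ∀ n, Monotone (grid n) := fun n i j hij => by
    simp only [hgrid]; gcongr
  set G : ℕ → Ω → ℝ := fun n ω => runningMax (fun k => ‖M (grid n k) ω‖) (n + 1) with hG
  have hGm : ∀ n, Measurable (G n) := fun n => measurable_runningMax (fun k => (hm _).norm) _
  have hGL : ∀ n, MemLp (G n) 2 P := fun n => memLp_runningMax (fun k => (hM _).norm) _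
  have hlast : ∀ n, grid n (n + 1) = T := fun n => by
    simp only [hgrid]; push_cast; field_simp
  have hbound : ∀ n, ∫⁻ ω, ENNReal.ofReal (G n ω ^ 2) ∂P ≤ 4 * ∫⁻ ω, ‖M T ω‖ₑ ^ 2 ∂P := by
    intro n
    have h1 := integral_runningMax_sq_le (P := P) (M := fun k => M (grid n k)) (fun k => hM _)
      (fun k => hm _) (fun k => ?_) (fun k => hmean _ _ (hmono n k.le_succ)) (n + 1)
    · rw [hlast] at h1
      rw [← ofReal_integral_eq_lintegral_ofReal (hGL n).integrable_sq
        (.of_forall fun ω => sq_nonneg _)]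
      refine (ENNReal.ofReal_le_ofReal h1).trans_eq ?_
      rw [ENNReal.ofReal_mul (by norm_num), ofReal_integral_eq_lintegral_ofReal
        (hM T).norm.integrable_sq (.of_forall fun ω => sq_nonneg _)]
      simp [ENNReal.ofReal_pow]
    · refine ((hind _ _ (hmono n k.le_succ)).symm.comp
        (φ := fun f (j : Set.Iic k) => f ⟨grid n j, hmono n j.2⟩) ?_ measurable_id)
      fun_prop
  -- The liminf of the grid maxima is measurable, unlike an uncountable supremum, and Fatou bounds
  -- its integral.
  refine ⟨fun ω => liminf (fun n => ENNReal.ofReal (G n ω ^ 2)) atTop,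
    .liminf fun n => by have := hGm n; fun_prop, ?_, ?_⟩
  · filter_upwards [hrc] with ω hω t ht
    -- Round `t` up to the grid: right-continuity requires an approach from the right.
    set j : ℕ → ℕ := fun n => ⌈(t : ℝ) * (n + 1) / T⌉₊ with hj
    have hjle : ∀ n, j n ≤ n + 1 := by
      intro n
      refine Nat.ceil_le.2 ?_
      push_cast
      exact div_le_of_le_mul₀ T.2 (by positivity) (by
        have : (t : ℝ) ≤ T := ht
        nlinarith [(n.cast_nonneg : (0:ℝ) ≤ n)])
    have hconv : Tendsto (fun n => ‖M (grid n (j n)) ω‖ₑ ^ 2) atTop (𝓝 (‖M t ω‖ₑ ^ 2)) := by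
      rcases eq_or_ne T 0 with hT | hT
      · have ht0 : t = 0 := by simpa [hT] using ht
        simp [hgrid, hT, ht0]
      have hT' : (0 : ℝ) < T := by positivity
      have hge : ∀ n, t ≤ grid n (j n) := by
        intro n
        rw [← NNReal.coe_le_coe]
        simp only [hgrid]
        push_cast
        rw [le_div_iff₀ (by positivity)]
        have := Nat.le_ceil ((t : ℝ) * (n + 1) / T)
        rw [div_le_iff₀ hT'] at this
        linarith
      have hle : ∀ n, (grid n (j n) : ℝ) ≤ t + T * (1 / ((n : ℝ) + 1)) := by
        intro n
        simp only [hgrid]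
        push_cast
        rw [div_le_iff₀ (by positivity)]
        have := (Nat.ceil_lt_add_one (a := (t : ℝ) * (n + 1) / T) (by positivity)).le
        have h2 : (t : ℝ) * (n + 1) / T * T = t * (n + 1) := by field_simp
        have h3 : (t + T * (1 / ((n : ℝ) + 1))) * (n + 1) = t * (n + 1) + T := by field_simp
        rw [h3]
        nlinarith
      have hlim : Tendsto (fun n => grid n (j n)) atTop (𝓝[≥] t) := by
        refine tendsto_nhdsWithin_iff.2 ⟨?_, .of_forall hge⟩
        rw [← NNReal.tendsto_coe]
        have hup : Tendsto (fun n : ℕ => (t : ℝ) + T * (1 / ((n : ℝ) + 1))) atTop (𝓝 t) := by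
          simpa using (tendsto_one_div_add_atTop_nhds_zero_nat (𝕜 := ℝ)).const_mul (T : ℝ)
            |>.const_add (t : ℝ)
        exact tendsto_of_tendsto_of_tendsto_of_le_of_le tendsto_const_nhds hup
          (fun n => NNReal.coe_le_coe.2 (hge n)) hle
      exact ((ENNReal.continuous_pow 2).tendsto _).comp ((hω t).tendsto.enorm.comp hlim)
    rw [← hconv.liminf_eq]
    refine liminf_le_liminf (.of_forall fun n => ?_)
    rw [← ofReal_norm, ← ENNReal.ofReal_pow (norm_nonneg _)]
    exact ENNReal.ofReal_le_ofReal (pow_le_pow_left₀ (norm_nonneg _)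
      (le_runningMax (fun k => ‖M (grid n k) ω‖) (hjle n)) 2)
  · refine (lintegral_liminf_le fun n => by have := hGm n; fun_prop).trans ?_
    exact liminf_le_of_le (by isBoundedDefault) fun b hb => by
      obtain ⟨n, hn⟩ := hb.exists
      exact hn.trans (hbound n)

end MaximalInequality


/-! ### Restarting an iid sequence -/

section Glue

variable {S : Type*} [MeasurableSpace S]

/-- The law of an iid sequence. -/
noncomputable abbrev iidMeasure (μ : Measure S) : Measure (ℕ → S) := Measure.infinitePi fun _ => μ

/-- The sequence that follows `x` up to index `n` and continues with `y`. -/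
def glue (n : ℕ) (x y : ℕ → S) (i : ℕ) : S := if i < n then x i else y (i - n)

lemma glue_of_lt {n i : ℕ} (h : i < n) (x y : ℕ → S) : glue n x y i = x i := if_pos h

@[simp] lemma glue_add (n i : ℕ) (x y : ℕ → S) : glue n x y (n + i) = y i := by simp [glue]

@[fun_prop] lemma measurable_glue (n : ℕ) :
    Measurable fun p : (ℕ → S) × (ℕ → S) => glue n p.1 p.2 := by
  refine measurable_pi_lambda _ fun i => ?_
  simp only [glue]
  split_ifs <;> fun_prop

/-- Replacing the tail of an iid sequence by a fresh copy keeps its law, as one sees on cylinders.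
Conditioning on the first `n` terms thereby becomes Fubini. -/
lemma measurePreserving_glue (μ : Measure S) [IsProbabilityMeasure μ] (n : ℕ) :
    MeasurePreserving (fun p : (ℕ → S) × (ℕ → S) => glue n p.1 p.2)
      ((iidMeasure μ).prod (iidMeasure μ)) (iidMeasure μ) := by
  refine ⟨measurable_glue n, Measure.eq_infinitePi _ fun s t ht => ?_⟩
  rw [Measure.map_apply (measurable_glue n) (.pi s.countable_toSet fun i _ => ht i)]
  have : (fun p : (ℕ → S) × (ℕ → S) => glue n p.1 p.2) ⁻¹' (Set.pi s t)
      = (Set.pi ((s.filter (· < n) : Finset ℕ) : Set ℕ) t)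
        ×ˢ (Set.pi (((s.filter (¬ · < n)).image (· - n) : Finset ℕ) : Set ℕ)
          fun i => t (n + i)) := by
    ext ⟨x, y⟩
    simp only [Set.mem_preimage, Set.mem_pi, Set.mem_prod, Finset.coe_filter, Finset.coe_image,
      Set.mem_image, Finset.mem_coe]
    constructor
    · intro h
      refine ⟨fun i hi => by simpa [glue, hi.2] using h i hi.1, ?_⟩
      rintro _ ⟨i, ⟨hi, hin⟩, rfl⟩
      have := h i hi
      rwa [glue, if_neg hin, ← Nat.add_sub_of_le (not_lt.1 hin), Nat.add_sub_cancel_left] at this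
    · rintro ⟨h1, h2⟩ i hi
      by_cases hin : i < n
      · simpa [glue, hin] using h1 i ⟨hi, hin⟩
      · have := h2 (i - n) ⟨i, ⟨hi, hin⟩, rfl⟩
        rw [Nat.add_sub_of_le (not_lt.1 hin)] at this
        simpa [glue, hin] using this
  rw [this, Measure.prod_prod, Measure.infinitePi_pi _ fun i _ => ht i,
    Measure.infinitePi_pi _ fun i _ => ht _, Finset.prod_image, 
    ← Finset.prod_filter_mul_prod_filter_not s (· < n)]
  · congr 1
    refine Finset.prod_congr rfl fun i hi => ?_
    rw [Nat.add_sub_of_le (not_lt.1 (Finset.mem_filter.1 hi).2)]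
  · intro i hi j hj hij
    simp only [Finset.coe_filter, Set.mem_ofPred_eq, not_lt] at hi hj
    simp only at hij
    omega

lemma lintegral_glue (μ : Measure S) [IsProbabilityMeasure μ] (n : ℕ) {F : (ℕ → S) → ℝ≥0∞}
    (hF : Measurable F) :
    ∫⁻ x, F x ∂(iidMeasure μ)
      = ∫⁻ x, ∫⁻ y, F (glue n x y) ∂(iidMeasure μ) ∂(iidMeasure μ) := by
  rw [← (measurePreserving_glue μ n).lintegral_comp hF, lintegral_prod _ (by fun_prop)]

end Glue

/-! ### Memorylessness of the exponential law -/

section Exponential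

variable {r : ℝ}

lemma lintegral_expMeasure (r : ℝ) {g : ℝ → ℝ≥0∞} (hg : Measurable g) :
    ∫⁻ x, g x ∂(expMeasure r)
      = ∫⁻ x, (Set.Ici 0).indicator (fun x => ENNReal.ofReal (r * Real.exp (-(r * x)))) x * g x := by
  have h : expMeasure r = volume.withDensity (exponentialPDF r) := rfl
  rw [h, lintegral_withDensity_eq_lintegral_mul _ (by unfold exponentialPDF; fun_prop) hg]
  refine lintegral_congr fun x => ?_
  rw [Pi.mul_apply, exponentialPDF_eq]
  by_cases hx : 0 ≤ x
  · simp [hx]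
  · simp [hx]

/-- Memorylessness of the exponential distribution. -/
lemma lintegral_expMeasure_shift {a : ℝ} (ha : 0 ≤ a) {g : ℝ → ℝ≥0∞}
    (hg : Measurable g) :
    ∫⁻ x, (Set.Ioi a).indicator (fun x => g (x - a)) x ∂(expMeasure r)
      = ENNReal.ofReal (Real.exp (-(r * a))) * ∫⁻ x, g x ∂(expMeasure r) := by
  rw [lintegral_expMeasure r (Measurable.indicator (by fun_prop) measurableSet_Ioi),
    lintegral_expMeasure r hg, ← lintegral_const_mul _ ((Measurable.indicator
      (by fun_prop) measurableSet_Ici).fun_mul hg),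
    ← lintegral_add_right_eq_self (μ := (volume : Measure ℝ)) _ a]
  refine lintegral_congr_ae ?_
  -- After translation the two sides use `Ioi 0` and `Ici 0`, which differ only at the null point
  -- `0`.
  have h0 : ∀ᵐ x : ℝ, x ≠ 0 := Measure.ae_ne volume 0
  filter_upwards [h0] with x hx
  rcases lt_or_gt_of_ne hx with h | h
  · simp [h.le, h]
  · have h1 : 0 ≤ x + a := by positivity
    simp only [Set.indicator, Set.mem_Ici, Set.mem_Ioi, h1, h.le, if_true, lt_add_iff_pos_left, h,
      add_sub_cancel_right, ← mul_assoc]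
    rw [← ENNReal.ofReal_mul (Real.exp_pos _).le, mul_left_comm, ← Real.exp_add]
    ring_nf

lemma expMeasure_Ioi (hr : 0 < r) {a : ℝ} (ha : 0 ≤ a) :
    expMeasure r (Set.Ioi a) = ENNReal.ofReal (Real.exp (-(r * a))) := by
  have := isProbabilityMeasure_expMeasure hr
  have h := lintegral_expMeasure_shift (r := r) ha (g := fun _ => 1) measurable_const
  simpa using h

lemma ae_pos_expMeasure (hr : 0 < r) : ∀ᵐ x ∂(expMeasure r), 0 < x := by
  have := isProbabilityMeasure_expMeasure hr
  have h : expMeasure r (Set.Ioi 0) = 1 := by simp [expMeasure_Ioi hr le_rfl]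
  exact (prob_compl_eq_zero_iff measurableSet_Ioi).2 h

/-- Subtract `a` from the first term. -/
def shiftHead (a : ℝ) (x : ℕ → ℝ) (i : ℕ) : ℝ := if i = 0 then x 0 - a else x i

@[fun_prop] lemma measurable_shiftHead (a : ℝ) : Measurable (shiftHead a) := by
  refine measurable_pi_lambda _ fun i => ?_
  simp only [shiftHead]
  split_ifs <;> fun_prop

/-- Memorylessness for the whole sequence: given that the first waiting time exceeds `a`, the
remaining waiting times are again iid exponential. The normalised image measure is identified on
cylinders. -/
lemma lintegral_iidMeasure_exp_shift (hr : 0 < r) {a : ℝ} (ha : 0 ≤ a) {g : (ℕ → ℝ) → ℝ≥0∞}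
    (hg : Measurable g) :
    ∫⁻ x, {x : ℕ → ℝ | a < x 0}.indicator (fun x => g (shiftHead a x)) x
        ∂(iidMeasure (expMeasure r))
      = ENNReal.ofReal (Real.exp (-(r * a))) * ∫⁻ x, g x ∂(iidMeasure (expMeasure r)) := by
  have := isProbabilityMeasure_expMeasure hr
  set c := ENNReal.ofReal (Real.exp (-(r * a))) with hc
  have hc0 : c ≠ 0 := by simp [hc, Real.exp_pos]
  have hcT : c ≠ ∞ := ENNReal.ofReal_ne_top
  have hm : MeasurableSet {x : ℕ → ℝ | a < x 0} := measurableSet_lt (by fun_prop) (by fun_prop)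
  have key : c⁻¹ • ((iidMeasure (expMeasure r)).restrict {x | a < x 0}).map (shiftHead a)
      = iidMeasure (expMeasure r) := by
    refine Measure.eq_infinitePi _ fun s t ht => ?_
    have hmeas : MeasurableSet (Set.pi (s : Set ℕ) t) := .pi s.countable_toSet fun i _ => ht i
    rw [Measure.smul_apply, Measure.map_apply (measurable_shiftHead a) hmeas,
      Measure.restrict_apply (measurable_shiftHead a hmeas)]
    classical
    -- The index `0` always carries the constraint `a < x 0` but may be missing from `s`, so the
    -- cylinder is padded with `univ` and `s` enlarged by `0`.
    set t' : ℕ → Set ℝ := fun i => if i ∈ s then t i else Set.univ with ht'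
    have ht'm : ∀ i, MeasurableSet (t' i) := fun i => by
      simp only [ht']; split_ifs; exacts [ht i, .univ]
    set u : ℕ → Set ℝ := fun i => if i = 0 then {x | a < x ∧ x - a ∈ t' 0} else t' i with hu
    have hum : ∀ i, MeasurableSet (u i) := fun i => by
      simp only [hu]
      split_ifs
      · exact measurableSet_Ioi.inter ((measurable_id.sub_const a) (ht'm 0))
      · exact ht'm i
    have hset : shiftHead a ⁻¹' Set.pi s t ∩ {x | a < x 0}
        = Set.pi ((insert 0 s : Finset ℕ) : Set ℕ) u := by
      ext x
      simp only [Set.mem_inter_iff, Set.mem_preimage, Set.mem_pi, Finset.mem_coe,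
        Set.mem_ofPred_eq, Finset.mem_insert, hu, ht', shiftHead]
      constructor
      · rintro ⟨h1, h2⟩ i hi
        by_cases h0 : i = 0
        · subst h0
          simp only [if_true, Set.mem_ofPred_eq]
          refine ⟨h2, ?_⟩
          split_ifs with h
          · simpa using h1 0 h
          · trivial
        · have hi' := hi.resolve_left h0
          simpa [h0, hi'] using h1 i hi'
      · intro h
        have h00 := h 0 (.inl rfl)
        simp only [if_true, Set.mem_ofPred_eq] at h00
        refine ⟨fun i hi => ?_, h00.1⟩
        by_cases h0 : i = 0
        · subst h0
          simpa [hi] using h00.2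
        · simpa [h0, hi] using h i (.inr hi)
    have h0 : expMeasure r (u 0) = c * expMeasure r (t' 0) := by
      rw [← lintegral_indicator_one (hum 0), ← lintegral_indicator_one (ht'm 0), hc,
        ← lintegral_expMeasure_shift ha (measurable_one.indicator (ht'm 0))]
      refine lintegral_congr fun x => ?_
      simp only [Set.indicator, hu, if_true, Set.mem_ofPred_eq, Set.mem_Ioi, Pi.one_apply]
      split_ifs <;> simp_all
    rw [hset, Measure.infinitePi_pi _ fun i _ => hum i,
      ← Finset.mul_prod_erase _ _ (Finset.mem_insert_self 0 s), h0, smul_eq_mul, ← mul_assoc,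
      ← mul_assoc, ENNReal.inv_mul_cancel hc0 hcT, one_mul]
    have h1 : ∏ i ∈ (insert 0 s).erase 0, expMeasure r (u i)
        = ∏ i ∈ (insert 0 s).erase 0, expMeasure r (t' i) :=
      Finset.prod_congr rfl fun i hi => by simp [hu, Finset.ne_of_mem_erase hi]
    rw [h1, Finset.mul_prod_erase _ (fun i => expMeasure r (t' i)) (Finset.mem_insert_self 0 s)]
    rw [← Finset.prod_subset (Finset.subset_insert 0 s) (fun i _ hi => by simp [ht', hi])]
    exact Finset.prod_congr rfl fun i hi => by simp [ht', hi]
  conv_rhs => rw [← key]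
  rw [lintegral_smul_measure, smul_eq_mul, ← mul_assoc, ENNReal.mul_inv_cancel hc0 hcT, one_mul,
    lintegral_map hg (measurable_shiftHead a), lintegral_indicator hm]

end Exponential


/-! ### Arrival times and the Poisson count -/

section Renewal

/-- The `n`-th arrival time for the waiting times `x`. -/
def arrival (x : ℕ → ℝ) (n : ℕ) : ℝ := ∑ i ∈ Finset.range n, x i

/-- The number of arrivals up to time `t`. -/
noncomputable def renewalCount (t : ℝ) (x : ℕ → ℝ) : ℕ := sInf {k | t < arrival x (k + 1)}

/-- Waiting times that are positive and not summable. -/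
structure IsGoodWaiting (x : ℕ → ℝ) : Prop where
  pos : ∀ i, 0 < x i
  exists_lt : ∀ t, ∃ k, t < arrival x (k + 1)

@[simp] lemma arrival_zero (x : ℕ → ℝ) : arrival x 0 = 0 := by simp [arrival]

lemma arrival_mono {x : ℕ → ℝ} (hx : ∀ i, 0 < x i) : Monotone (arrival x) :=
  monotone_nat_of_le_succ fun n => by simp [arrival, Finset.sum_range_succ, (hx n).le]

lemma arrival_glue_add (n k : ℕ) (x y : ℕ → ℝ) :
    arrival (glue n x y) (n + k) = arrival x n + arrival y k := by
  simp only [arrival, Finset.sum_range_add, glue_add]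
  congr 1
  exact Finset.sum_congr rfl fun _ hi => glue_of_lt (Finset.mem_range.1 hi) _ _

lemma arrival_glue_of_le {n k : ℕ} (h : k ≤ n) (x y : ℕ → ℝ) :
    arrival (glue n x y) k = arrival x k :=
  Finset.sum_congr rfl fun _ hi => glue_of_lt ((Finset.mem_range.1 hi).trans_le h) _ _

lemma arrival_shiftHead (a : ℝ) (x : ℕ → ℝ) (k : ℕ) :
    arrival (shiftHead a x) (k + 1) = arrival x (k + 1) - a := by
  simp only [arrival, Finset.sum_range_succ', shiftHead]
  simp
  ring

@[fun_prop] lemma measurable_arrival (n : ℕ) : Measurable fun x => arrival x n := by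
  unfold arrival; fun_prop

namespace IsGoodWaiting

variable {x y : ℕ → ℝ} {s t : ℝ}

lemma lt_count_iff (hx : IsGoodWaiting x) {k : ℕ} : k < renewalCount t x ↔ arrival x (k + 1) ≤ t := by
  refine ⟨fun h => not_lt.1 fun h' => ?_, fun h => not_le.1 fun h' => ?_⟩
  · exact Nat.notMem_of_lt_sInf h h'
  · have h1 : t < arrival x (renewalCount t x + 1) := Nat.sInf_mem (hx.exists_lt t)
    exact absurd (h1.trans_le (arrival_mono hx.pos (Nat.succ_le_succ h'))) (not_lt.2 h)

lemma lt_arrival_count (hx : IsGoodWaiting x) : t < arrival x (renewalCount t x + 1) :=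
  Nat.sInf_mem (hx.exists_lt t)

lemma arrival_count_le (hx : IsGoodWaiting x) (ht : 0 ≤ t) : arrival x (renewalCount t x) ≤ t := by
  rcases h : renewalCount t x with _ | k
  · simpa using ht
  · exact hx.lt_count_iff.1 (h ▸ Nat.lt_succ_self k)

lemma count_eq_iff (hx : IsGoodWaiting x) (ht : 0 ≤ t) {n : ℕ} :
    renewalCount t x = n ↔ arrival x n ≤ t ∧ t < arrival x (n + 1) := by
  constructor
  · rintro rfl
    exact ⟨hx.arrival_count_le ht, hx.lt_arrival_count⟩
  · rintro ⟨h1, h2⟩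
    refine le_antisymm (not_lt.1 fun h => absurd h2 (not_lt.2 (hx.lt_count_iff.1 h))) ?_
    rcases n with _ | n
    · exact Nat.zero_le _
    · exact hx.lt_count_iff.2 h1

lemma count_zero (hx : IsGoodWaiting x) : renewalCount 0 x = 0 :=
  (hx.count_eq_iff le_rfl).2 ⟨by simp, by simpa [arrival] using hx.pos 0⟩

lemma glue (hx : IsGoodWaiting x) (hy : IsGoodWaiting y) (n : ℕ) :
    IsGoodWaiting (glue n x y) where
  pos i := by unfold LevyConstruction.glue; split_ifs; exacts [hx.pos _, hy.pos _]
  exists_lt t := by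
    obtain ⟨k, hk⟩ := hy.exists_lt (t - arrival x n)
    exact ⟨n + k, by rw [add_assoc, arrival_glue_add]; linarith⟩

lemma shiftHead (hx : IsGoodWaiting x) {a : ℝ} (ha : a < x 0) :
    IsGoodWaiting (shiftHead a x) where
  pos i := by
    unfold LevyConstruction.shiftHead
    split_ifs
    · linarith
    · exact hx.pos i
  exists_lt t := by
    obtain ⟨k, hk⟩ := hx.exists_lt (t + a)
    exact ⟨k, by rw [arrival_shiftHead]; linarith⟩

lemma count_glue_eq_iff (hx : IsGoodWaiting x) (hy : IsGoodWaiting y) (ht : 0 ≤ t) (n : ℕ) :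
    renewalCount t (LevyConstruction.glue n x y) = n ↔ arrival x n ≤ t ∧ t - arrival x n < y 0 := by
  rw [(hx.glue hy n).count_eq_iff ht, arrival_glue_of_le le_rfl, arrival_glue_add,
    sub_lt_iff_lt_add']
  simp [arrival]

/-- When exactly `n` arrivals have occurred by time `s`, the pending waiting time has already run
for `s - arrival x n`. Counting after `s` is therefore counting from zero with the first waiting
time shortened by that amount. -/
lemma count_glue_add (hx : IsGoodWaiting x) (hy : IsGoodWaiting y) (hs : 0 ≤ s) (ht : 0 ≤ t)
    {n : ℕ} (h1 : arrival x n ≤ s) (h2 : s - arrival x n < y 0) :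
    renewalCount (s + t) (LevyConstruction.glue n x y)
      = n + renewalCount t (LevyConstruction.shiftHead (s - arrival x n) y) := by
  have hy' := hy.shiftHead h2
  rw [(hx.glue hy n).count_eq_iff (add_nonneg hs ht), add_assoc, arrival_glue_add,
    arrival_glue_add]
  have e1 := hy'.lt_arrival_count (t := t)
  have e2 := hy'.arrival_count_le ht
  rw [arrival_shiftHead] at e1
  refine ⟨?_, by linarith⟩
  rcases hk : renewalCount t (LevyConstruction.shiftHead (s - arrival x n) y) with _ | k
  · simp; linarith
  · rw [hk, arrival_shiftHead] at e2
    linarith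

/-- The arrival of index `n + 1` comes after `s`, so up to time `s` the fresh waiting times `y` are
invisible. -/
lemma count_of_glue_lt (hx : IsGoodWaiting x) (hy : IsGoodWaiting y) {n : ℕ}
    (h2 : s - arrival x n < y 0) (hts : t ≤ s) :
    Finset.range (renewalCount t (LevyConstruction.glue n x y))
      = (Finset.range n).filter fun k => arrival x (k + 1) ≤ t := by
  ext k
  simp only [Finset.mem_range, Finset.mem_filter, (hx.glue hy n).lt_count_iff]
  by_cases hk : k < n
  · simp [hk, arrival_glue_of_le (Nat.succ_le_of_lt hk)]
  · simp only [hk, false_and, iff_false, not_le]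
    refine hts.trans_lt (lt_of_lt_of_le ?_ (arrival_mono (hx.glue hy n).pos
      (add_le_add_left (not_lt.1 hk) 1)))
    rw [arrival_glue_add]
    simp [arrival] at h2 ⊢
    linarith

end IsGoodWaiting

@[fun_prop] lemma measurable_renewalCount (t : ℝ) : Measurable (renewalCount t) := by
  have hs : ∀ n, MeasurableSet {x : ℕ → ℝ | t < arrival x n} := fun n =>
    measurableSet_lt measurable_const (measurable_arrival n)
  refine measurable_to_countable' fun n => ?_
  -- The second piece is the set of sequences that never pass `t`, where `sInf ∅ = 0`.
  have : renewalCount t ⁻¹' {n}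
      = ({x | t < arrival x (n + 1)} ∩ ⋂ k < n, {x | t < arrival x (k + 1)}ᶜ)
        ∪ (if n = 0 then ⋂ k, {x | t < arrival x (k + 1)}ᶜ else ∅) := by
    ext x
    simp only [Set.mem_preimage, Set.mem_singleton_iff, Set.mem_union, Set.mem_inter_iff,
      Set.mem_iInter, Set.mem_compl_iff, Set.mem_ofPred_eq]
    by_cases hne : {k | t < arrival x (k + 1)}.Nonempty
    · constructor
      · rintro rfl
        exact .inl ⟨Nat.sInf_mem hne, fun k hk => Nat.notMem_of_lt_sInf hk⟩
      · rintro (⟨h1, h2⟩ | h)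
        · exact le_antisymm (Nat.sInf_le h1) (not_lt.1 fun h => h2 _ h (Nat.sInf_mem hne))
        · split_ifs at h with h0
          · obtain ⟨k, hk⟩ := hne
            exact absurd hk (by simpa using Set.mem_iInter.1 h k)
          · exact h.elim
    · have hempty := Set.not_nonempty_iff_eq_empty.1 hne
      have h0 : renewalCount t x = 0 := by rw [renewalCount, hempty, Nat.sInf_empty]
      have hall : ∀ k, arrival x (k + 1) ≤ t := fun k => not_lt.1 fun hk => hne ⟨k, hk⟩
      rw [h0]
      constructor
      · rintro rfl
        simpa using .inr hall
      · rintro (⟨h1, -⟩ | h)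
        · exact absurd h1 (not_lt.2 (hall n))
        · split_ifs at h with hn
          · exact hn.symm
          · exact h.elim
  rw [this]
  refine ((hs _).inter (.biInter (Set.to_countable _) fun k _ => (hs _).compl)).union ?_
  split_ifs
  exacts [.iInter fun k => (hs _).compl, .empty]

variable {r : ℝ}

lemma ae_pos_iidMeasure_exp (hr : 0 < r) : ∀ᵐ x ∂(iidMeasure (expMeasure r)), ∀ i, 0 < x i := by
  have := isProbabilityMeasure_expMeasure hr
  exact ae_all_iff.2 fun i =>
    (measurePreserving_eval_infinitePi (fun _ : ℕ => expMeasure r) i).quasiMeasurePreserving.ae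
      (ae_pos_expMeasure hr)

/-- The factor `exp (r * arrival x n)` cancels the product of the exponential densities. What is
left is `r ^ n` times the volume of a simplex, computed by integrating out the first waiting time.
-/
lemma lintegral_exp_arrival (hr : 0 < r) (n : ℕ) {t : ℝ} (ht : 0 ≤ t) :
    ∫⁻ x, {x | arrival x n ≤ t}.indicator (fun x => ENNReal.ofReal (Real.exp (r * arrival x n))) x
        ∂(iidMeasure (expMeasure r))
      = ENNReal.ofReal ((r * t) ^ n / n.factorial) := by
  have := isProbabilityMeasure_expMeasure hr
  have hmeas : ∀ n (t : ℝ), Measurable ({x | arrival x n ≤ t}.indicator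
      (fun x => ENNReal.ofReal (Real.exp (r * arrival x n)))) := fun n t =>
    Measurable.indicator (by fun_prop) (measurableSet_le (by fun_prop) (by fun_prop))
  induction n generalizing t with
  | zero => simp [ht]
  | succ n ih =>
    rw [lintegral_glue _ 1 (hmeas _ _)]
    have hG : Measurable fun u : ℝ => (Set.Iic t).indicator (fun u =>
        ENNReal.ofReal (Real.exp (r * u)) * ENNReal.ofReal ((r * (t - u)) ^ n / n.factorial)) u :=
      Measurable.indicator (by fun_prop) measurableSet_Iic
    have hinner : ∀ᵐ x ∂(iidMeasure (expMeasure r)),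
        ∫⁻ y, {x | arrival x (n + 1) ≤ t}.indicator
            (fun x => ENNReal.ofReal (Real.exp (r * arrival x (n + 1)))) (glue 1 x y)
            ∂(iidMeasure (expMeasure r))
          = (Set.Iic t).indicator (fun u => ENNReal.ofReal (Real.exp (r * u))
            * ENNReal.ofReal ((r * (t - u)) ^ n / n.factorial)) (x 0) := by
      filter_upwards [ae_pos_iidMeasure_exp hr] with x hx
      have e : ∀ y, arrival (glue 1 x y) (n + 1) = x 0 + arrival y n := fun y => by
        rw [add_comm n, arrival_glue_add]; simp [arrival]
      by_cases hxt : x 0 ≤ t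
      · rw [Set.indicator_of_mem (Set.mem_Iic.2 hxt), ← ih (sub_nonneg.2 hxt),
          ← lintegral_const_mul _ (hmeas _ _)]
        refine lintegral_congr fun y => ?_
        simp only [Set.indicator, Set.mem_ofPred_eq, e, le_sub_iff_add_le']
        split_ifs
        · rw [← ENNReal.ofReal_mul (Real.exp_pos _).le, ← Real.exp_add, mul_add]
        · simp
      · rw [Set.indicator_of_notMem (by simpa using hxt), ← lintegral_zero]
        refine lintegral_congr_ae ?_
        filter_upwards [ae_pos_iidMeasure_exp hr] with y hy
        refine Set.indicator_of_notMem ?_ _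
        have : 0 ≤ arrival y n := Finset.sum_nonneg fun i _ => (hy i).le
        simp only [Set.mem_ofPred_eq, e, not_le]
        linarith [not_le.1 hxt]
    rw [lintegral_congr_ae hinner,
      (measurePreserving_eval_infinitePi (fun _ : ℕ => expMeasure r) 0).lintegral_comp hG,
      lintegral_expMeasure r hG]
    have hcont : Continuous fun u : ℝ => r * ((r * (t - u)) ^ n / n.factorial) := by fun_prop
    have h1 : ∀ u : ℝ, (Set.Ici 0).indicator (fun x => ENNReal.ofReal (r * Real.exp (-(r * x)))) u *
        (Set.Iic t).indicator (fun u => ENNReal.ofReal (Real.exp (r * u))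
          * ENNReal.ofReal ((r * (t - u)) ^ n / n.factorial)) u
        = (Set.Icc 0 t).indicator
          (fun u => ENNReal.ofReal (r * ((r * (t - u)) ^ n / n.factorial))) u := by
      intro u
      simp only [Set.indicator, Set.mem_Ici, Set.mem_Iic, Set.mem_Icc]
      by_cases h0 : 0 ≤ u <;> by_cases h2 : u ≤ t <;> simp only [h0, h2, if_true, if_false,
        and_true, and_false, and_self, zero_mul, mul_zero]
      rw [← mul_assoc, ← ENNReal.ofReal_mul (by positivity), mul_assoc r, ← Real.exp_add]
      simp [ENNReal.ofReal_mul hr.le]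
    simp only [h1]
    rw [lintegral_indicator measurableSet_Icc, ← ofReal_integral_eq_lintegral_ofReal
      (hcont.integrableOn_Icc), integral_Icc_eq_integral_Ioc,
      ← intervalIntegral.integral_of_le ht]
    · congr 1
      have h2 : ∫ u in (0 : ℝ)..t, r * ((r * (t - u)) ^ n / n.factorial)
          = r ^ (n + 1) / n.factorial * ∫ u in (0 : ℝ)..t, (t - u) ^ n := by
        rw [← intervalIntegral.integral_const_mul]
        refine intervalIntegral.integral_congr fun u _ => ?_
        simp only [mul_pow]
        ring
      rw [h2, intervalIntegral.integral_comp_sub_left (fun u => u ^ n) t]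
      simp only [sub_self, sub_zero, integral_pow, Nat.factorial_succ]
      push_cast
      field_simp
      simp [mul_pow]
    · refine (ae_restrict_iff' measurableSet_Icc).2 (.of_forall fun u hu => ?_)
      have := sub_nonneg.2 hu.2
      positivity

/-- Given the first `n` waiting times, the next one must exceed `t - arrival x n`. That tail
probability is `exp (-(r * t))` times the weight whose integral is already known. -/
lemma measure_arrival_le_lt (hr : 0 < r) (n : ℕ) {t : ℝ} (ht : 0 ≤ t) :
    iidMeasure (expMeasure r) {x | arrival x n ≤ t ∧ t < arrival x (n + 1)}
      = ENNReal.ofReal (Real.exp (-(r * t)) * (r * t) ^ n / n.factorial) := by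
  have := isProbabilityMeasure_expMeasure hr
  have hm : MeasurableSet {x | arrival x n ≤ t ∧ t < arrival x (n + 1)} :=
    (measurableSet_le (measurable_arrival n) measurable_const).inter
      (measurableSet_lt measurable_const (measurable_arrival (n + 1)))
  rw [← lintegral_indicator_one hm, lintegral_glue _ n (measurable_one.indicator hm),
    mul_div_assoc, ENNReal.ofReal_mul (Real.exp_pos _).le, ← lintegral_exp_arrival hr n ht,
    ← lintegral_const_mul _ (Measurable.indicator (by fun_prop)
      (measurableSet_le (by fun_prop) (by fun_prop)))]
  refine lintegral_congr fun x => ?_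
  have e : ∀ y, ({x | arrival x n ≤ t ∧ t < arrival x (n + 1)}.indicator 1 (glue n x y) : ℝ≥0∞)
      = {x | arrival x n ≤ t}.indicator 1 x * {y | t - arrival x n < y 0}.indicator 1 y := by
    intro y
    have e1 : arrival y 1 = y 0 := by simp [arrival]
    simp only [Set.indicator, Set.mem_ofPred_eq, arrival_glue_of_le le_rfl, arrival_glue_add,
      sub_lt_iff_lt_add', e1]
    by_cases h1 : arrival x n ≤ t <;> by_cases h2 : t < arrival x n + y 0 <;> simp [h1, h2]
  simp only [e]
  by_cases h1 : arrival x n ≤ t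
  · simp only [Set.indicator_of_mem (show x ∈ {x | arrival x n ≤ t} from h1), Pi.one_apply, one_mul]
    have := lintegral_iidMeasure_exp_shift hr (sub_nonneg.2 h1) (g := 1) measurable_one
    simp only [Pi.one_apply, lintegral_one, measure_univ, mul_one] at this
    refine this.trans ?_
    rw [← ENNReal.ofReal_mul (Real.exp_pos _).le, ← Real.exp_add]
    ring_nf
  · simp [Set.indicator, h1]

/-- There is no explosion: the events "exactly `n` arrivals by time `t`" are almost surely disjoint,
and their Poisson probabilities add up to one. -/
lemma ae_isGoodWaiting (hr : 0 < r) :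
    ∀ᵐ x ∂(iidMeasure (expMeasure r)), IsGoodWaiting x := by
  have := isProbabilityMeasure_expMeasure hr
  have hpos := ae_pos_iidMeasure_exp hr
  have key : ∀ t : ℕ, ∀ᵐ x ∂(iidMeasure (expMeasure r)), ∃ k, (t : ℝ) < arrival x (k + 1) := by
    intro t
    set D : ℕ → Set (ℕ → ℝ) := fun n => {x | arrival x n ≤ t ∧ (t : ℝ) < arrival x (n + 1)}
    have hm : ∀ n, MeasurableSet (D n) := fun n =>
      (measurableSet_le (measurable_arrival n) measurable_const).inter
        (measurableSet_lt measurable_const (measurable_arrival (n + 1)))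
    have hd : Pairwise (Function.onFun (AEDisjoint (iidMeasure (expMeasure r))) D) := by
      have aux : ∀ i j, i < j → AEDisjoint (iidMeasure (expMeasure r)) (D i) (D j) := by
        intro i j hij
        refine measure_mono_null ?_ (ae_iff.1 hpos)
        rintro x ⟨⟨-, h1⟩, ⟨h2, -⟩⟩ hx
        exact absurd (h1.trans_le (arrival_mono hx hij)) (not_lt.2 h2)
      intro i j hij
      rcases lt_or_gt_of_ne hij with h | h
      exacts [aux i j h, (aux j i h).symm]
    have hU : iidMeasure (expMeasure r) (⋃ n, D n) = 1 := by
      rw [measure_iUnion₀ hd fun n => (hm n).nullMeasurableSet]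
      simp only [D, measure_arrival_le_lt hr _ t.cast_nonneg]
      have := hasSum_one_poissonMeasure (r * t).toNNReal
      rw [Real.coe_toNNReal _ (by positivity)] at this
      rw [← ENNReal.ofReal_tsum_of_nonneg (fun n => by positivity) this.summable]
      rw [this.tsum_eq, ENNReal.ofReal_one]
    have := (prob_compl_eq_zero_iff (.iUnion hm)).2 hU
    filter_upwards [compl_mem_ae_iff.2 this] with x hx
    rw [compl_compl] at hx
    obtain ⟨n, hn⟩ := Set.mem_iUnion.1 hx
    exact ⟨n, hn.2⟩
  filter_upwards [hpos, ae_all_iff.2 key] with x hx hk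
  refine ⟨hx, fun t => ?_⟩
  obtain ⟨k, hk⟩ := hk ⌈t⌉₊
  exact ⟨k, (Nat.le_ceil t).trans_lt hk⟩

lemma map_renewalCount (hr : 0 < r) {t : ℝ} (ht : 0 ≤ t) :
    (iidMeasure (expMeasure r)).map (renewalCount t)
      = poissonMeasure (r * t).toNNReal := by
  refine Measure.ext_of_singleton fun n => ?_
  rw [Measure.map_apply (measurable_renewalCount t) (measurableSet_singleton n),
    poissonMeasure_singleton, Real.coe_toNNReal _ (by positivity)]
  refine (measure_congr ?_).trans (measure_arrival_le_lt hr n ht)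
  filter_upwards [ae_isGoodWaiting hr] with x hx
  exact propext (hx.count_eq_iff ht)

end Renewal


/-! ### Independence and stationarity of compound Poisson increments -/

section CompoundPath

variable {E : Type*} [NormedAddCommGroup E] [InnerProductSpace ℝ E] [MeasurableSpace E]
  [BorelSpace E] [SecondCountableTopology E] [CompleteSpace E]
  {r : ℝ} {μ : Measure E} [IsProbabilityMeasure μ]

/-- The compound Poisson path with waiting times `p.1` and jumps `p.2`. -/
noncomputable def compoundPath (t : ℝ≥0) (p : (ℕ → ℝ) × (ℕ → E)) : E :=
  ∑ k ∈ Finset.range (renewalCount t p.1), p.2 k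

/-- The law of independent iid exponential waiting times and iid jumps. -/
noncomputable abbrev markedLaw (r : ℝ) (μ : Measure E) : Measure ((ℕ → ℝ) × (ℕ → E)) :=
  (iidMeasure (expMeasure r)).prod (iidMeasure μ)

@[fun_prop] lemma measurable_sum_range_apply :
    Measurable fun p : ℕ × (ℕ → E) => ∑ k ∈ Finset.range p.1, p.2 k :=
  measurable_from_prod_countable_right fun n => by
    simp only
    fun_prop

@[fun_prop] lemma measurable_compoundPath (t : ℝ≥0) :
    Measurable (compoundPath t : (ℕ → ℝ) × (ℕ → E) → E) :=
  measurable_sum_range_apply.comp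
    (((measurable_renewalCount t).comp measurable_fst).prodMk measurable_snd)

/-- The path on `[0, s]` if there are `n` arrivals up to time `s`. -/
noncomputable def pastPath (s : ℝ≥0) (n : ℕ) (x : ℕ → ℝ) (H : ℕ → E) (t : Set.Iic s) : E :=
  ∑ k ∈ Finset.range n, if arrival x (k + 1) ≤ (t : ℝ≥0) then H k else 0

@[fun_prop] lemma measurable_pastPath (s : ℝ≥0) (n : ℕ) :
    Measurable fun p : (ℕ → ℝ) × (ℕ → E) => pastPath s n p.1 p.2 := by
  refine measurable_pi_lambda _ fun t => Finset.measurable_sum _ fun k _ =>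
    Measurable.ite (measurableSet_le (by fun_prop) measurable_const) (by fun_prop) measurable_const

variable {x y : ℕ → ℝ}

lemma IsGoodWaiting.compoundPath_glue_past (hx : IsGoodWaiting x) (hy : IsGoodWaiting y)
    {s : ℝ≥0} {n : ℕ} (h2 : s - arrival x n < y 0) (H K : ℕ → E) :
    (fun t : Set.Iic s => compoundPath t (LevyConstruction.glue n x y,
      LevyConstruction.glue n H K)) = pastPath s n x H := by
  funext t
  simp only [compoundPath, pastPath]
  rw [hx.count_of_glue_lt hy h2 (NNReal.coe_le_coe.2 t.2), Finset.sum_filter]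
  exact Finset.sum_congr rfl fun k hk => by rw [glue_of_lt (Finset.mem_range.1 hk)]

lemma IsGoodWaiting.compoundPath_glue_sub (hx : IsGoodWaiting x) (hy : IsGoodWaiting y)
    {s u : ℝ≥0} {n : ℕ} (h1 : arrival x n ≤ s) (h2 : s - arrival x n < y 0) (H K : ℕ → E) :
    compoundPath (s + u) (LevyConstruction.glue n x y, LevyConstruction.glue n H K)
        - compoundPath s (LevyConstruction.glue n x y, LevyConstruction.glue n H K)
      = compoundPath u (LevyConstruction.shiftHead (s - arrival x n) y, K) := by
  simp only [compoundPath, NNReal.coe_add]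
  rw [(hx.count_glue_eq_iff hy s.coe_nonneg n).2 ⟨h1, h2⟩, hx.count_glue_add hy s.coe_nonneg u.coe_nonneg h1 h2,
    Finset.sum_range_add, add_sub_cancel_left]
  exact Finset.sum_congr rfl fun k _ => glue_add _ _ _ _

/-- The weight of the paths on `[0, s]` with `n` arrivals that lie in `A`. -/
noncomputable def pastWeight (r : ℝ) (μ : Measure E) (s : ℝ≥0) (n : ℕ) (A : Set (Set.Iic s → E)) :
    ℝ≥0∞ :=
  ∫⁻ x, {x | arrival x n ≤ s}.indicator (fun x => ENNReal.ofReal (Real.exp (-(r * (s - arrival x n))))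
    * iidMeasure μ {H | pastPath s n x H ∈ A}) x ∂(iidMeasure (expMeasure r))

/-- Cut both the waiting times and the jumps at index `n`. The past uses only the first pieces, the
increment only the fresh ones, and memorylessness turns the shortened waiting time back into an
exponential one. The second factor does not depend on `n`, so the sum over `n` still factorises. -/
lemma markedLaw_count_inter (hr : 0 < r) (s u : ℝ≥0) (n : ℕ) {A : Set (Set.Iic s → E)}
    (hA : MeasurableSet A) {B : Set E} (hB : MeasurableSet B) :
    markedLaw r μ {p | renewalCount s p.1 = n ∧ (fun t : Set.Iic s => compoundPath t p) ∈ A ∧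
        compoundPath (s + u) p - compoundPath s p ∈ B}
      = pastWeight r μ s n A * markedLaw r μ {p | compoundPath u p ∈ B} := by
  have := isProbabilityMeasure_expMeasure hr
  have hpast : Measurable fun (p : (ℕ → ℝ) × (ℕ → E)) (t : Set.Iic s) => compoundPath t p := by
    fun_prop
  set S : Set ((ℕ → ℝ) × (ℕ → E)) := {p | renewalCount s p.1 = n ∧
    (fun t : Set.Iic s => compoundPath t p) ∈ A ∧ compoundPath (s + u) p - compoundPath s p ∈ B}
    with hS
  have hSm : MeasurableSet S :=
    (((measurable_renewalCount s).comp measurable_fst) (measurableSet_singleton n)).inter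
      ((hpast hA).inter (((measurable_compoundPath (s + u)).sub (measurable_compoundPath s)) hB))
  have hBm : MeasurableSet {p : (ℕ → ℝ) × (ℕ → E) | compoundPath u p ∈ B} :=
    measurable_compoundPath u hB
  set F : ((ℕ → ℝ) × (ℕ → E)) → ℝ≥0∞ := S.indicator 1 with hF
  have hFm : Measurable F := measurable_one.indicator hSm
  have hK : Measurable fun y => iidMeasure μ {K : ℕ → E | compoundPath u (y, K) ∈ B} :=
    measurable_measure_prodMk_left hBm
  have hfull : markedLaw r μ {p | compoundPath u p ∈ B}
      = ∫⁻ y, iidMeasure μ {K : ℕ → E | compoundPath u (y, K) ∈ B} ∂(iidMeasure (expMeasure r)) := by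
    rw [Measure.prod_apply hBm]; rfl
  have hAm : MeasurableSet {p : (ℕ → ℝ) × (ℕ → E) | pastPath s n p.1 p.2 ∈ A} :=
    measurable_pastPath s n hA
  rw [← lintegral_indicator_one hSm, lintegral_prod _ hFm.aemeasurable,
    lintegral_glue _ n (hFm.lintegral_prod_right')]
  have hH : ∀ x y : ℕ → ℝ, ∫⁻ H, F (glue n x y, H) ∂(iidMeasure μ)
      = ∫⁻ H, ∫⁻ K, F (glue n x y, glue n H K) ∂(iidMeasure μ) ∂(iidMeasure μ) := fun x y =>
    lintegral_glue _ n (by fun_prop)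
  have hw : Measurable fun x : ℕ → ℝ => {x | arrival x n ≤ s}.indicator
      (fun x => ENNReal.ofReal (Real.exp (-(r * (s - arrival x n))))
        * iidMeasure μ {H | pastPath s n x H ∈ A}) x :=
    Measurable.indicator (Measurable.fun_mul (by fun_prop) (measurable_measure_prodMk_left hAm))
      (measurableSet_le (by fun_prop) measurable_const)
  rw [pastWeight, ← lintegral_mul_const _ hw]
  refine lintegral_congr_ae ?_
  filter_upwards [ae_isGoodWaiting hr] with x hx
  simp only [hH]
  by_cases h1 : arrival x n ≤ s
  · have hKs : Measurable fun y : ℕ → ℝ => {y : ℕ → ℝ | s - arrival x n < y 0}.indicator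
        (fun y => iidMeasure μ {K | compoundPath u (shiftHead (s - arrival x n) y, K) ∈ B}) y :=
      (hK.comp (measurable_shiftHead _)).indicator
          (measurableSet_lt measurable_const (measurable_pi_apply 0))
    rw [Set.indicator_of_mem (show x ∈ {x | arrival x n ≤ s} from h1), mul_right_comm, hfull,
      ← lintegral_iidMeasure_exp_shift hr (sub_nonneg.2 h1) hK, ← lintegral_mul_const _ hKs]
    refine lintegral_congr_ae ?_
    filter_upwards [ae_isGoodWaiting hr] with y hy
    by_cases h2 : s - arrival x n < y 0
    · rw [Set.indicator_of_mem (show y ∈ {y : ℕ → ℝ | s - arrival x n < y 0} from h2)]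
      have hF2 : ∀ H K, F (glue n x y, glue n H K) = {H | pastPath s n x H ∈ A}.indicator 1 H *
          {K | compoundPath u (shiftHead (s - arrival x n) y, K) ∈ B}.indicator 1 K := by
        intro H K
        have e1 := hx.compoundPath_glue_past hy h2 H K
        have e2 := hx.compoundPath_glue_sub hy (u := u) h1 h2 H K
        have e3 := (hx.count_glue_eq_iff hy s.coe_nonneg n).2 ⟨h1, h2⟩
        have hmem : (glue n x y, glue n H K) ∈ S ↔ pastPath s n x H ∈ A ∧
            compoundPath u (shiftHead (s - arrival x n) y, K) ∈ B := by
          rw [hS, Set.mem_ofPred_eq, e1, e2]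
          simp only [e3, true_and]
        by_cases h3 : pastPath s n x H ∈ A <;>
          by_cases h4 : compoundPath u (shiftHead (s - arrival x n) y, K) ∈ B <;>
          simp [hF, Set.indicator, hmem, h3, h4]
      have m1 : MeasurableSet {H | pastPath s n x H ∈ A} := measurable_prodMk_left hAm
      have m2 : MeasurableSet {K | compoundPath u (shiftHead (s - arrival x n) y, K) ∈ B} :=
        measurable_prodMk_left hBm
      simp only [hF2, lintegral_const_mul _ (measurable_one.indicator m2),
        lintegral_mul_const _ (measurable_one.indicator m1), lintegral_indicator_one m1,
        lintegral_indicator_one m2]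
      rw [mul_comm]
    · rw [Set.indicator_of_notMem (show y ∉ {y : ℕ → ℝ | s - arrival x n < y 0} from h2), zero_mul]
      have hF2 : ∀ H K, F (glue n x y, glue n H K) = 0 := fun H K =>
        Set.indicator_of_notMem (fun h => h2 ((hx.count_glue_eq_iff hy s.coe_nonneg n).1 h.1).2) _
      simp [hF2]
  · rw [Set.indicator_of_notMem (show x ∉ {x | arrival x n ≤ s} from h1), zero_mul,
      ← lintegral_zero]
    refine lintegral_congr_ae ?_
    filter_upwards [ae_isGoodWaiting hr] with y hy
    have hF2 : ∀ H K, F (glue n x y, glue n H K) = 0 := fun H K =>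
      Set.indicator_of_notMem (fun h => h1 ((hx.count_glue_eq_iff hy s.coe_nonneg n).1 h.1).1) _
    simp [hF2]

/-- Independence and stationarity of the increments of a compound Poisson process. -/
lemma markedLaw_past_inter_increment (hr : 0 < r) (s u : ℝ≥0) {A : Set (Set.Iic s → E)}
    (hA : MeasurableSet A) {B : Set E} (hB : MeasurableSet B) :
    markedLaw r μ {p | (fun t : Set.Iic s => compoundPath t p) ∈ A ∧
        compoundPath (s + u) p - compoundPath s p ∈ B}
      = markedLaw r μ {p | (fun t : Set.Iic s => compoundPath t p) ∈ A}
        * markedLaw r μ {p | compoundPath u p ∈ B} := by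
  have := isProbabilityMeasure_expMeasure hr
  have hpast : Measurable fun (p : (ℕ → ℝ) × (ℕ → E)) (t : Set.Iic s) => compoundPath t p := by
    fun_prop
  have key : ∀ B : Set E, MeasurableSet B →
      markedLaw r μ {p | (fun t : Set.Iic s => compoundPath t p) ∈ A ∧
        compoundPath (s + u) p - compoundPath s p ∈ B}
      = (∑' n, pastWeight r μ s n A) * markedLaw r μ {p | compoundPath u p ∈ B} := by
    intro B hB
    rw [← ENNReal.tsum_mul_right]
    simp only [← markedLaw_count_inter hr s u _ hA hB]
    rw [← measure_iUnion]
    · congr 1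
      ext p
      simp
    · intro i j hij
      refine Set.disjoint_left.2 fun p hp hp' => hij (hp.1.symm.trans hp'.1)
    · intro n
      exact (((measurable_renewalCount s).comp measurable_fst) (measurableSet_singleton n)).inter
        ((hpast hA).inter (((measurable_compoundPath (s + u)).sub (measurable_compoundPath s)) hB))
  -- The choice `B = univ` identifies the total past weight with the probability of `A`.
  have huniv := key Set.univ .univ
  simp only [Set.mem_univ, and_true, Set.ofPred_true, measure_univ, mul_one] at huniv
  rw [key B hB, huniv]

lemma indepFun_compoundPath (hr : 0 < r) {s t : ℝ≥0} (hst : s ≤ t) :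
    IndepFun (fun p => compoundPath t p - compoundPath s p)
      (fun p (q : Set.Iic s) => compoundPath q p) (markedLaw r μ) ∧
    (markedLaw r μ).map (fun p => compoundPath t p - compoundPath s p)
      = (markedLaw r μ).map (compoundPath (t - s)) := by
  have := isProbabilityMeasure_expMeasure hr
  obtain ⟨u, rfl⟩ := exists_add_of_le hst
  have hm : Measurable fun p : (ℕ → ℝ) × (ℕ → E) => compoundPath (s + u) p - compoundPath s p := by
    fun_prop
  have hlaw : ∀ B, MeasurableSet B →
      markedLaw r μ {p | compoundPath (s + u) p - compoundPath s p ∈ B}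
        = markedLaw r μ {p | compoundPath u p ∈ B} := fun B hB => by
    simpa using markedLaw_past_inter_increment (μ := μ) hr s u .univ hB
  refine ⟨?_, ?_⟩
  · rw [indepFun_iff_measure_inter_preimage_eq_mul]
    intro B A hB hA
    have := markedLaw_past_inter_increment (μ := μ) hr s u hA hB
    rw [Set.inter_comm, mul_comm]
    refine this.trans ?_
    rw [← hlaw B hB]
    rfl
  · ext B hB
    rw [Measure.map_apply hm hB, Measure.map_apply (by fun_prop) hB, add_tsub_cancel_left]
    exact hlaw B hB

lemma map_compoundPath (hr : 0 < r) (t : ℝ≥0) :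
    (markedLaw r μ).map (compoundPath t)
      = ((poissonMeasure (r * t).toNNReal).prod (iidMeasure μ)).map
        fun p => ∑ k ∈ Finset.range p.1, p.2 k := by
  have := isProbabilityMeasure_expMeasure hr
  rw [← map_renewalCount hr t.coe_nonneg, ← Measure.map_id (μ := iidMeasure μ), Measure.map_prod_map _ _
    (by fun_prop) measurable_id, Measure.map_map (by fun_prop) (by fun_prop)]
  rfl

end CompoundPath


/-! ### Factorial moments of the Poisson law -/

section PoissonMoments

lemma hasSum_poisson_descFactorial (l : ℝ≥0) (k : ℕ) :
    HasSum (fun n : ℕ => Real.exp (-l) * (l : ℝ) ^ n / n.factorial * (n.descFactorial k : ℝ))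
      ((l : ℝ) ^ k) := by
  have h := (hasSum_one_poissonMeasure l).mul_left ((l : ℝ) ^ k)
  rw [mul_one] at h
  -- The terms with `n < k` vanish; after the shift `n ↦ n + k` the falling factorial cancels
  -- against `(n + k)!`.
  refine (Function.Injective.hasSum_iff (add_left_injective k) ?_).1 (h.congr_fun ?_)
  · intro n hn
    have : n < k := by
      by_contra hk
      exact hn ⟨n - k, Nat.sub_add_cancel (not_lt.1 hk)⟩
    simp [Nat.descFactorial_of_lt this]
  · intro n
    have h1 : ((n + k).factorial : ℝ) = n.factorial * (n + k).descFactorial k := by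
      rw [← Nat.factorial_mul_descFactorial (Nat.le_add_left k n), Nat.add_sub_cancel]
      push_cast; ring
    have h2 : ((n + k).descFactorial k : ℝ) ≠ 0 := by
      exact_mod_cast (Nat.descFactorial_pos.2 (Nat.le_add_left k n)).ne'
    simp only [Function.comp]
    rw [h1]
    have h3 : (n.factorial : ℝ) ≠ 0 := by positivity
    field_simp
    ring

lemma integrable_poisson_descFactorial (l : ℝ≥0) (k : ℕ) :
    Integrable (fun n : ℕ => (n.descFactorial k : ℝ)) (poissonMeasure l) :=
  integrable_poissonMeasure_iff.2 (by
    simpa using (hasSum_poisson_descFactorial l k).summable)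

lemma integral_poisson_descFactorial (l : ℝ≥0) (k : ℕ) :
    ∫ n : ℕ, (n.descFactorial k : ℝ) ∂(poissonMeasure l) = (l : ℝ) ^ k := by
  rw [integral_poissonMeasure]
  exact (hasSum_poisson_descFactorial l k).tsum_eq

end PoissonMoments

/-! ### Characteristic function and moments of a compound Poisson variable -/

section CompoundLaw

variable {E : Type*} [NormedAddCommGroup E] [InnerProductSpace ℝ E] [MeasurableSpace E]
  [BorelSpace E] [SecondCountableTopology E] [CompleteSpace E]
  {r : ℝ} {μ : Measure E} [IsProbabilityMeasure μ]

lemma iIndepFun_iidMeasure (μ : Measure E) [IsProbabilityMeasure μ] :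
    iIndepFun (fun (k : ℕ) (h : ℕ → E) => h k) (iidMeasure μ) :=
  iIndepFun_infinitePi (P := fun _ : ℕ => μ) (X := fun _ => id) fun _ => measurable_id

lemma integral_exp_sum_range (μ : Measure E) [IsProbabilityMeasure μ] (n : ℕ) (ξ : E) :
    ∫ h, Complex.exp ((⟪∑ k ∈ Finset.range n, h k, ξ⟫ : ℝ) * Complex.I) ∂(iidMeasure μ)
      = charFun μ ξ ^ n := by
  have h := (iIndepFun_iidMeasure μ).restrict (Finset.range n) |>.charFun_map_fun_finsetSum_eq_prod
    (fun k _ => (measurable_pi_apply k).aemeasurable)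
  have := congrFun h ξ
  rw [charFun_apply, integral_map (by fun_prop) (by fun_prop)] at this
  rw [this]
  simp [Measure.infinitePi_map_eval]

/-- Given the count `N`, the characteristic function is `charFun μ ξ ^ N`; what remains is the
generating function of a Poisson variable. -/
lemma integral_exp_compoundPath (hr : 0 < r) (t : ℝ≥0) (ξ : E) :
    ∫ p, Complex.exp ((⟪compoundPath t p, ξ⟫ : ℝ) * Complex.I) ∂(markedLaw r μ)
      = Complex.exp (-((t : ℝ) * (r * (1 - charFun μ ξ)))) := by
  have := isProbabilityMeasure_expMeasure hr
  have h1 : Integrable (fun p : ℕ × (ℕ → E) =>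
      Complex.exp ((⟪∑ k ∈ Finset.range p.1, p.2 k, ξ⟫ : ℝ) * Complex.I))
      ((poissonMeasure (r * t).toNNReal).prod (iidMeasure μ)) := by
    refine Integrable.of_bound (C := 1) ?_ (.of_forall fun p => ?_)
    · have := measurable_sum_range_apply (E := E)
      exact Measurable.aestronglyMeasurable (by fun_prop)
    · rw [Complex.norm_exp_ofReal_mul_I]
  rw [← integral_map (f := fun y => Complex.exp ((⟪y, ξ⟫ : ℝ) * Complex.I))
    (measurable_compoundPath t).aemeasurable (by fun_prop), map_compoundPath hr,
    integral_map measurable_sum_range_apply.aemeasurable (by fun_prop), integral_prod _ h1]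
  simp only [integral_exp_sum_range]
  rw [integral_poissonMeasure, Real.coe_toNNReal _ (by positivity)]
  have h2 := (NormedSpace.expSeries_div_hasSum_exp (r * t * charFun μ ξ : ℂ)).mul_left
    (Complex.exp (-(r * t)))
  rw [← Complex.exp_eq_exp_ℂ, ← Complex.exp_add] at h2
  refine (HasSum.tsum_eq (h2.congr_fun fun n => ?_)).trans (by ring_nf)
  rw [Complex.real_smul]
  push_cast
  rw [mul_pow]
  ring

lemma memLp_apply_iidMeasure (hμ : MemLp id 2 μ) (k : ℕ) :
    MemLp (fun h : ℕ → E => h k) 2 (iidMeasure μ) :=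
  hμ.comp_measurePreserving (measurePreserving_eval_infinitePi (fun _ : ℕ => μ) k)

lemma integral_apply_iidMeasure {F : Type*} [NormedAddCommGroup F] [NormedSpace ℝ F] (k : ℕ)
    {f : E → F} (hf : AEStronglyMeasurable f μ) :
    ∫ h : ℕ → E, f (h k) ∂(iidMeasure μ) = ∫ y, f y ∂μ := by
  have hk := measurePreserving_eval_infinitePi (fun _ : ℕ => μ) k
  rw [← hk.map_eq] at hf
  conv_rhs => rw [← hk.map_eq]
  exact (integral_map hk.measurable.aemeasurable hf).symm

lemma memLp_sum_range (hμ : MemLp id 2 μ) (n : ℕ) :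
    MemLp (fun h : ℕ → E => ∑ k ∈ Finset.range n, h k) 2 (iidMeasure μ) :=
  memLp_finsetSum _ fun k _ => memLp_apply_iidMeasure hμ k

lemma integral_sum_range (hμ : MemLp id 2 μ) (n : ℕ) :
    ∫ h : ℕ → E, ∑ k ∈ Finset.range n, h k ∂(iidMeasure μ) = (n : ℝ) • ∫ y, y ∂μ := by
  rw [integral_finsetSum _ fun k _ => (memLp_apply_iidMeasure hμ k).integrable one_le_two]
  simp only [integral_apply_iidMeasure (f := fun y => y) _ hμ.1, Finset.sum_const,
    Finset.card_range, Nat.cast_smul_eq_nsmul]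

/-- The dependence on `n` is expressed through falling factorials, so that the Poisson average can
be read off term by term. The offset `c` is kept free because it will be the mean of the random sum,
which does not depend on `n`. -/
lemma integral_norm_sum_range_sub_sq (hμ : MemLp id 2 μ) (c : E) (n : ℕ) :
    ∫ h : ℕ → E, ‖∑ k ∈ Finset.range n, h k - c‖ ^ 2 ∂(iidMeasure μ)
      = ‖c‖ ^ 2 + (n.descFactorial 1 : ℝ) * (∫ y, ‖y‖ ^ 2 ∂μ - 2 * ⟪c, ∫ y, y ∂μ⟫)
        + (n.descFactorial 2 : ℝ) * ‖∫ y, y ∂μ‖ ^ 2 := by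
  induction n with
  | zero => simp
  | succ n ih =>
    have hS := (memLp_sum_range hμ n).sub (memLp_const c)
    have hk := memLp_apply_iidMeasure hμ n
    have hind : IndepFun (fun h : ℕ → E => ∑ k ∈ Finset.range n, h k - c) (fun h => h n)
        (iidMeasure μ) := by
      have := (iIndepFun_iidMeasure μ).indepFun_finsetSum_of_notMem (fun k => measurable_pi_apply k)
        (s := Finset.range n) (i := n) (by simp)
      have := this.comp (measurable_id.sub_const c) measurable_id
      refine this.congr (.of_forall fun h => ?_) (.of_forall fun h => rfl)
      simp
    have hin := hind.integral_bilin (hS.integrable one_le_two) (hk.integrable one_le_two)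
      (innerSL ℝ)
    have hmean : ∫ h : ℕ → E, (∑ k ∈ Finset.range n, h k - c) ∂(iidMeasure μ)
        = (n : ℝ) • ∫ y, y ∂μ - c := by
      rw [integral_sub ((memLp_sum_range hμ n).integrable one_le_two) (integrable_const c),
        integral_sum_range hμ]
      simp
    have e : ∀ h : ℕ → E, ‖∑ k ∈ Finset.range (n + 1), h k - c‖ ^ 2
        = ‖∑ k ∈ Finset.range n, h k - c‖ ^ 2
          + 2 * innerSL ℝ (∑ k ∈ Finset.range n, h k - c) (h n) + ‖h n‖ ^ 2 := fun h => by
      rw [Finset.sum_range_succ, add_sub_right_comm, norm_add_sq_real]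
      rfl
    simp only [e]
    have i1 : Integrable (fun h : ℕ → E => ‖∑ k ∈ Finset.range n, h k - c‖ ^ 2) (iidMeasure μ) :=
      hS.norm.integrable_sq
    have i2 : Integrable (fun h : ℕ → E => 2 * innerSL ℝ (∑ k ∈ Finset.range n, h k - c) (h n))
        (iidMeasure μ) := (integrable_inner_of_memLp hS hk).const_mul 2
    have i3 : Integrable (fun h : ℕ → E => ‖h n‖ ^ 2) (iidMeasure μ) := hk.norm.integrable_sq
    rw [integral_add (i1.fun_add i2) i3, integral_add i1 i2, ih, integral_const_mul, hin, hmean,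
      integral_apply_iidMeasure (f := fun y => ‖y‖ ^ 2) n (hμ.1.norm.pow 2),
      integral_apply_iidMeasure (f := fun y => y) n hμ.1]
    simp only [Nat.descFactorial_succ, Nat.descFactorial_zero]
    have e2 : ∀ a b : E, (innerSL ℝ) a b = ⟪a, b⟫ := fun _ _ => rfl
    rcases n with _ | n
    · simp [e2]; ring
    · simp [e2, inner_sub_left, real_inner_smul_left, -map_sub, -map_add, -map_smul]
      ring

lemma integrable_norm_sum_range_sub_sq (hμ : MemLp id 2 μ) (l : ℝ≥0) (c : E) :
    Integrable (fun p : ℕ × (ℕ → E) => ‖∑ k ∈ Finset.range p.1, p.2 k - c‖ ^ 2)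
      ((poissonMeasure l).prod (iidMeasure μ)) := by
  have hm := measurable_sum_range_apply (E := E)
  rw [integrable_prod_iff (Measurable.aestronglyMeasurable (by fun_prop))]
  refine ⟨.of_forall fun n => ((memLp_sum_range hμ n).sub (memLp_const c)).norm.integrable_sq, ?_⟩
  simp only [norm_pow, norm_norm, integral_norm_sum_range_sub_sq hμ]
  exact ((integrable_const _).add ((integrable_poisson_descFactorial l 1).mul_const _)).add
    ((integrable_poisson_descFactorial l 2).mul_const _)

lemma memLp_sum_poisson (hμ : MemLp id 2 μ) (l : ℝ≥0) :
    MemLp (fun p : ℕ × (ℕ → E) => ∑ k ∈ Finset.range p.1, p.2 k) 2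
      ((poissonMeasure l).prod (iidMeasure μ)) := by
  rw [memLp_two_iff_integrable_sq_norm measurable_sum_range_apply.aestronglyMeasurable]
  simpa using integrable_norm_sum_range_sub_sq hμ l 0

lemma memLp_compoundPath (hr : 0 < r) (hμ : MemLp id 2 μ) (t : ℝ≥0) :
    MemLp (compoundPath t) 2 (markedLaw r μ) := by
  have h := memLp_sum_poisson hμ (r * t).toNNReal
  rw [show (fun p : ℕ × (ℕ → E) => ∑ k ∈ Finset.range p.1, p.2 k)
    = id ∘ fun p : ℕ × (ℕ → E) => ∑ k ∈ Finset.range p.1, p.2 k from rfl,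
    ← memLp_map_measure_iff (by fun_prop) measurable_sum_range_apply.aemeasurable,
    ← map_compoundPath hr, memLp_map_measure_iff (by fun_prop) (by fun_prop)] at h
  exact h

lemma integral_compoundPath (hr : 0 < r) (hμ : MemLp id 2 μ) (t : ℝ≥0) :
    ∫ p, compoundPath t p ∂(markedLaw r μ) = (r * t : ℝ) • ∫ y, y ∂μ := by
  rw [← integral_map (f := fun y : E => y) (measurable_compoundPath t).aemeasurable (by fun_prop),
    map_compoundPath hr, integral_map measurable_sum_range_apply.aemeasurable (by fun_prop),
    integral_prod _ ((memLp_sum_poisson hμ _).integrable one_le_two)]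
  simp only [integral_sum_range hμ]
  rw [integral_smul_const]
  have := integral_poisson_descFactorial (r * t).toNNReal 1
  rw [Real.coe_toNNReal _ (by positivity)] at this
  simp only [Nat.descFactorial_one, pow_one] at this
  rw [this]

/-- With Poisson parameter `l`, jump mean `m` and offset `c = l m`, the terms in `‖m‖ ^ 2` have
coefficients `l² - 2 l² + l² = 0`, and only `l` times the second moment survives. -/
lemma integral_norm_compoundPath_sub_sq (hr : 0 < r) (hμ : MemLp id 2 μ) (t : ℝ≥0) :
    ∫ p, ‖compoundPath t p - (r * t : ℝ) • ∫ y, y ∂μ‖ ^ 2 ∂(markedLaw r μ)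
      = r * t * ∫ y, ‖y‖ ^ 2 ∂μ := by
  set l := (r * t).toNNReal
  have hl : (l : ℝ) = r * t := Real.coe_toNNReal _ (by positivity)
  rw [← hl, ← integral_map (f := fun y : E => ‖y - (l : ℝ) • ∫ y, y ∂μ‖ ^ 2)
    (measurable_compoundPath t).aemeasurable (by fun_prop),
    map_compoundPath hr, integral_map measurable_sum_range_apply.aemeasurable (by fun_prop),
    integral_prod _ (integrable_norm_sum_range_sub_sq hμ _ _)]
  simp only [integral_norm_sum_range_sub_sq hμ]
  have i1 := integrable_poisson_descFactorial l 1
  have i2 := integrable_poisson_descFactorial l 2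
  rw [integral_add ((integrable_const _).fun_add (i1.mul_const _)) (i2.mul_const _),
    integral_add (integrable_const _) (i1.mul_const _), integral_mul_const, integral_mul_const,
    integral_poisson_descFactorial, integral_poisson_descFactorial]
  simp only [integral_const, probReal_univ, real_inner_smul_left, real_inner_self_eq_norm_sq,
    norm_smul, Real.norm_eq_abs, smul_eq_mul, mul_pow, sq_abs]
  ring

lemma hasLevyIncrements_compoundPath (hr : 0 < r) :
    HasLevyIncrements (fun t => compoundPath t) (markedLaw r μ)
      (fun ξ => r * (1 - charFun μ ξ)) := by
  have := isProbabilityMeasure_expMeasure hr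
  refine .of_indepFun measurable_compoundPath
    (fun s t hst => (indepFun_compoundPath hr hst).1) fun s t hst ξ => ?_
  have hm : Measurable fun p : (ℕ → ℝ) × (ℕ → E) => compoundPath t p - compoundPath s p := by
    fun_prop
  rw [← integral_map (f := fun y => Complex.exp ((⟪y, ξ⟫ : ℝ) * Complex.I)) hm.aemeasurable
    (by fun_prop), (indepFun_compoundPath hr hst).2, integral_map
    (measurable_compoundPath _).aemeasurable (by fun_prop), integral_exp_compoundPath hr,
    NNReal.coe_sub hst]

end CompoundLaw


lemma HasLevyIncrements.comp_measurePreserving {E Ω S : Type*} [NormedAddCommGroup E]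
    [InnerProductSpace ℝ E] [MeasurableSpace E] [BorelSpace E] [SecondCountableTopology E]
    [MeasurableSpace Ω] [MeasurableSpace S] {P : Measure Ω} {R : Measure S} {Y : ℝ≥0 → S → E}
    {ψ : E → ℂ} (h : HasLevyIncrements Y R ψ) {Z : Ω → S} (hZ : MeasurePreserving Z P R) :
    HasLevyIncrements (fun t ω => Y t (Z ω)) P ψ where
  measurable t := (h.measurable t).comp hZ.measurable
  integral_eq s t hst ξ I η := by
    have hm := h.measurable
    have := h.integral_eq s t hst ξ I η
    rw [← hZ.map_eq, integral_map hZ.measurable.aemeasurable (by fun_prop),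
      integral_map hZ.measurable.aemeasurable (by fun_prop)] at this
    exact this

/-! ### Path regularity of the compound Poisson process -/

section CountPaths

variable {x : ℕ → ℝ}

lemma IsGoodWaiting.count_eventually_eq_right (hx : IsGoodWaiting x) (t : ℝ≥0) :
    ∀ᶠ u in 𝓝[Set.Ici t] t, renewalCount (u : ℝ≥0) x = renewalCount t x := by
  have h1 : ∀ᶠ u : ℝ≥0 in 𝓝[Set.Ici t] t, (u : ℝ) < arrival x (renewalCount t x + 1) :=
    eventually_nhdsWithin_of_eventually_nhds
      ((NNReal.continuous_coe.tendsto t).eventually (eventually_lt_nhds (hx.lt_arrival_count)))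
  filter_upwards [h1, self_mem_nhdsWithin] with u hu htu
  exact (hx.count_eq_iff u.coe_nonneg).2
    ⟨(hx.arrival_count_le t.coe_nonneg).trans (NNReal.coe_le_coe.2 htu), hu⟩

lemma IsGoodWaiting.count_eventually_eq_left (hx : IsGoodWaiting x) {t : ℝ≥0} (ht : 0 < t) :
    ∃ n, ∀ᶠ u in 𝓝[<] t, renewalCount (u : ℝ≥0) x = n := by
  classical
  -- The inequality is not strict: an arrival at exactly `t` is not yet counted just before `t`.
  have hex : ∃ k, (t : ℝ) ≤ arrival x (k + 1) := (hx.exists_lt t).imp fun _ h => h.le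
  refine ⟨Nat.find hex, ?_⟩
  have hlt : arrival x (Nat.find hex) < t := by
    rcases h : Nat.find hex with _ | n
    · simpa using ht
    · exact not_le.1 (Nat.find_min hex (m := n) (by omega))
  have h1 : ∀ᶠ u : ℝ≥0 in 𝓝[<] t, arrival x (Nat.find hex) < (u : ℝ) :=
    eventually_nhdsWithin_of_eventually_nhds
      ((NNReal.continuous_coe.tendsto t).eventually (eventually_gt_nhds hlt))
  filter_upwards [h1, self_mem_nhdsWithin] with u hu htu
  exact (hx.count_eq_iff u.coe_nonneg).2
    ⟨hu.le, (NNReal.coe_lt_coe.2 htu).trans_le (Nat.find_spec hex)⟩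

variable {d : ℕ}

lemma isCadlag_compoundPath {p : (ℕ → ℝ) × (ℕ → EuclideanSpace ℝ (Fin d))}
    (hp : IsGoodWaiting p.1) : IsCadlag fun t => compoundPath t p := by
  refine ⟨fun t => ?_, fun t ht => ?_⟩
  · refine (continuousWithinAt_const (b := compoundPath t p)).congr_of_eventuallyEq ?_ rfl
    filter_upwards [hp.count_eventually_eq_right t] with u hu
    rw [compoundPath, hu, compoundPath]
  · obtain ⟨n, hn⟩ := hp.count_eventually_eq_left ht
    refine ⟨∑ k ∈ Finset.range n, p.2 k, tendsto_const_nhds.congr' ?_⟩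
    filter_upwards [hn] with u hu
    rw [compoundPath, hu]

lemma compoundPath_zero {p : (ℕ → ℝ) × (ℕ → EuclideanSpace ℝ (Fin d))}
    (hp : IsGoodWaiting p.1) : compoundPath 0 p = 0 := by
  simp [compoundPath, hp.count_zero]

end CountPaths

lemma iIndepFun_eval_iidMeasure {Ω S : Type*} [MeasurableSpace Ω] [MeasurableSpace S]
    {P : Measure Ω} [IsProbabilityMeasure P] {μ : Measure S} [IsProbabilityMeasure μ]
    {Z : Ω → ℕ → S} (hZ : MeasurePreserving Z P (iidMeasure μ)) :
    iIndepFun (fun k ω => Z ω k) P ∧ ∀ k, P.map (fun ω => Z ω k) = μ := by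
  have hm (k : ℕ) : Measurable fun ω => Z ω k := (measurable_pi_apply k).comp hZ.measurable
  have hmap (k : ℕ) : P.map (fun ω => Z ω k) = μ :=
    ((measurePreserving_eval_infinitePi (fun _ : ℕ => μ) k).comp hZ).map_eq
  refine ⟨(iIndepFun_iff_map_fun_eq_infinitePi_map hm).2 ?_, hmap⟩
  simp only [hmap]
  exact hZ.map_eq

/-! ### The constructed process meets the definition of a compound Poisson process -/

section IsCompound

variable {d : ℕ} {Ω : Type*} [MeasurableSpace Ω] {P : Measure Ω} [IsProbabilityMeasure P]
  {r : ℝ} {μ : Measure (EuclideanSpace ℝ (Fin d))} [IsProbabilityMeasure μ]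

lemma isCompoundPoisson_compoundPath {Z : Ω → (ℕ → ℝ) × (ℕ → EuclideanSpace ℝ (Fin d))}
    (hr : 0 < r) (hZ : MeasurePreserving Z P (markedLaw r μ)) :
    IsCompoundPoisson (fun t ω => compoundPath t (Z ω)) r μ P := by
  have := isProbabilityMeasure_expMeasure hr
  have h1 : MeasurePreserving (fun ω => (Z ω).1) P (iidMeasure (expMeasure r)) :=
    measurePreserving_fst.comp hZ
  have h2 : MeasurePreserving (fun ω => (Z ω).2) P (iidMeasure μ) :=
    measurePreserving_snd.comp hZ
  have m1 (k : ℕ) : Measurable fun ω => (Z ω).1 k := (measurable_pi_apply k).comp h1.measurable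
  have m2 (k : ℕ) : Measurable fun ω => (Z ω).2 k := (measurable_pi_apply k).comp h2.measurable
  refine ⟨fun t ω => renewalCount t (Z ω).1, fun k ω => (Z ω).2 k,
    ⟨hr, fun t => (measurable_renewalCount t).comp h1.measurable, fun k ω => (Z ω).1 k, m1,
      (iIndepFun_eval_iidMeasure h1).1, (iIndepFun_eval_iidMeasure h1).2, ?_⟩,
    m2, (iIndepFun_eval_iidMeasure h2).1, (iIndepFun_eval_iidMeasure h2).2, ?_,
    fun t ω => rfl⟩
  -- For good waiting times the counted indices form an initial segment; elsewhere the set may be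
  -- infinite while `renewalCount` is a default value.
  · filter_upwards [h1.quasiMeasurePreserving.ae (ae_isGoodWaiting hr)] with ω hω t
    have : {k : ℕ | ∑ i ∈ Finset.range (k + 1), (Z ω).1 i ≤ (t : ℝ)}
        = Set.Iio (renewalCount t (Z ω).1) := by
      ext k
      exact hω.lt_count_iff.symm
    rw [this, Set.encard_eq_coe_toFinset_card]
    simp
  · have hind : IndepFun (fun ω => (Z ω).1) (fun ω => (Z ω).2) P := by
      rw [indepFun_iff_map_prod_eq_prod_map_map h1.measurable.aemeasurable
        h2.measurable.aemeasurable, h1.map_eq, h2.map_eq]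
      exact hZ.map_eq
    exact hind.comp (φ := fun x (t : ℝ≥0) => renewalCount t x) (ψ := id)
      (measurable_pi_lambda _ fun t => measurable_renewalCount t) measurable_id

end IsCompound


/-! ### Deterministic dyadic chaining -/

section Dyadic

/-- The largest dyadic number of level `n` below `t`. -/
noncomputable def dyadicFloor (n : ℕ) (t : ℝ≥0) : ℝ≥0 := (⌊t * 2 ^ n⌋₊ : ℝ≥0) / 2 ^ n

/-- The increment of `f` over the `k`-th dyadic interval of level `n`. -/
noncomputable def dyadicIncrement (f : ℝ≥0 → ℝ) (n k : ℕ) : ℝ :=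
  f (((k + 1 : ℕ) : ℝ≥0) / 2 ^ n) - f ((k : ℝ≥0) / 2 ^ n)

lemma dyadicFloor_le (n : ℕ) (t : ℝ≥0) : dyadicFloor n t ≤ t :=
  div_le_of_le_mul₀ (by positivity) (by positivity) (Nat.floor_le (by positivity))

lemma sub_dyadicFloor_le (n : ℕ) (t : ℝ≥0) : (t : ℝ) - dyadicFloor n t ≤ (2⁻¹ : ℝ) ^ n := by
  have h := (Nat.lt_floor_add_one (t * 2 ^ n)).le
  have h' : (t : ℝ) * 2 ^ n ≤ (⌊t * 2 ^ n⌋₊ : ℝ) + 1 := by exact_mod_cast h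
  have h2 : (0 : ℝ) < 2 ^ n := by positivity
  rw [dyadicFloor, inv_pow, NNReal.coe_div]
  push_cast
  rw [sub_le_iff_le_add, ← one_div, ← add_div, le_div_iff₀ h2]
  linarith

lemma floor_two_mul_cases (x : ℝ≥0) : ⌊x * 2⌋₊ = 2 * ⌊x⌋₊ ∨ ⌊x * 2⌋₊ = 2 * ⌊x⌋₊ + 1 := by
  have h1 : 2 * ⌊x⌋₊ ≤ ⌊x * 2⌋₊ := by
    rw [Nat.le_floor_iff (by positivity)]
    push_cast
    rw [mul_comm]
    gcongr
    exact Nat.floor_le (by positivity)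
  have h2 : ⌊x * 2⌋₊ < 2 * ⌊x⌋₊ + 2 := by
    rw [Nat.floor_lt (by positivity)]
    push_cast
    have := Nat.lt_floor_add_one x
    calc x * 2 < ((⌊x⌋₊ : ℝ≥0) + 1) * 2 := by gcongr
      _ = _ := by ring
  omega

variable {f : ℝ≥0 → ℝ} {C q : ℝ}

/-- The increments of level `n` on `[0, n]` are bounded by `C q ^ n`. -/
def DyadicBound (f : ℝ≥0 → ℝ) (C q : ℝ) : Prop :=
  ∀ n, ∀ k < n * 2 ^ n, |dyadicIncrement f n k| ≤ C * q ^ n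

lemma floor_lt_of_lt {n : ℕ} {t : ℝ≥0} (ht : t < n) : ⌊t * 2 ^ n⌋₊ < n * 2 ^ n := by
  rw [Nat.floor_lt (by positivity)]
  push_cast
  gcongr

/-- Passing to the next level moves the dyadic floor of `t` by no step or by one step of the finer
grid. -/
lemma DyadicBound.abs_succ_sub_le (h : DyadicBound f C q) (hC : 0 ≤ C) (hq : 0 ≤ q) {n : ℕ}
    {t : ℝ≥0} (ht : t < n) :
    |f (dyadicFloor (n + 1) t) - f (dyadicFloor n t)| ≤ C * q ^ (n + 1) := by
  have e : dyadicFloor n t = ((2 * ⌊t * 2 ^ n⌋₊ : ℕ) : ℝ≥0) / 2 ^ (n + 1) := by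
    rw [dyadicFloor, pow_succ]
    push_cast
    field_simp
  have hk := floor_lt_of_lt ht
  have e2 : t * 2 ^ (n + 1) = t * 2 ^ n * 2 := by ring
  rcases floor_two_mul_cases (t * 2 ^ n) with h1 | h1
  · rw [e, dyadicFloor, e2, h1]
    simp only [sub_self, abs_zero]
    positivity
  · rw [e, dyadicFloor, e2, h1]
    refine h (n + 1) (2 * ⌊t * 2 ^ n⌋₊) ?_
    rw [pow_succ]
    nlinarith [Nat.zero_le (2 ^ n)]

lemma DyadicBound.abs_sub_le (h : DyadicBound f C q) (hC : 0 ≤ C) (hq : 0 ≤ q) {n : ℕ}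
    {s t : ℝ≥0} (ht : t < n) (hst : s ≤ t) (hd : t ≤ s + 1 / 2 ^ n) :
    |f (dyadicFloor n t) - f (dyadicFloor n s)| ≤ C * q ^ n := by
  have h1 : ⌊s * 2 ^ n⌋₊ ≤ ⌊t * 2 ^ n⌋₊ := Nat.floor_mono (by gcongr)
  have h2 : ⌊t * 2 ^ n⌋₊ ≤ ⌊s * 2 ^ n⌋₊ + 1 := by
    rw [← Nat.floor_add_one (by positivity)]
    refine Nat.floor_mono ?_
    calc t * 2 ^ n ≤ (s + 1 / 2 ^ n) * 2 ^ n := by gcongr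
      _ = s * 2 ^ n + 1 := by field_simp
  have h3 := floor_lt_of_lt ht
  rcases (by omega : ⌊t * 2 ^ n⌋₊ = ⌊s * 2 ^ n⌋₊ ∨ ⌊t * 2 ^ n⌋₊ = ⌊s * 2 ^ n⌋₊ + 1) with h | h'
  · rw [dyadicFloor, dyadicFloor, h]
    simp only [sub_self, abs_zero]
    positivity
  · rw [dyadicFloor, dyadicFloor, h']
    exact h n _ (by omega)

/-- Along the dyadic floors of a fixed `t` the values are Cauchy at a geometric rate. Two times
within `2 ^ (-n)` of each other have equal or adjacent floors at level `n`, so the limit inherits a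
modulus of continuity of order `q ^ n`. -/
lemma DyadicBound.exists_limit (h : DyadicBound f C q) (hC : 0 ≤ C) (hq : 0 < q) (hq1 : q < 1) :
    ∃ g : ℝ≥0 → ℝ, Continuous g ∧ ∀ t, Tendsto (fun n => f (dyadicFloor n t)) atTop (𝓝 (g t)) := by
  have hle {t : ℝ≥0} {N : ℕ} (ht : t < N) (n : ℕ) :
      dist (f (dyadicFloor (N + n) t)) (f (dyadicFloor (N + (n + 1)) t))
        ≤ C * q ^ (N + 1) * q ^ n := by
    rw [dist_comm, Real.dist_eq]
    refine (h.abs_succ_sub_le hC hq.le (n := N + n) (ht.trans_le ?_)).trans_eq ?_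
    · exact_mod_cast Nat.le_add_right N n
    · ring
  have hex (t : ℝ≥0) : ∃ a, Tendsto (fun n => f (dyadicFloor n t)) atTop (𝓝 a) := by
    obtain ⟨N, hN⟩ := exists_nat_gt t
    obtain ⟨a, ha⟩ := cauchySeq_tendsto_of_complete
      (cauchySeq_of_le_geometric q (C * q ^ (N + 1)) hq1 (hle hN))
    refine ⟨a, (tendsto_add_atTop_iff_nat N).1 ?_⟩
    simpa only [add_comm] using ha
  choose g hg using hex
  have hgd {t : ℝ≥0} {n : ℕ} (ht : t < n) :
      dist (f (dyadicFloor n t)) (g t) ≤ C * q ^ (n + 1) / (1 - q) := by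
    refine dist_le_of_le_geometric_of_tendsto₀ (f := fun k => f (dyadicFloor (n + k) t)) q _ hq1
      (hle ht) ?_
    have := (tendsto_add_atTop_iff_nat n).2 (hg t)
    simpa only [add_comm] using this
  refine ⟨g, ?_, hg⟩
  have key {s t : ℝ≥0} {n : ℕ} (ht : t < n) (hst : s ≤ t) (hd : t ≤ s + 1 / 2 ^ n) :
      dist (g s) (g t) ≤ (C * q / (1 - q) + C + C * q / (1 - q)) * q ^ n := by
    have h1 := hgd (hst.trans_lt ht)
    have h2 := hgd ht
    have h3 := h.abs_sub_le hC hq.le ht hst hd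
    rw [dist_comm] at h1
    rw [← Real.dist_eq, dist_comm] at h3
    calc dist (g s) (g t) ≤ _ + _ + _ := dist_triangle4 _ _ _ _
      _ ≤ C * q ^ (n + 1) / (1 - q) + C * q ^ n + C * q ^ (n + 1) / (1 - q) := by gcongr
      _ = _ := by ring
  set A := C * q / (1 - q) + C + C * q / (1 - q)
  have hlim : Tendsto (fun n : ℕ => A * q ^ n) atTop (𝓝 0) := by
    simpa using (tendsto_pow_atTop_nhds_zero_of_lt_one hq.le hq1).const_mul A
  rw [continuous_iff_continuousAt]
  intro t
  rw [ContinuousAt, Metric.tendsto_nhds]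
  intro ε hε
  obtain ⟨N, hN⟩ := exists_nat_gt (t + 1)
  obtain ⟨n, hnA, hnN⟩ := ((hlim.eventually_lt_const hε).and (eventually_ge_atTop N)).exists
  have hn : t + 1 < n := hN.trans_le (by exact_mod_cast hnN)
  have hpos : (0 : ℝ≥0) < 1 / 2 ^ n := by positivity
  have e1 : ∀ᶠ u in 𝓝 t, u < t + 1 / 2 ^ n := eventually_lt_nhds (lt_add_of_pos_right t hpos)
  have e2 : ∀ᶠ u in 𝓝 t, t < u + 1 / 2 ^ n :=
    (continuous_id.add continuous_const).tendsto t |>.eventually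
      (eventually_gt_nhds (lt_add_of_pos_right t hpos))
  have e3 : ∀ᶠ u in 𝓝 t, u < t + 1 := eventually_lt_nhds (lt_add_of_pos_right t one_pos)
  filter_upwards [e1, e2, e3] with u h1 h2 h3
  rcases le_total u t with hut | hut
  · exact (key ((lt_add_of_pos_right t one_pos).trans hn) hut h2.le).trans_lt hnA
  · rw [dist_comm]
    exact (key (h3.trans hn) hut h1.le).trans_lt hnA

end Dyadic


/-! ### Kolmogorov's continuity theorem -/

section Modification

variable {Ω : Type*} [MeasurableSpace Ω] {P : Measure Ω} {X : ℝ≥0 → Ω → ℝ}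

/-- The weighted sum of the fourth powers of all dyadic increments. -/
noncomputable def dyadicEnergy (f : ℝ≥0 → ℝ) : ℝ≥0∞ :=
  ∑' n : ℕ, ENNReal.ofReal ((10 / 9) ^ (4 * n))
    * ∑ k ∈ Finset.range (n * 2 ^ n), ENNReal.ofReal (dyadicIncrement f n k ^ 4)

lemma dyadicBound_of_energy_lt_top {f : ℝ≥0 → ℝ} (h : dyadicEnergy f < ∞) :
    ∃ C, 0 ≤ C ∧ DyadicBound f C (9 / 10) := by
  set A := (dyadicEnergy f).toReal
  refine ⟨A + 1, by positivity, fun n k hk => ?_⟩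
  have h1 : ENNReal.ofReal ((10 / 9) ^ (4 * n)) * ENNReal.ofReal (dyadicIncrement f n k ^ 4)
      ≤ dyadicEnergy f := by
    refine le_trans ?_ (ENNReal.le_tsum n)
    gcongr
    exact Finset.single_le_sum (f := fun k => ENNReal.ofReal (dyadicIncrement f n k ^ 4))
      (fun _ _ => bot_le) (Finset.mem_range.2 hk)
  rw [← ENNReal.ofReal_mul (by positivity), ENNReal.ofReal_le_iff_le_toReal h.ne] at h1
  have hA : (0 : ℝ) ≤ A := ENNReal.toReal_nonneg
  -- `A + 1` replaces the fourth root of `A`, since `A < (A + 1) ^ 4`.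
  have h2 : |(10 / 9 : ℝ) ^ n * dyadicIncrement f n k| ≤ A + 1 := by
    by_contra! hcon
    have : (A + 1) ^ 4 < |(10 / 9 : ℝ) ^ n * dyadicIncrement f n k| ^ 4 := by gcongr
    rw [Even.pow_abs (by decide), mul_pow, ← pow_mul, mul_comm n 4] at this
    have h4 : A < (A + 1) ^ 4 := by nlinarith [sq_nonneg A, mul_nonneg hA hA, pow_nonneg hA 3, pow_nonneg hA 4]
    exact absurd h1 (not_le.2 (h4.trans this))
  rw [abs_mul, abs_of_pos (by positivity : (0 : ℝ) < (10 / 9) ^ n)] at h2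
  have h3 : (9 / 10 : ℝ) ^ n * (10 / 9) ^ n = 1 := by rw [← mul_pow]; norm_num
  calc |dyadicIncrement f n k| = (9 / 10 : ℝ) ^ n * ((10 / 9) ^ n * |dyadicIncrement f n k|) := by
        rw [← mul_assoc, h3, one_mul]
    _ ≤ (9 / 10 : ℝ) ^ n * (A + 1) := by gcongr
    _ = _ := mul_comm _ _

lemma measurable_dyadicIncrement (hX : ∀ t, Measurable (X t)) (n k : ℕ) :
    Measurable fun ω => dyadicIncrement (fun t => X t ω) n k :=
  (hX _).sub (hX _)

lemma measurable_dyadicEnergy (hX : ∀ t, Measurable (X t)) :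
    Measurable fun ω => dyadicEnergy fun t => X t ω := by
  have := measurable_dyadicIncrement hX
  unfold dyadicEnergy
  fun_prop

/-- Level `n` has `n * 2 ^ n` increments, each with fourth moment at most `C * 4 ^ (-n)`. With the
weight `(10 / 9) ^ (4 * n)` the ratio is `(10 / 9) ^ 4 / 2 = 10000 / 13122 < 1`; any `q` with `2 ^
(-1/4) < q < 1` could replace `9 / 10`. -/
lemma lintegral_dyadicEnergy_lt_top (hX : ∀ t, Measurable (X t)) {C : ℝ≥0}
    (hC : ∀ s t : ℝ≥0, s ≤ t →
      ∫⁻ ω, ENNReal.ofReal ((X t ω - X s ω) ^ 4) ∂P ≤ ENNReal.ofReal (C * ((t : ℝ) - s) ^ 2)) :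
    ∫⁻ ω, dyadicEnergy (fun t => X t ω) ∂P < ∞ := by
  have hm := measurable_dyadicIncrement hX
  unfold dyadicEnergy
  rw [lintegral_tsum fun n => Measurable.aemeasurable (by fun_prop)]
  have hle (n : ℕ) : ∫⁻ ω, ENNReal.ofReal ((10 / 9) ^ (4 * n))
      * ∑ k ∈ Finset.range (n * 2 ^ n), ENNReal.ofReal (dyadicIncrement (fun t => X t ω) n k ^ 4) ∂P
      ≤ ENNReal.ofReal (C * (n * (10000 / 13122) ^ n)) := by
    rw [lintegral_const_mul _ (by fun_prop), lintegral_finsetSum _ fun k _ => by fun_prop]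
    have h1 : ∀ k ∈ Finset.range (n * 2 ^ n),
        ∫⁻ ω, ENNReal.ofReal (dyadicIncrement (fun t => X t ω) n k ^ 4) ∂P
          ≤ ENNReal.ofReal (C * ((1 / 2) ^ n) ^ 2) := fun k _ => by
      refine (hC _ _ (by gcongr; omega)).trans_eq ?_
      congr 3
      push_cast
      rw [← sub_div, add_sub_cancel_left, one_div_pow]
    refine (mul_le_mul_right (Finset.sum_le_sum h1) _).trans_eq ?_
    rw [Finset.sum_const, Finset.card_range, ← ENNReal.ofReal_nsmul,
      ← ENNReal.ofReal_mul (by positivity)]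
    congr 1
    rw [nsmul_eq_mul, pow_mul, ← pow_mul (1 / 2 : ℝ) n 2, mul_comm n 2, pow_mul (1 / 2 : ℝ) 2 n]
    push_cast
    have e : ((10 / 9 : ℝ) ^ 4) ^ n * (2 ^ n * ((1 / 2 : ℝ) ^ 2) ^ n) = (10000 / 13122) ^ n := by
      rw [← mul_pow, ← mul_pow]
      norm_num
    rw [← e]
    ring
  refine (ENNReal.tsum_le_tsum hle).trans_lt ?_
  have hs : Summable fun n : ℕ => (C : ℝ) * (n * (10000 / 13122 : ℝ) ^ n) := by
    refine Summable.mul_left _ ?_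
    simpa using summable_pow_mul_geometric_of_norm_lt_one 1
      (r := (10000 / 13122 : ℝ)) (by rw [Real.norm_eq_abs]; norm_num [abs_lt])
  rw [← ENNReal.ofReal_tsum_of_nonneg (fun n => by positivity) hs]
  exact ENNReal.ofReal_lt_top

/-- **Kolmogorov continuity theorem** for fourth moments. -/
lemma exists_continuous_modification (hX : ∀ t, Measurable (X t)) {C : ℝ≥0}
    (hC : ∀ s t : ℝ≥0, s ≤ t →
      ∫⁻ ω, ENNReal.ofReal ((X t ω - X s ω) ^ 4) ∂P ≤ ENNReal.ofReal (C * ((t : ℝ) - s) ^ 2)) :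
    ∃ Y : ℝ≥0 → Ω → ℝ, (∀ t, Measurable (Y t)) ∧ (∀ ω, Continuous fun t => Y t ω) ∧
      ∀ t, X t =ᵐ[P] Y t := by
  classical
  -- Off this measurable set of full measure the path is replaced by zero, so that every path is
  -- continuous.
  set G : Set Ω := {ω | dyadicEnergy (fun t => X t ω) < ∞}
  have hG : MeasurableSet G := measurableSet_lt (measurable_dyadicEnergy hX) measurable_const
  have hGae : ∀ᵐ ω ∂P, ω ∈ G :=
    ae_lt_top (measurable_dyadicEnergy hX) (lintegral_dyadicEnergy_lt_top hX hC).ne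
  have hex (ω : Ω) : ∃ g : ℝ≥0 → ℝ, Continuous g ∧ ∀ t,
      Tendsto (fun n => G.indicator (X (dyadicFloor n t)) ω) atTop (𝓝 (g t)) := by
    by_cases hω : ω ∈ G
    · obtain ⟨A, hA, hb⟩ := dyadicBound_of_energy_lt_top hω
      simpa only [Set.indicator_of_mem hω] using
        hb.exists_limit hA (by norm_num) (by norm_num)
    · exact ⟨0, continuous_zero, fun t => by simp [Set.indicator_of_notMem hω]⟩
  choose Y hYc hY using hex
  refine ⟨fun t ω => Y ω t, fun t => ?_, hYc, fun t => ?_⟩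
  · exact measurable_of_tendsto_metrizable (fun n => (hX _).indicator hG)
      (tendsto_pi_nhds.2 fun ω => hY ω t)
  · have hm (n : ℕ) : Measurable fun ω => ENNReal.ofReal ((X t ω - X (dyadicFloor n t) ω) ^ 4) := by
      have := hX t
      have := hX (dyadicFloor n t)
      fun_prop
    -- The fourth moments of `X t - X (dyadicFloor n t)` are summable, hence `X` along the floors
    -- tends to `X t` almost surely. This identifies the limit.
    have hfin : ∫⁻ ω, ∑' n, ENNReal.ofReal ((X t ω - X (dyadicFloor n t) ω) ^ 4) ∂P < ∞ := by
      rw [lintegral_tsum fun n => (hm n).aemeasurable]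
      have hs : Summable fun n : ℕ => (C : ℝ) * (1 / 4 : ℝ) ^ n :=
        (summable_geometric_of_lt_one (by norm_num) (by norm_num)).mul_left _
      refine (ENNReal.tsum_le_tsum (g := fun n => ENNReal.ofReal (C * (1 / 4 : ℝ) ^ n))
        fun n => ?_).trans_lt ?_
      · refine (hC _ _ (dyadicFloor_le n t)).trans ?_
        have h0 : (0 : ℝ) ≤ (t : ℝ) - dyadicFloor n t :=
          sub_nonneg.2 (NNReal.coe_le_coe.2 (dyadicFloor_le n t))
        have h1 : ((t : ℝ) - dyadicFloor n t) ^ 2 ≤ (1 / 4 : ℝ) ^ n := by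
          calc ((t : ℝ) - dyadicFloor n t) ^ 2 ≤ ((2⁻¹ : ℝ) ^ n) ^ 2 := by
                gcongr
                exact sub_dyadicFloor_le n t
            _ = (1 / 4 : ℝ) ^ n := by rw [← pow_mul, mul_comm, pow_mul]; norm_num
        gcongr
      · rw [← ENNReal.ofReal_tsum_of_nonneg (fun n => by positivity) hs]
        exact ENNReal.ofReal_lt_top
    filter_upwards [hGae, ae_lt_top (Measurable.tsum hm) hfin.ne] with ω hω hlt
    have h0 : Tendsto (fun n => (X t ω - X (dyadicFloor n t) ω) ^ 4) atTop (𝓝 0) := by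
      have := (ENNReal.tendsto_toReal ENNReal.zero_ne_top).comp
        (ENNReal.tendsto_atTop_zero_of_tsum_ne_top hlt.ne)
      refine this.congr fun n => ?_
      exact ENNReal.toReal_ofReal (by positivity)
    have h1 : Tendsto (fun n => (X t ω - X (dyadicFloor n t) ω) ^ 4) atTop
        (𝓝 ((X t ω - Y ω t) ^ 4)) := by
      have := hY ω t
      simp only [Set.indicator_of_mem hω] at this
      exact (tendsto_const_nhds.sub this).pow 4
    have := tendsto_nhds_unique h1 h0
    exact sub_eq_zero.1 (pow_eq_zero_iff (by norm_num) |>.1 this)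

end Modification


/-! ### Isonormal Gaussian process and pre-Brownian motion -/

section Isonormal

/-- The map is 1-Lipschitz, because `x ↦ exp (i x)` is and the `L¹` norm is at most the `L²` norm.
It lets characteristic functions pass through `L²`-convergent series. -/
lemma continuous_integral_exp_Lp {Ω : Type*} [MeasurableSpace Ω] (P : Measure Ω)
    [IsProbabilityMeasure P] :
    Continuous fun h : Lp ℝ 2 P => ∫ ω, Complex.exp (Complex.I * (h ω : ℂ)) ∂P := by
  refine LipschitzWith.continuous (K := 1) (LipschitzWith.of_dist_le_mul fun f g => ?_)
  have hi (f : Lp ℝ 2 P) : Integrable (fun ω => Complex.exp (Complex.I * (f ω : ℂ))) P := by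
    have := Lp.aestronglyMeasurable f
    refine Integrable.of_bound (C := 1) (by fun_prop) (.of_forall fun ω => ?_)
    rw [mul_comm, Complex.norm_exp_ofReal_mul_I]
  have hL : Integrable (fun ω => (f - g) ω) P := (Lp.memLp (f - g)).integrable one_le_two
  rw [dist_eq_norm, dist_eq_norm, ← integral_sub (hi f) (hi g), NNReal.coe_one, one_mul]
  calc ‖∫ ω, (Complex.exp (Complex.I * (f ω : ℂ)) - Complex.exp (Complex.I * (g ω : ℂ))) ∂P‖
      ≤ ∫ ω, ‖(f - g) ω‖ ∂P := by
        refine norm_integral_le_of_norm_le hL.norm ?_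
        filter_upwards [Lp.coeFn_sub f g] with ω hω
        have : Complex.exp (Complex.I * (f ω : ℂ)) - Complex.exp (Complex.I * (g ω : ℂ))
            = Complex.exp ((g ω : ℂ) * Complex.I)
              * (Complex.exp (Complex.I * ((f ω - g ω : ℝ) : ℂ)) - 1) := by
          rw [mul_sub, ← Complex.exp_add, mul_one, mul_comm (g ω : ℂ)]
          congr 2
          push_cast
          ring
        rw [this, norm_mul, Complex.norm_exp_ofReal_mul_I, one_mul, hω]
        exact Real.norm_exp_I_mul_ofReal_sub_one_le
    _ = (eLpNorm (f - g : Lp ℝ 2 P) 1 P).toReal := by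
        rw [eLpNorm_one_eq_lintegral_enorm, integral_norm_eq_lintegral_enorm hL.1]
    _ ≤ ‖f - g‖ := by
        rw [Lp.norm_def]
        exact ENNReal.toReal_mono (Lp.eLpNorm_ne_top _)
          (eLpNorm_le_eLpNorm_of_exponent_le one_le_two hL.1)

/-- The product of standard Gaussian measures. -/
noncomputable abbrev whiteNoise (ι : Type*) : Measure (ι → ℝ) :=
  Measure.infinitePi fun _ : ι => gaussianReal 0 1

lemma memLp_whiteNoise_apply {ι : Type*} (i : ι) :
    MemLp (fun ω : ι → ℝ => ω i) 2 (whiteNoise ι) :=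
  (memLp_id_gaussianReal 2).comp_measurePreserving
    (measurePreserving_eval_infinitePi (fun _ : ι => gaussianReal 0 1) i)

lemma integral_whiteNoise_apply {ι : Type*} (i : ι) {f : ℝ → ℝ} (hf : Measurable f) :
    ∫ ω, f (ω i) ∂(whiteNoise ι) = ∫ x, f x ∂(gaussianReal 0 1) := by
  rw [← (measurePreserving_eval_infinitePi (fun _ : ι => gaussianReal 0 1) i).map_eq,
    integral_map (measurable_pi_apply i).aemeasurable hf.aestronglyMeasurable]

lemma orthonormal_whiteNoise (ι : Type*) :
    Orthonormal ℝ fun i : ι => (memLp_whiteNoise_apply i).toLp := by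
  classical
  rw [orthonormal_iff_ite]
  intro i j
  have e : ⟪(memLp_whiteNoise_apply i).toLp, (memLp_whiteNoise_apply j).toLp⟫
      = ∫ ω, ω i * ω j ∂(whiteNoise ι) := by
    rw [L2.inner_def]
    refine integral_congr_ae ?_
    filter_upwards [(memLp_whiteNoise_apply i).coeFn_toLp, (memLp_whiteNoise_apply j).coeFn_toLp]
      with ω h1 h2
    rw [h1, h2]
    exact mul_comm _ _
  rw [e]
  split_ifs with hij
  · subst hij
    rw [integral_whiteNoise_apply i (f := fun x => x * x) (by fun_prop)]
    have := variance_eq_sub (X := id) (memLp_id_gaussianReal (μ := 0) (v := 1) 2)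
    rw [variance_id_gaussianReal] at this
    simpa [sq] using this.symm
  · have hind : IndepFun (fun ω : ι → ℝ => ω i) (fun ω => ω j) (whiteNoise ι) :=
      (iIndepFun_infinitePi (P := fun _ : ι => gaussianReal 0 1) (X := fun _ x => x)
        fun _ => measurable_id).indepFun hij
    have := hind.integral_mul_eq_mul_integral
      (measurable_pi_apply i).aestronglyMeasurable (measurable_pi_apply j).aestronglyMeasurable
    simp only [Pi.mul_apply] at this
    refine this.trans ?_
    rw [integral_whiteNoise_apply i (f := fun x => x) measurable_id]
    simp

lemma integral_exp_sum_whiteNoise {ι : Type*} (c : ι → ℝ) (s : Finset ι) :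
    ∫ ω, Complex.exp (Complex.I * ((∑ i ∈ s, c i * ω i : ℝ) : ℂ)) ∂(whiteNoise ι)
      = Complex.exp (-((∑ i ∈ s, c i ^ 2 : ℝ) : ℂ) / 2) := by
  have hI : iIndepFun (fun (i : ι) (ω : ι → ℝ) => c i * ω i) (whiteNoise ι) :=
    iIndepFun_infinitePi (P := fun _ : ι => gaussianReal 0 1) (X := fun i x => c i * x)
      fun _ => by fun_prop
  have h := congrFun ((hI.restrict s).charFun_map_fun_finsetSum_eq_prod
    (fun k _ => Measurable.aemeasurable (by fun_prop))) 1
  rw [charFun_apply, integral_map (Measurable.aemeasurable (by fun_prop)) (by fun_prop)] at h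
  have hmap (i : ι) : (whiteNoise ι).map (fun ω => c i * ω i)
      = gaussianReal 0 (.mk (c i ^ 2) (sq_nonneg _)) := by
    have h1 : (whiteNoise ι).map (fun ω => ω i) = gaussianReal 0 1 :=
      (measurePreserving_eval_infinitePi (fun _ : ι => gaussianReal 0 1) i).map_eq
    have : (fun ω : ι → ℝ => c i * ω i) = (fun x => c i * x) ∘ fun ω => ω i := rfl
    rw [this, ← Measure.map_map (by fun_prop) (by fun_prop), h1, gaussianReal_map_const_mul]
    simp
  simp only [hmap, charFun_gaussianReal, Finset.prod_apply, ← Complex.exp_sum] at h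
  refine Eq.trans (integral_congr_ae (.of_forall fun ω => ?_)) (h.trans ?_)
  · simp [mul_comm]
  · congr 1
    push_cast
    rw [← Finset.sum_neg_distrib, Finset.sum_div]
    exact Finset.sum_congr rfl fun i _ => by simp; ring

/-- Send a Hilbert basis to independent standard Gaussians and extend isometrically. Finite
combinations have the right Gaussian characteristic function, and both sides are continuous in `L²`.
-/
lemma exists_isonormal (H : Type) [NormedAddCommGroup H] [InnerProductSpace ℝ H]
    [CompleteSpace H] :
    ∃ (Ω : Type) (_ : MeasurableSpace Ω) (P : Measure Ω) (_ : IsProbabilityMeasure P)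
      (Φ : H →ₗᵢ[ℝ] Lp ℝ 2 P), ∀ f, P.map (Φ f) = gaussianReal 0 (‖f‖₊ ^ 2) := by
  obtain ⟨w, b, -⟩ := exists_hilbertBasis ℝ H
  set P := whiteNoise w
  have hv := (orthonormal_whiteNoise w).orthogonalFamily
  set Φ : H →ₗᵢ[ℝ] Lp ℝ 2 P := hv.linearIsometry.comp b.repr.toLinearIsometry
  have hint (f : H) : ∫ ω, Complex.exp (Complex.I * (Φ f ω : ℂ)) ∂P
      = Complex.exp (-((‖f‖ ^ 2 : ℝ) : ℂ) / 2) := by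
    have hsum : HasSum (fun i => b.repr f i • (memLp_whiteNoise_apply i).toLp) (Φ f) :=
      hv.hasSum_linearIsometry (b.repr f)
    have h1 := ((continuous_integral_exp_Lp P).tendsto (Φ f)).comp hsum
    have hc : Continuous fun h : Lp ℝ 2 P => Complex.exp (-((‖h‖ ^ 2 : ℝ) : ℂ) / 2) := by fun_prop
    have h2 := (hc.tendsto (Φ f)).comp hsum
    rw [Φ.norm_map] at h2
    refine tendsto_nhds_unique h1 (h2.congr fun s => ?_)
    have e : ‖∑ i ∈ s, b.repr f i • (memLp_whiteNoise_apply i).toLp‖ ^ 2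
        = ∑ i ∈ s, b.repr f i ^ 2 := by
      rw [← real_inner_self_eq_norm_sq, (orthonormal_whiteNoise w).inner_sum]
      simp [sq]
    simp only [Function.comp_apply, e]
    rw [← integral_exp_sum_whiteNoise]
    refine integral_congr_ae ?_
    have ha : ∀ᵐ ω ∂P, ∀ i ∈ s, (b.repr f i • (memLp_whiteNoise_apply i).toLp : Lp ℝ 2 P) ω
        = b.repr f i * ω i := by
      rw [eventually_all_finset]
      intro i _
      filter_upwards [Lp.coeFn_smul (b.repr f i) (memLp_whiteNoise_apply i).toLp,
        (memLp_whiteNoise_apply i).coeFn_toLp] with ω h1 h2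
      rw [h1, Pi.smul_apply, h2, smul_eq_mul]
    filter_upwards [Lp.coeFn_finsetSum s fun i => b.repr f i • (memLp_whiteNoise_apply i).toLp, ha]
      with ω h1 h2
    rw [h1, Finset.sum_apply, Finset.sum_congr rfl h2]
  refine ⟨w → ℝ, inferInstance, P, inferInstance, Φ, fun f => ?_⟩
  have hm : AEMeasurable (Φ f) P := (Lp.aestronglyMeasurable (Φ f)).aemeasurable
  have := Measure.isProbabilityMeasure_map hm
  refine Measure.ext_of_charFun ?_
  ext t
  rw [charFun_apply, integral_map hm (by fun_prop), charFun_gaussianReal]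
  have h := hint (t • f)
  rw [norm_smul, mul_pow, Real.norm_eq_abs, sq_abs] at h
  refine Eq.trans (integral_congr_ae ?_) (h.trans ?_)
  · rw [map_smul]
    filter_upwards [Lp.coeFn_smul t (Φ f)] with ω hω
    rw [hω]
    simp [mul_comm]
  · congr 1
    push_cast
    ring

/-- There is a pre-Brownian motion. -/
lemma exists_isPreBrownianReal :
    ∃ (Ω : Type) (_ : MeasurableSpace Ω) (P : Measure Ω) (_ : IsProbabilityMeasure P)
      (X : ℝ≥0 → Ω → ℝ), (∀ t, Measurable (X t)) ∧ IsPreBrownianReal X P := by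
  obtain ⟨Ω, mΩ, P, hP, Φ, hΦ⟩ := exists_isonormal (Lp ℝ 2 (volume : Measure ℝ))
  have hfin (t : ℝ≥0) : (volume (Set.Icc (0 : ℝ) t)) ≠ ∞ := by simp
  -- The indicators of `[0, s]` and `[0, t]` have inner product `min s t`, the Brownian covariance.
  set u : ℝ≥0 → Lp ℝ 2 (volume : Measure ℝ) := fun t =>
    indicatorConstLp 2 (measurableSet_Icc (a := (0 : ℝ)) (b := t)) (hfin t) 1
  refine ⟨Ω, mΩ, P, hP, fun t => Φ (u t), fun t => (Lp.stronglyMeasurable _).measurable, ?_⟩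
  have hmean (f : Lp ℝ 2 (volume : Measure ℝ)) : ∫ ω, Φ f ω ∂P = 0 := by
    have hm : AEMeasurable (Φ f) P := (Lp.aestronglyMeasurable (Φ f)).aemeasurable
    have := integral_map hm (f := fun x : ℝ => x) (by fun_prop)
    rw [← this, hΦ, integral_id_gaussianReal]
  refine IsGaussianProcess.isPreBrownianReal_of_covariance ⟨fun I => ⟨?_⟩⟩ (fun t => hmean (u t))
    fun s t hst => ?_
  · have hm : AEMeasurable (fun ω => I.restrict fun t => Φ (u t) ω) P :=
      aemeasurable_pi_lambda _ fun t => (Lp.aestronglyMeasurable (Φ (u t))).aemeasurable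
    -- A linear functional of the values `Φ (u t)` is again `Φ` of a vector, hence Gaussian.
    refine isGaussian_of_map_eq_gaussianReal fun L => ?_
    refine ⟨0, ‖∑ t : I, L (Pi.single t 1) • u t‖₊ ^ 2, ?_⟩
    rw [← hΦ, AEMeasurable.map_map_of_aemeasurable L.continuous.measurable.aemeasurable hm]
    refine Measure.map_congr ?_
    rw [map_sum]
    have ha : ∀ᵐ ω ∂P, ∀ t : I, (Φ (L (Pi.single t 1) • u t)) ω
        = L (Pi.single t 1) * Φ (u t) ω := by
      rw [ae_all_iff]
      intro t
      rw [map_smul]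
      filter_upwards [Lp.coeFn_smul (L (Pi.single t 1)) (Φ (u t))] with ω h1
      rw [h1, Pi.smul_apply, smul_eq_mul]
    filter_upwards [Lp.coeFn_finsetSum Finset.univ fun t : I => Φ (L (Pi.single t 1) • u t), ha]
      with ω h1 h2
    rw [h1, Finset.sum_apply, Finset.sum_congr rfl fun t _ => h2 t, Function.comp_apply]
    have := L.toLinearMap.pi_apply_eq_sum_univ (I.restrict fun t => Φ (u t) ω)
    simp only [ContinuousLinearMap.coe_coe] at this
    rw [this]
    refine Finset.sum_congr rfl fun t _ => ?_
    rw [smul_eq_mul, mul_comm]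
    congr 2
    ext j
    simp [Pi.single_apply, eq_comm]
  · rw [covariance_eq_sub (Lp.memLp _) (Lp.memLp _), hmean, zero_mul, sub_zero]
    have h1 : ⟪Φ (u s), Φ (u t)⟫ = ∫ ω, (Φ (u s) * Φ (u t) : Ω → ℝ) ω ∂P := by
      rw [L2.inner_def]
      exact integral_congr_ae (.of_forall fun ω => mul_comm _ _)
    rw [← h1, Φ.inner_map_map, L2.inner_indicatorConstLp_one]
    rw [integral_congr_ae (ae_restrict_of_ae indicatorConstLp_coeFn)]
    rw [setIntegral_indicator measurableSet_Icc]
    rw [Set.inter_eq_left.2 (Set.Icc_subset_Icc_right (by exact_mod_cast hst))]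
    simp

end Isonormal


/-! ### Finite sums of independent processes -/

lemma iIndepFun_path_sum_left {ι E Ω : Type*} [NormedAddCommGroup E] [MeasurableSpace E]
    [BorelSpace E] [SecondCountableTopology E] [MeasurableSpace Ω] {P : Measure Ω}
    [IsProbabilityMeasure P] {Y : ι → ℝ≥0 → Ω → E} (hm : ∀ j t, Measurable (Y j t))
    (hind : iIndepFun (fun j ω t => Y j t ω) P) {s : Finset ι} {j : ι} (hj : j ∉ s) :
    IndepFun (fun ω t => ∑ i ∈ s, Y i t ω) (fun ω t => Y j t ω) P := by
  have := hind.indepFun_finsetSum_of_notMem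
    (fun i => measurable_pi_lambda _ fun t => hm i t) hj
  refine this.congr (.of_forall fun ω => ?_) (.of_forall fun ω => rfl)
  ext t
  simp

lemma HasLevyIncrements.sum {ι E Ω : Type*} [NormedAddCommGroup E] [InnerProductSpace ℝ E]
    [MeasurableSpace E] [BorelSpace E] [SecondCountableTopology E] [MeasurableSpace Ω]
    {P : Measure Ω} [IsProbabilityMeasure P] {Y : ι → ℝ≥0 → Ω → E} {ψ : ι → E → ℂ}
    (hY : ∀ j, HasLevyIncrements (Y j) P (ψ j)) (hind : iIndepFun (fun j ω t => Y j t ω) P)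
    (s : Finset ι) :
    HasLevyIncrements (fun t ω => ∑ j ∈ s, Y j t ω) P (fun ξ => ∑ j ∈ s, ψ j ξ) := by
  classical
  induction s using Finset.induction_on with
  | empty => simpa using hasLevyIncrements_drift (0 : E) (P := P)
  | insert j s hj ih =>
    have := ih.add (hY j) (iIndepFun_path_sum_left (fun j => (hY j).measurable) hind hj)
    simpa only [Finset.sum_insert hj, add_comm] using this

/-! ### Brownian motion with continuous paths -/

section Brownian

lemma lintegral_pow_four_gaussianReal (v : ℝ≥0) :
    ∫⁻ x, ENNReal.ofReal (x ^ 4) ∂(gaussianReal 0 v)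
      = ENNReal.ofReal ((v : ℝ) ^ 2) * ∫⁻ x, ENNReal.ofReal (x ^ 4) ∂(gaussianReal 0 1) := by
  have : gaussianReal 0 v = (gaussianReal 0 1).map fun x => √v * x := by
    rw [gaussianReal_map_const_mul]
    simp only [mul_zero, mul_one]
    congr 1
    ext
    exact (Real.sq_sqrt v.coe_nonneg).symm
  rw [this, lintegral_map (by fun_prop) (by fun_prop), ← lintegral_const_mul _ (by fun_prop)]
  refine lintegral_congr fun x => ?_
  rw [← ENNReal.ofReal_mul (by positivity), mul_pow]
  congr 2
  rw [show (4 : ℕ) = 2 * 2 from rfl, pow_mul, Real.sq_sqrt v.coe_nonneg]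

lemma lintegral_pow_four_gaussianReal_one_lt_top :
    ∫⁻ x, ENNReal.ofReal (x ^ 4) ∂(gaussianReal 0 1) < ∞ := by
  have h := (memLp_id_gaussianReal (μ := 0) (v := 1) 4).integrable_norm_pow (by norm_num)
  refine lt_of_eq_of_lt (lintegral_congr fun x => ?_) h.lintegral_lt_top
  simp [Even.pow_abs (by decide : Even 4)]

/-- There is a Brownian motion all of whose paths are continuous. -/
lemma exists_brownian :
    ∃ (Ω : Type) (_ : MeasurableSpace Ω) (P : Measure Ω) (_ : IsProbabilityMeasure P)
      (B : ℝ≥0 → Ω → ℝ), (∀ t, Measurable (B t)) ∧ (∀ ω, Continuous fun t => B t ω) ∧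
        IsPreBrownianReal B P := by
  obtain ⟨Ω, mΩ, P, hP, X, hm, hX⟩ := exists_isPreBrownianReal
  set C : ℝ≥0 := (∫⁻ x, ENNReal.ofReal (x ^ 4) ∂(gaussianReal 0 1)).toNNReal
  obtain ⟨B, hBm, hBc, hB⟩ := exists_continuous_modification hm (P := P) (C := C) fun s t hst => by
    have h := hX.hasLaw_sub t s
    have e : ∫⁻ ω, ENNReal.ofReal ((X t ω - X s ω) ^ 4) ∂P
        = ∫⁻ x, ENNReal.ofReal (x ^ 4) ∂(P.map (X t - X s)) := by
      rw [lintegral_map (by fun_prop) ((hm t).sub (hm s))]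
      rfl
    rw [e, h.map_eq, lintegral_pow_four_gaussianReal, mul_comm]
    refine le_of_eq ?_
    rw [ENNReal.ofReal_mul C.coe_nonneg, ENNReal.ofReal_coe_nnreal,
      ENNReal.coe_toNNReal lintegral_pow_four_gaussianReal_one_lt_top.ne]
    congr 2
    rw [coe_nndist, Real.dist_eq, sq_abs]
    rfl
  exact ⟨Ω, mΩ, P, hP, B, hBm, hBc, hX.congr hB⟩

variable {Ω : Type*} [MeasurableSpace Ω] {P : Measure Ω} {B : ℝ≥0 → Ω → ℝ}

lemma IsPreBrownianReal.comp_measurePreserving {S : Type*} [MeasurableSpace S] {R : Measure S}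
    (hB : IsPreBrownianReal B P) {Z : S → Ω} (hZ : MeasurePreserving Z R P) :
    IsPreBrownianReal (fun t ω => B t (Z ω)) R where
  hasLaw I := (hB.hasLaw I).comp hZ.hasLaw

/-- The rank-one piece of the Gaussian part: `√Q W` is the sum of these over the coordinates of `W`,
with `v = √Q e_i`. -/
lemma hasLevyIncrements_brownian_smul {E : Type*} [NormedAddCommGroup E] [InnerProductSpace ℝ E]
    [MeasurableSpace E] [BorelSpace E] [SecondCountableTopology E] [IsProbabilityMeasure P]
    (hB : IsPreBrownianReal B P) (hm : ∀ t, Measurable (B t)) (v : E) :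
    HasLevyIncrements (fun t ω => B t ω • v) P
      (fun ξ => 1 / 2 * ((⟪v, ξ⟫ ^ 2 : ℝ) : ℂ)) := by
  refine .of_indepFun (fun t => (hm t).smul_const v) (fun s t hst => ?_) fun s t hst ξ => ?_
  · have h := hB.indepFun_shift s
    have := h.comp (φ := fun f => f (t - s) • v) (ψ := fun f (r : Set.Iic s) => f r • v)
      (by fun_prop) (by fun_prop)
    refine this.congr (.of_forall fun ω => ?_) (.of_forall fun ω => rfl)
    simp [add_tsub_cancel_of_le hst, sub_smul]
  · have h := hB.hasLaw_sub t s
    have e := congrFun (congrArg charFun h.map_eq) ⟪v, ξ⟫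
    rw [charFun_apply, integral_map h.aemeasurable (by fun_prop), charFun_gaussianReal] at e
    refine Eq.trans (integral_congr_ae (.of_forall fun ω => ?_)) (e.trans ?_)
    · simp only [← sub_smul, real_inner_smul_left, Pi.sub_apply]
      congr 2
      simp [mul_comm]
    · congr 1
      rw [coe_nndist, Real.dist_eq, abs_of_nonneg (by simpa using hst)]
      push_cast
      simp only [NNReal.val_eq_coe]
      ring

end Brownian

/-! ### The Wiener process and its image under `√Q` -/

section Wiener

variable {d : ℕ}

lemma toEuclideanCLM_apply_eq_sum (A : Matrix (Fin d) (Fin d) ℝ) (x : EuclideanSpace ℝ (Fin d)) :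
    Matrix.toEuclideanCLM (𝕜 := ℝ) A x
      = ∑ i, x i • Matrix.toEuclideanCLM (𝕜 := ℝ) A (EuclideanSpace.single i 1) := by
  conv_lhs => rw [← (EuclideanSpace.basisFun (Fin d) ℝ).sum_repr x]
  simp

/-- As `√Q` is self-adjoint, the left side is `‖√Q ξ‖ ^ 2` written in coordinates. -/
lemma sum_inner_sqrt_sq {Q : Matrix (Fin d) (Fin d) ℝ} (hQ : Q.PosSemidef)
    (ξ : EuclideanSpace ℝ (Fin d)) :
    ∑ i, ⟪Matrix.toEuclideanCLM (𝕜 := ℝ) (CFC.sqrt Q) (EuclideanSpace.single i 1), ξ⟫ ^ 2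
      = ⟪ξ, Matrix.toEuclideanCLM (𝕜 := ℝ) Q ξ⟫ := by
  set A := Matrix.toEuclideanCLM (𝕜 := ℝ) (CFC.sqrt Q)
  have hsa : IsSelfAdjoint A := by
    have : IsSelfAdjoint (CFC.sqrt Q) := (CFC.sqrt_nonneg Q).isSelfAdjoint
    exact this.map _
  have hA (x y : EuclideanSpace ℝ (Fin d)) : ⟪A x, y⟫ = ⟪x, A y⟫ := by
    rw [← ContinuousLinearMap.adjoint_inner_right, ← ContinuousLinearMap.star_eq_adjoint,
      hsa.star_eq]
  have hsq : Matrix.toEuclideanCLM (𝕜 := ℝ) Q = A * A := by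
    rw [← map_mul, CFC.sqrt_mul_sqrt_self Q hQ.nonneg]
  rw [hsq, mul_apply_eq_comp, ← hA, real_inner_self_eq_norm_sq,
    EuclideanSpace.norm_sq_eq]
  refine Finset.sum_congr rfl fun i _ => ?_
  rw [hA, EuclideanSpace.inner_single_left]
  simp

/-- There is a Wiener process all of whose paths are continuous, and its image under `√Q` has the
exponent of a centered Gaussian process with covariance `Q`. -/
lemma exists_wiener {Q : Matrix (Fin d) (Fin d) ℝ} (hQ : Q.PosSemidef) :
    ∃ (Ω : Type) (_ : MeasurableSpace Ω) (P : Measure Ω) (_ : IsProbabilityMeasure P)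
      (W : ℝ≥0 → Ω → EuclideanSpace ℝ (Fin d)), IsWienerProcess W P ∧
        (∀ ω, Continuous fun t => W t ω) ∧
        HasLevyIncrements (fun t ω => Matrix.toEuclideanCLM (𝕜 := ℝ) (CFC.sqrt Q) (W t ω)) P
          (fun ξ => 1 / 2 * (⟪ξ, Matrix.toEuclideanCLM (𝕜 := ℝ) Q ξ⟫ : ℂ)) := by
  obtain ⟨Ω, mΩ, R, hR, B, hm, hc, hB⟩ := exists_brownian
  set P : Measure (Fin d → Ω) := Measure.infinitePi fun _ => R
  have hev (i : Fin d) : MeasurePreserving (fun ω : Fin d → Ω => ω i) P R :=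
    measurePreserving_eval_infinitePi (fun _ => R) i
  have hBi (i : Fin d) : IsPreBrownianReal (fun t (ω : Fin d → Ω) => B t (ω i)) P :=
    IsPreBrownianReal.comp_measurePreserving hB (hev i)
  have hmi (i : Fin d) (t : ℝ≥0) : Measurable fun ω : Fin d → Ω => B t (ω i) :=
    (hm t).comp (measurable_pi_apply i)
  have hind : iIndepFun (fun (i : Fin d) (ω : Fin d → Ω) (t : ℝ≥0) => B t (ω i)) P :=
    iIndepFun_infinitePi (X := fun _ ω t => B t ω) fun _ => measurable_pi_lambda _ hm
  refine ⟨Fin d → Ω, inferInstance, P, inferInstance, fun t ω => WithLp.toLp 2 fun i => B t (ω i),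
    ⟨fun t => ?_, fun i => ⟨hBi i, .of_forall fun ω => hc (ω i)⟩, hind⟩, fun ω => ?_, ?_⟩
  · exact (WithLp.measurable_toLp 2 _).comp (measurable_pi_lambda _ fun i => hmi i t)
  · have := fun i => hc (ω i)
    fun_prop
  · have h := HasLevyIncrements.sum (fun i => hasLevyIncrements_brownian_smul (hBi i) (hmi i)
      (Matrix.toEuclideanCLM (𝕜 := ℝ) (CFC.sqrt Q) (EuclideanSpace.single i 1)))
      (hind.comp (fun i f t => f t • Matrix.toEuclideanCLM (𝕜 := ℝ) (CFC.sqrt Q)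
        (EuclideanSpace.single i 1)) fun i => by fun_prop) Finset.univ
    refine Eq.mp ?_ h
    congr 1
    · ext t ω : 2
      rw [toEuclideanCLM_apply_eq_sum]
    · ext ξ
      rw [← Finset.mul_sum, ← sum_inner_sqrt_sq hQ]
      push_cast
      rfl

end Wiener


/-! ### Geometry of the shells -/

section Shells

variable {d : ℕ}

lemma mem_shell_succ {n : ℕ} {y : EuclideanSpace ℝ (Fin d)} :
    y ∈ shell d (n + 1) ↔ 1 / ((n : ℝ) + 2) ≤ ‖y‖ ∧ ‖y‖ < 1 / ((n : ℝ) + 1) := Iff.rfl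

lemma mem_shell_zero {y : EuclideanSpace ℝ (Fin d)} : y ∈ shell d 0 ↔ 1 ≤ ‖y‖ := Iff.rfl

lemma measurableSet_shell (n : ℕ) : MeasurableSet (shell d n) := by
  rcases n with _ | n
  · exact measurableSet_le measurable_const measurable_norm
  · exact (measurableSet_le measurable_const measurable_norm).inter
      (measurableSet_lt measurable_norm measurable_const)

lemma norm_ge_of_mem_shell {n : ℕ} {y : EuclideanSpace ℝ (Fin d)} (hy : y ∈ shell d n) :
    1 / ((n : ℝ) + 1) ≤ ‖y‖ := by
  rcases n with _ | n
  · simpa using mem_shell_zero.1 hy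
  · convert (mem_shell_succ.1 hy).1 using 2
    push_cast
    ring

lemma norm_lt_of_mem_shell {n : ℕ} (hn : n ≠ 0) {y : EuclideanSpace ℝ (Fin d)}
    (hy : y ∈ shell d n) : ‖y‖ < 1 / (n : ℝ) := by
  obtain ⟨n, rfl⟩ := Nat.exists_eq_succ_of_ne_zero hn
  simpa using (mem_shell_succ.1 hy).2

lemma norm_lt_one_of_mem_shell {n : ℕ} (hn : n ≠ 0) {y : EuclideanSpace ℝ (Fin d)}
    (hy : y ∈ shell d n) : ‖y‖ < 1 :=
  (norm_lt_of_mem_shell hn hy).trans_le <| by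
    rw [div_le_one (by positivity)]
    exact_mod_cast Nat.one_le_iff_ne_zero.2 hn

lemma pairwise_disjoint_shell : Pairwise (Function.onFun Disjoint (shell d)) := by
  have key : ∀ m n : ℕ, m < n → Disjoint (shell d m) (shell d n) := fun m n h => by
    rw [Set.disjoint_left]
    intro y h1 h2
    have h3 := norm_ge_of_mem_shell h1
    have h4 := norm_lt_of_mem_shell (by omega) h2
    have h5 : 1 / (n : ℝ) ≤ 1 / ((m : ℝ) + 1) :=
      one_div_le_one_div_of_le (by positivity) (by exact_mod_cast h)
    linarith
  intro m n hmn
  rcases lt_or_gt_of_ne hmn with h | h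
  · exact key m n h
  · exact (key n m h).symm

lemma iUnion_shell : ⋃ n, shell d n = {0}ᶜ := by
  ext y
  simp only [Set.mem_iUnion, Set.mem_compl_iff, Set.mem_singleton_iff]
  constructor
  · rintro ⟨n, hn⟩ rfl
    have := norm_ge_of_mem_shell hn
    rw [norm_zero] at this
    exact absurd this (not_le.2 (by positivity))
  · intro hy
    have hpos : 0 < ‖y‖ := norm_pos_iff.2 hy
    have hex : ∃ n : ℕ, 1 / ((n : ℝ) + 1) ≤ ‖y‖ :=
      (exists_nat_one_div_lt hpos).imp fun n h => h.le
    classical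
    rcases h : Nat.find hex with _ | n
    · have := Nat.find_spec hex
      rw [h] at this
      exact ⟨0, mem_shell_zero.2 (by simpa using this)⟩
    · refine ⟨n + 1, mem_shell_succ.2 ⟨?_, ?_⟩⟩
      · have := Nat.find_spec hex
        rw [h] at this
        convert this using 2
        push_cast
        ring
      · exact not_le.1 (Nat.find_min hex (m := n) (by omega))

end Shells

/-! ### Lévy measures restricted to shells -/

section LevyMeasure

variable {d : ℕ} {ν : Measure (EuclideanSpace ℝ (Fin d))}

lemma IsLevyMeasure.integrable_min (hν : IsLevyMeasure ν) :
    Integrable (fun y : EuclideanSpace ℝ (Fin d) => min (‖y‖ ^ 2) 1) ν := by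
  refine ⟨by fun_prop, ?_⟩
  rw [hasFiniteIntegral_iff_ofReal (.of_forall fun y => by positivity)]
  exact hν.lintegral_lt_top

lemma IsLevyMeasure.measure_shell_lt_top (hν : IsLevyMeasure ν) (n : ℕ) : ν (shell d n) < ∞ := by
  have hc : (0 : ℝ) < (1 / ((n : ℝ) + 1)) ^ 2 := by positivity
  refine lt_of_le_of_lt (measure_mono fun y hy => ?_) (hν.integrable_min.measure_ge_lt_top hc)
  have h := norm_ge_of_mem_shell hy
  refine le_min (pow_le_pow_left₀ (by positivity) h 2) ?_
  refine pow_le_one₀ (by positivity) ?_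
  rw [div_le_one (by positivity)]
  linarith [(Nat.cast_nonneg n : (0 : ℝ) ≤ n)]

lemma IsLevyMeasure.restrict_iUnion_shell (hν : IsLevyMeasure ν) :
    ν.restrict (⋃ n, shell d n) = ν := by
  rw [iUnion_shell]
  refine Measure.restrict_eq_self_of_ae_mem ?_
  rw [ae_iff]
  simpa using hν.zero

lemma IsLevyMeasure.hasSum_setIntegral_shell (hν : IsLevyMeasure ν) {F : Type*}
    [NormedAddCommGroup F] [NormedSpace ℝ F] {f : EuclideanSpace ℝ (Fin d) → F}
    (hf : Integrable f ν) : HasSum (fun n => ∫ y in shell d n, f y ∂ν) (∫ y, f y ∂ν) := by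
  have := hasSum_integral_iUnion (μ := ν) (f := f) measurableSet_shell pairwise_disjoint_shell
    hf.integrableOn
  rwa [hν.restrict_iUnion_shell] at this

lemma IsLevyMeasure.memLp_shell (hν : IsLevyMeasure ν) {n : ℕ} (hn : n ≠ 0) :
    MemLp id 2 (ν.restrict (shell d n)) := by
  have : IsFiniteMeasure (ν.restrict (shell d n)) := ⟨by simpa using hν.measure_shell_lt_top n⟩
  refine MemLp.of_bound (by fun_prop) 1 ?_
  filter_upwards [ae_restrict_mem (measurableSet_shell n)] with y hy
  exact (norm_lt_one_of_mem_shell hn hy).le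

/-- This is the variance budget of the small jumps: on the shells with `n ≥ 1` the integrand `min
(‖y‖ ^ 2) 1` is `‖y‖ ^ 2`. -/
lemma IsLevyMeasure.summable_setIntegral_norm_sq (hν : IsLevyMeasure ν) :
    Summable fun n : ℕ => ∫ y in shell d (n + 1), ‖y‖ ^ 2 ∂ν := by
  have h := (summable_nat_add_iff 1).2 (hν.hasSum_setIntegral_shell hν.integrable_min).summable
  refine h.congr fun n => ?_
  refine setIntegral_congr_fun (measurableSet_shell _) fun y hy => ?_
  exact min_eq_left (pow_le_one₀ (norm_nonneg y)
    (norm_lt_one_of_mem_shell n.succ_ne_zero hy).le)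

end LevyMeasure

/-! ### The Lévy–Khintchine integrand -/

section LevyKhintchine

variable {d : ℕ} {ν : Measure (EuclideanSpace ℝ (Fin d))}

lemma norm_one_sub_exp_add_le (x : ℝ) :
    ‖1 - Complex.exp (Complex.I * x) + Complex.I * x‖ ≤ 3 * x ^ 2 := by
  rcases le_total |x| 1 with h | h
  · have := Complex.norm_exp_sub_one_sub_id_le (x := Complex.I * x) (by simpa using h)
    rw [← norm_neg]
    have e : -(1 - Complex.exp (Complex.I * x) + Complex.I * x)
        = Complex.exp (Complex.I * x) - 1 - Complex.I * x := by ring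
    rw [e]
    refine this.trans ?_
    simp only [norm_mul, Complex.norm_I, one_mul, Complex.norm_real, Real.norm_eq_abs, sq_abs]
    nlinarith [sq_nonneg x]
  · have h1 : ‖1 - Complex.exp (Complex.I * x)‖ ≤ ‖x‖ := by
      rw [norm_sub_rev]
      exact Real.norm_exp_I_mul_ofReal_sub_one_le
    refine (norm_add_le _ _).trans ?_
    simp only [norm_mul, Complex.norm_I, one_mul, Complex.norm_real]
    rw [Real.norm_eq_abs] at h1 ⊢
    rw [← sq_abs]
    nlinarith

lemma norm_one_sub_exp_le (x : ℝ) : ‖1 - Complex.exp (Complex.I * x)‖ ≤ 2 := by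
  refine (norm_sub_le _ _).trans ?_
  rw [mul_comm, Complex.norm_exp_ofReal_mul_I, norm_one]
  norm_num

lemma levyKhintchineIntegrand_of_one_le (ξ : EuclideanSpace ℝ (Fin d))
    {y : EuclideanSpace ℝ (Fin d)} (hy : 1 ≤ ‖y‖) :
    levyKhintchineIntegrand ξ y = 1 - Complex.exp (Complex.I * (⟪y, ξ⟫ : ℝ)) := by
  rw [levyKhintchineIntegrand, Set.indicator_of_notMem (by simp [hy])]
  simp

lemma levyKhintchineIntegrand_of_lt_one (ξ : EuclideanSpace ℝ (Fin d))
    {y : EuclideanSpace ℝ (Fin d)} (hy : ‖y‖ < 1) :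
    levyKhintchineIntegrand ξ y
      = 1 - Complex.exp (Complex.I * (⟪y, ξ⟫ : ℝ)) + Complex.I * (⟪y, ξ⟫ : ℝ) := by
  rw [levyKhintchineIntegrand, real_inner_comm]
  rcases eq_or_ne y 0 with rfl | h
  · simp
  · rw [Set.indicator_of_mem (show ‖y‖ ∈ Set.Ioo (0 : ℝ) 1 from ⟨norm_pos_iff.2 h, hy⟩), mul_one]

/-- Taylor expansion handles the compensated small jumps and boundedness the large ones. The bound
yields absolute convergence and, being locally uniform in `ξ`, continuity of the exponent. -/
lemma norm_levyKhintchineIntegrand_le (ξ y : EuclideanSpace ℝ (Fin d)) :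
    ‖levyKhintchineIntegrand ξ y‖ ≤ (2 + 3 * ‖ξ‖ ^ 2) * min (‖y‖ ^ 2) 1 := by
  rcases le_or_gt 1 ‖y‖ with h | h
  · rw [levyKhintchineIntegrand_of_one_le ξ h, min_eq_right (one_le_pow₀ h)]
    refine (norm_one_sub_exp_le _).trans ?_
    nlinarith [sq_nonneg ‖ξ‖]
  · rw [levyKhintchineIntegrand_of_lt_one ξ h, min_eq_left (pow_le_one₀ (norm_nonneg y) h.le)]
    refine (norm_one_sub_exp_add_le _).trans ?_
    have h1 : ⟪y, ξ⟫ ^ 2 ≤ (‖y‖ * ‖ξ‖) ^ 2 := by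
      rw [← sq_abs]
      gcongr
      exact abs_real_inner_le_norm y ξ
    nlinarith [sq_nonneg ‖y‖]

lemma measurable_levyKhintchineIntegrand (ξ : EuclideanSpace ℝ (Fin d)) :
    Measurable (levyKhintchineIntegrand ξ) := by
  have : Measurable fun y : EuclideanSpace ℝ (Fin d) =>
      (Set.Ioo (0 : ℝ) 1).indicator (fun _ => (1 : ℂ)) ‖y‖ :=
    (measurable_const.indicator measurableSet_Ioo).comp measurable_norm
  unfold levyKhintchineIntegrand
  fun_prop

lemma IsLevyMeasure.integrable_integrand (hν : IsLevyMeasure ν)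
    (ξ : EuclideanSpace ℝ (Fin d)) : Integrable (levyKhintchineIntegrand ξ) ν :=
  (hν.integrable_min.const_mul _).mono' (measurable_levyKhintchineIntegrand ξ).aestronglyMeasurable
    (.of_forall (norm_levyKhintchineIntegrand_le ξ))

lemma IsLevyMeasure.continuous_exponent (hν : IsLevyMeasure ν) (l : EuclideanSpace ℝ (Fin d))
    (Q : Matrix (Fin d) (Fin d) ℝ) : Continuous (levyKhintchineExponent l Q ν) := by
  have h : Continuous fun ξ => ∫ y, levyKhintchineIntegrand ξ y ∂ν := by
    rw [continuous_iff_continuousAt]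
    intro ξ₀
    refine continuousAt_of_dominated
      (.of_forall fun ξ => (measurable_levyKhintchineIntegrand ξ).aestronglyMeasurable)
      (bound := fun y => (2 + 3 * (‖ξ₀‖ + 1) ^ 2) * min (‖y‖ ^ 2) 1) ?_
      (hν.integrable_min.const_mul _) (.of_forall fun y => ?_)
    · have : ∀ᶠ ξ : EuclideanSpace ℝ (Fin d) in 𝓝 ξ₀, ‖ξ‖ < ‖ξ₀‖ + 1 :=
        (continuous_norm.tendsto ξ₀).eventually (eventually_lt_nhds (lt_add_one _))
      filter_upwards [this] with ξ hξ
      refine .of_forall fun y => (norm_levyKhintchineIntegrand_le ξ y).trans ?_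
      gcongr
    · unfold levyKhintchineIntegrand
      fun_prop
  unfold levyKhintchineExponent
  fun_prop

/-- The compensator of the jumps in the `n`-th shell; large jumps are not compensated. -/
noncomputable def compensator (ν : Measure (EuclideanSpace ℝ (Fin d))) (n : ℕ) :
    EuclideanSpace ℝ (Fin d) :=
  if n = 0 then 0 else ∫ y in shell d n, y ∂ν

lemma integrable_one_sub_exp (ρ : Measure (EuclideanSpace ℝ (Fin d))) [IsFiniteMeasure ρ]
    (ξ : EuclideanSpace ℝ (Fin d)) :
    Integrable (fun y => 1 - Complex.exp (Complex.I * (⟪y, ξ⟫ : ℝ))) ρ :=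
  Integrable.of_bound (by fun_prop) 2 (.of_forall fun _ => norm_one_sub_exp_le _)

/-- On shell `0` the indicator term vanishes and on every other shell it is present throughout, so
the integrand splits into a compound Poisson exponent and the exponent of the compensating drift. -/
lemma IsLevyMeasure.setIntegral_integrand (hν : IsLevyMeasure ν) (n : ℕ)
    (ξ : EuclideanSpace ℝ (Fin d)) :
    ∫ y in shell d n, levyKhintchineIntegrand ξ y ∂ν
      = ∫ y in shell d n, (1 - Complex.exp (Complex.I * (⟪y, ξ⟫ : ℝ))) ∂ν
        + Complex.I * (⟪compensator ν n, ξ⟫ : ℝ) := by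
  have : IsFiniteMeasure (ν.restrict (shell d n)) := ⟨by simpa using hν.measure_shell_lt_top n⟩
  rcases eq_or_ne n 0 with rfl | hn
  · simp only [compensator, if_true, inner_zero_left, Complex.ofReal_zero, mul_zero, add_zero]
    exact setIntegral_congr_fun (measurableSet_shell 0) fun y hy =>
      levyKhintchineIntegrand_of_one_le ξ hy
  · have hL := hν.memLp_shell hn
    have hi : Integrable (fun y : EuclideanSpace ℝ (Fin d) => y) (ν.restrict (shell d n)) :=
      hL.integrable one_le_two
    have h2 : Integrable (fun y : EuclideanSpace ℝ (Fin d) => ⟪y, ξ⟫) (ν.restrict (shell d n)) :=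
      hi.inner_const ξ
    rw [setIntegral_congr_fun (measurableSet_shell n) (g := fun y =>
      1 - Complex.exp (Complex.I * (⟪y, ξ⟫ : ℝ)) + Complex.I * (⟪y, ξ⟫ : ℝ)) fun y hy =>
      levyKhintchineIntegrand_of_lt_one ξ (norm_lt_one_of_mem_shell hn hy)]
    have h3 : Integrable (fun y : EuclideanSpace ℝ (Fin d) => Complex.I * ((⟪y, ξ⟫ : ℝ) : ℂ))
        (ν.restrict (shell d n)) := h2.ofReal.const_mul _
    rw [integral_add (integrable_one_sub_exp _ ξ) h3, integral_const_mul,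
      integral_complex_ofReal, compensator, if_neg hn]
    congr 3
    simp only [real_inner_comm ξ]
    rw [integral_inner hi]

end LevyKhintchine


/-! ### Compound Poisson processes with a given finite jump measure -/

section CompoundModel

variable {d : ℕ} {Ω : Type*} [MeasurableSpace Ω]

/-- A compound Poisson process with jump measure `ρ`, together with its basic path and moment
properties. -/
structure IsCompoundModel (C : ℝ≥0 → Ω → EuclideanSpace ℝ (Fin d))
    (ρ : Measure (EuclideanSpace ℝ (Fin d))) (P : Measure Ω) : Prop where
  isCompound : IsCompoundPoissonOf C ρ P
  incr : HasLevyIncrements C P fun ξ => ∫ y, (1 - Complex.exp (Complex.I * (⟪y, ξ⟫ : ℝ))) ∂ρ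
  cadlag : ∀ᵐ ω ∂P, IsCadlag fun t => C t ω
  zero : ∀ᵐ ω ∂P, C 0 ω = 0
  memLp : MemLp id 2 ρ → ∀ t, MemLp (C t) 2 P
  integral_eq : MemLp id 2 ρ → ∀ t, ∫ ω, C t ω ∂P = (t : ℝ) • ∫ y, y ∂ρ
  integral_sq : MemLp id 2 ρ → ∀ t : ℝ≥0,
    ∫ ω, ‖C t ω - (t : ℝ) • ∫ y, y ∂ρ‖ ^ 2 ∂P = t * ∫ y, ‖y‖ ^ 2 ∂ρ

lemma isCadlag_const (x : EuclideanSpace ℝ (Fin d)) : IsCadlag fun _ => x :=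
  ⟨fun _ => continuousWithinAt_const, fun _ _ => ⟨x, tendsto_const_nhds⟩⟩

lemma isCompoundModel_zero (P : Measure Ω) [IsProbabilityMeasure P] :
    IsCompoundModel (fun _ _ => (0 : EuclideanSpace ℝ (Fin d))) 0 P where
  isCompound := ⟨by simp, .inl ⟨rfl, fun _ _ => rfl⟩⟩
  incr := by simpa using hasLevyIncrements_drift (0 : EuclideanSpace ℝ (Fin d)) (P := P)
  cadlag := .of_forall fun _ => isCadlag_const 0
  zero := .of_forall fun _ => rfl
  memLp _ _ := MemLp.zero
  integral_eq _ _ := by simp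
  integral_sq _ _ := by simp

lemma isCompoundModel_compoundPath {P : Measure Ω} [IsProbabilityMeasure P]
    {ρ : Measure (EuclideanSpace ℝ (Fin d))} [IsFiniteMeasure ρ] (hρ : ρ ≠ 0)
    {Z : Ω → (ℕ → ℝ) × (ℕ → EuclideanSpace ℝ (Fin d))}
    [IsProbabilityMeasure ((ρ Set.univ)⁻¹ • ρ)]
    (hZ : MeasurePreserving Z P (markedLaw (ρ Set.univ).toReal ((ρ Set.univ)⁻¹ • ρ))) :
    IsCompoundModel (fun t ω => compoundPath t (Z ω)) ρ P := by
  set r := (ρ Set.univ).toReal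
  set μ := (ρ Set.univ)⁻¹ • ρ
  have h0 : ρ Set.univ ≠ 0 := by simpa using hρ
  have hr : 0 < r := ENNReal.toReal_pos h0 (measure_ne_top _ _)
  have := isProbabilityMeasure_expMeasure hr
  have hscale {F : Type _} [NormedAddCommGroup F] [NormedSpace ℝ F]
      (f : EuclideanSpace ℝ (Fin d) → F) : r • ∫ y, f y ∂μ = ∫ y, f y ∂ρ := by
    rw [integral_smul_measure, smul_smul, ENNReal.toReal_inv, mul_inv_cancel₀ hr.ne', one_smul]
  have hgood : ∀ᵐ ω ∂P, IsGoodWaiting (Z ω).1 :=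
    (measurePreserving_fst.comp hZ).quasiMeasurePreserving.ae (ae_isGoodWaiting hr)
  have hL (h : MemLp id 2 ρ) : MemLp id 2 μ := h.smul_measure (ENNReal.inv_ne_top.2 h0)
  have hm (t : ℝ≥0) := measurable_compoundPath (E := EuclideanSpace ℝ (Fin d)) t
  have hmean (t : ℝ≥0) : (r * t : ℝ) • ∫ y, y ∂μ = (t : ℝ) • ∫ y, y ∂ρ := by
    rw [mul_comm, mul_smul, hscale]
  refine ⟨⟨measure_lt_top _ _, .inr ⟨hρ, isCompoundPoisson_compoundPath hr hZ⟩⟩, ?_, ?_, ?_,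
    fun h t => ?_, fun h t => ?_, fun h t => ?_⟩
  · have h := (hasLevyIncrements_compoundPath (μ := μ) hr).comp_measurePreserving hZ
    refine Eq.mp ?_ h
    congr 1
    ext ξ
    rw [← hscale, integral_sub (integrable_const _), charFun_apply]
    · simp [Complex.real_smul, mul_comm Complex.I]
    · exact Integrable.of_bound (by fun_prop) 1 (.of_forall fun y => by
        rw [mul_comm, Complex.norm_exp_ofReal_mul_I])
  · filter_upwards [hgood] with ω hω using isCadlag_compoundPath hω
  · filter_upwards [hgood] with ω hω using compoundPath_zero hω
  · exact (memLp_compoundPath hr (hL h) t).comp_measurePreserving hZ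
  · rw [← hmean, ← integral_compoundPath hr (hL h) t, ← hZ.map_eq,
      integral_map hZ.measurable.aemeasurable (by fun_prop)]
  · have := integral_norm_compoundPath_sub_sq hr (hL h) t
    rw [hmean, ← hZ.map_eq, integral_map hZ.measurable.aemeasurable (by fun_prop)] at this
    rw [this, mul_comm r, mul_assoc, ← smul_eq_mul r, hscale]

/-- The process is a fixed functional of a random element `Z` of law `R`, so it can be transplanted
to any space carrying such a `Z`. For `ρ = 0` a Dirac mass on the same sample space serves, so that
all shells share one type. -/
lemma exists_isCompoundModel (ρ : Measure (EuclideanSpace ℝ (Fin d))) [IsFiniteMeasure ρ] :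
    ∃ (R : Measure ((ℕ → ℝ) × (ℕ → EuclideanSpace ℝ (Fin d)))) (_ : IsProbabilityMeasure R)
      (C : ℝ≥0 → (ℕ → ℝ) × (ℕ → EuclideanSpace ℝ (Fin d)) → EuclideanSpace ℝ (Fin d)),
      (∀ t, Measurable (C t)) ∧
      ∀ {Ω : Type} [MeasurableSpace Ω] (P : Measure Ω) [IsProbabilityMeasure P]
        (Z : Ω → (ℕ → ℝ) × (ℕ → EuclideanSpace ℝ (Fin d))), MeasurePreserving Z P R →
        IsCompoundModel (fun t ω => C t (Z ω)) ρ P := by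
  rcases eq_or_ne ρ 0 with rfl | hρ
  · exact ⟨Measure.dirac 0, inferInstance, fun _ _ => 0, fun _ => measurable_const,
      fun P _ _ _ => isCompoundModel_zero P⟩
  · have h0 : ρ Set.univ ≠ 0 := by simpa using hρ
    have : IsProbabilityMeasure ((ρ Set.univ)⁻¹ • ρ) :=
      ⟨by simpa using ENNReal.inv_mul_cancel h0 (measure_ne_top _ _)⟩
    have := isProbabilityMeasure_expMeasure (ENNReal.toReal_pos h0 (measure_ne_top ρ Set.univ))
    exact ⟨markedLaw (ρ Set.univ).toReal ((ρ Set.univ)⁻¹ • ρ), inferInstance,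
      fun t => compoundPath t, measurable_compoundPath,
      fun P _ Z hZ => isCompoundModel_compoundPath hρ hZ⟩

end CompoundModel

/-! ### Joint independent realisation -/

section Family

variable {d : ℕ}

lemma IsWienerProcess.comp_measurePreserving {Ω S : Type*} [MeasurableSpace Ω]
    [MeasurableSpace S] {P : Measure Ω} [IsProbabilityMeasure P] {R : Measure S}
    {W : ℝ≥0 → S → EuclideanSpace ℝ (Fin d)} (hW : IsWienerProcess W R) {Z : Ω → S}
    (hZ : MeasurePreserving Z P R) : IsWienerProcess (fun t ω => W t (Z ω)) P where
  measurable t := (hW.measurable t).comp hZ.measurable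
  brownian i := ⟨IsPreBrownianReal.comp_measurePreserving (hW.brownian i).toIsPreBrownianReal hZ,
    hZ.quasiMeasurePreserving.ae (hW.brownian i).cont⟩
  indep := by
    have hR : IsProbabilityMeasure R := hZ.map_eq ▸ Measure.isProbabilityMeasure_map hZ.aemeasurable
    have hm (i : Fin d) : Measurable fun (ω : S) (t : ℝ≥0) => W t ω i :=
      measurable_pi_lambda _ fun t => by
        have := hW.measurable t
        fun_prop
    have h := hW.indep
    rw [iIndepFun_iff_map_fun_eq_infinitePi_map hm] at h
    have hm' (i : Fin d) : Measurable fun (ω : Ω) (t : ℝ≥0) => W t (Z ω) i :=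
      (hm i).comp hZ.measurable
    rw [iIndepFun_iff_map_fun_eq_infinitePi_map hm']
    rw [← hZ.map_eq, Measure.map_map (measurable_pi_lambda _ hm) hZ.measurable] at h
    refine h.trans ?_
    congr 1
    ext1 i
    rw [Measure.map_map (hm i) hZ.measurable]
    rfl

/-- A Wiener process and a sequence of compound Poisson processes with prescribed jump measures
that are jointly independent. -/
lemma exists_independent_processes {Q : Matrix (Fin d) (Fin d) ℝ} (hQ : Q.PosSemidef)
    (ρ : ℕ → Measure (EuclideanSpace ℝ (Fin d))) [∀ n, IsFiniteMeasure (ρ n)] :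
    ∃ (Ω : Type) (_ : MeasurableSpace Ω) (P : Measure Ω) (_ : IsProbabilityMeasure P)
      (W : ℝ≥0 → Ω → EuclideanSpace ℝ (Fin d)) (C : ℕ → ℝ≥0 → Ω → EuclideanSpace ℝ (Fin d)),
      IsWienerProcess W P ∧ (∀ ω, Continuous fun t => W t ω) ∧
      HasLevyIncrements (fun t ω => Matrix.toEuclideanCLM (𝕜 := ℝ) (CFC.sqrt Q) (W t ω)) P
        (fun ξ => 1 / 2 * (⟪ξ, Matrix.toEuclideanCLM (𝕜 := ℝ) Q ξ⟫ : ℂ)) ∧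
      (∀ n, IsCompoundModel (C n) (ρ n) P) ∧
      iIndepFun (fun (j : Option ℕ) (ω : Ω) (t : ℝ≥0) => j.elim W C t ω) P := by
  obtain ⟨ΩW, mW, PW, hPW, W, hW, hWc, hWi⟩ := exists_wiener hQ
  choose R hR C hCm hC using fun n => exists_isCompoundModel (ρ n)
  -- Every index gets the same sample type: `none` uses only the Wiener half and `some n` only the
  -- compound Poisson half. The value `getD 0` merely pads the unused half at `none`.
  let S := ΩW × ((ℕ → ℝ) × (ℕ → EuclideanSpace ℝ (Fin d)))
  let M : Option ℕ → Measure S := fun j => PW.prod (R (j.getD 0))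
  let P : Measure (Option ℕ → S) := Measure.infinitePi M
  have hev (j : Option ℕ) : MeasurePreserving (fun ω : Option ℕ → S => ω j) P (M j) :=
    measurePreserving_eval_infinitePi M j
  have hZW : MeasurePreserving (fun ω : Option ℕ → S => (ω none).1) P PW :=
    measurePreserving_fst.comp (hev none)
  have hZC (n : ℕ) : MeasurePreserving (fun ω : Option ℕ → S => (ω (some n)).2) P (R n) :=
    measurePreserving_snd.comp (hev (some n))
  refine ⟨Option ℕ → S, inferInstance, P, inferInstance, fun t ω => W t (ω none).1,
    fun n t ω => C n t (ω (some n)).2, hW.comp_measurePreserving hZW, fun ω => hWc _,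
    hWi.comp_measurePreserving hZW, fun n => hC n P _ (hZC n), ?_⟩
  have h := iIndepFun_infinitePi (P := M)
    (X := fun (j : Option ℕ) (z : S) (t : ℝ≥0) => j.elim (W t z.1) fun n => C n t z.2) fun j => by
      refine measurable_pi_lambda _ fun t => ?_
      rcases j with _ | n
      · exact (hW.measurable t).comp measurable_fst
      · exact (hCm n t).comp measurable_snd
  refine Eq.mp ?_ h
  congr 1
  ext j ω t
  rcases j with _ | n <;> rfl

end Family


/-! ### Uniform limits of càdlàg functions -/

section Cadlag

variable {d : ℕ} {f g : ℝ≥0 → EuclideanSpace ℝ (Fin d)}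

lemma IsCadlag.add (hf : IsCadlag f) (hg : IsCadlag g) : IsCadlag fun t => f t + g t :=
  ⟨fun t => (hf.1 t).add (hg.1 t), fun t ht =>
    let ⟨_, hx⟩ := hf.2 t ht
    let ⟨_, hy⟩ := hg.2 t ht
    ⟨_, hx.add hy⟩⟩

lemma isCadlag_of_continuous (hf : Continuous f) : IsCadlag f :=
  ⟨fun _ => hf.continuousWithinAt, fun t _ => ⟨f t, (hf.tendsto t).mono_left nhdsWithin_le_nhds⟩⟩

lemma IsCadlag.sum {ι : Type*} {F : ι → ℝ≥0 → EuclideanSpace ℝ (Fin d)} {s : Finset ι}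
    (h : ∀ i ∈ s, IsCadlag (F i)) : IsCadlag fun t => ∑ i ∈ s, F i t := by
  classical
  induction s using Finset.induction_on with
  | empty => simpa using isCadlag_const 0
  | insert i s hi ih =>
    simp only [Finset.sum_insert hi]
    exact (h i (by simp)).add (ih fun j hj => h j (by simp [hj]))

/-- A sequence of càdlàg functions with geometrically small differences on growing intervals
converges to a càdlàg function. -/
lemma exists_isCadlag_limit {F : ℕ → ℝ≥0 → EuclideanSpace ℝ (Fin d)} (hF : ∀ j, IsCadlag (F j))
    {K : ℝ} (hK : ∀ (j : ℕ) (t : ℝ≥0), t ≤ j → dist (F j t) (F (j + 1) t) ≤ K * (1 / 2) ^ j) :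
    ∃ f, IsCadlag f ∧ ∀ t, Tendsto (fun j => F j t) atTop (𝓝 (f t)) := by
  have hgeo {a : ℕ → EuclideanSpace ℝ (Fin d)} {N : ℕ}
      (h : ∀ j, N ≤ j → dist (a j) (a (j + 1)) ≤ K * (1 / 2) ^ j) :
      ∃ x, Tendsto a atTop (𝓝 x) ∧ dist (a N) x ≤ 2 * K * (1 / 2) ^ N := by
    have h' (n : ℕ) : dist (a (N + n)) (a (N + (n + 1))) ≤ K * (1 / 2) ^ N * (1 / 2) ^ n := by
      refine (h (N + n) (by omega)).trans_eq ?_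
      rw [pow_add]
      ring
    obtain ⟨x, hx⟩ := cauchySeq_tendsto_of_complete
      (cauchySeq_of_le_geometric (1 / 2) _ (by norm_num) h')
    refine ⟨x, (tendsto_add_atTop_iff_nat N).1 (by simpa only [add_comm] using hx), ?_⟩
    have := dist_le_of_le_geometric_of_tendsto₀ (f := fun n => a (N + n)) (1 / 2) _ (by norm_num)
      h' hx
    refine this.trans_eq ?_
    ring
  have hex (t : ℝ≥0) : ∃ x, Tendsto (fun j => F j t) atTop (𝓝 x) := by
    obtain ⟨N, hN⟩ := exists_nat_ge t
    obtain ⟨x, hx, -⟩ := hgeo (a := fun j => F j t) (N := N) fun j hj =>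
      hK j t (hN.trans (by exact_mod_cast hj))
    exact ⟨x, hx⟩
  choose f hf using hex
  have hdist {t : ℝ≥0} {n : ℕ} (ht : t ≤ n) : dist (F n t) (f t) ≤ 2 * K * (1 / 2) ^ n := by
    obtain ⟨x, hx, h⟩ := hgeo (a := fun j => F j t) (N := n) fun j hj =>
      hK j t (ht.trans (by exact_mod_cast hj))
    rwa [tendsto_nhds_unique (hf t) hx]
  have hunif (t : ℝ≥0) : TendstoUniformlyOnFilter F f atTop (𝓝 t) := by
    have hlim : Tendsto (fun n : ℕ => 2 * K * (1 / 2) ^ n) atTop (𝓝 0) := by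
      simpa using (tendsto_pow_atTop_nhds_zero_of_lt_one (r := (1 / 2 : ℝ))
        (by norm_num) (by norm_num)).const_mul (2 * K)
    obtain ⟨N, hN⟩ := exists_nat_ge (t + 1)
    rw [Metric.tendstoUniformlyOnFilter_iff]
    intro ε hε
    have h1 := (hlim.eventually_lt_const hε).and (eventually_ge_atTop N)
    have h2 : ∀ᶠ u in 𝓝 t, u < t + 1 := eventually_lt_nhds (lt_add_of_pos_right t one_pos)
    refine (h1.prod_mk h2).mono ?_
    rintro ⟨n, u⟩ ⟨⟨h3, h4⟩, h5⟩
    rw [dist_comm]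
    exact (hdist (h5.le.trans (hN.trans (by exact_mod_cast h4)))).trans_lt h3
  refine ⟨f, ⟨fun t => ?_, fun t ht => ?_⟩, hf⟩
  · exact ((hunif t).mono_right nhdsWithin_le_nhds).tendsto_of_eventually_tendsto
      (.of_forall fun n => (hF n).1 t) (hf t)
  · have : (𝓝[<] t).NeBot := nhdsLT_neBot_of_exists_lt ⟨0, ht⟩
    -- The bound on consecutive differences passes to the left limits, which are therefore Cauchy;
    -- locally uniform convergence then exchanges the two limits.
    choose L hL using fun n => (hF n).2 t ht
    obtain ⟨N, hN⟩ := exists_nat_ge t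
    obtain ⟨x, hx, -⟩ := hgeo (a := L) (N := N) fun j hj =>
      le_of_tendsto ((hL j).dist (hL (j + 1))) <| by
        filter_upwards [self_mem_nhdsWithin] with u hu
        exact hK j u (le_of_lt (lt_of_lt_of_le hu (hN.trans (by exact_mod_cast hj))))
    exact ⟨x, ((hunif t).mono_right nhdsWithin_le_nhds).tendsto_of_eventually_tendsto
      (.of_forall hL) hx⟩

end Cadlag

/-! ### Càdlàg limits of processes that are Cauchy in `E sup ‖·‖²` -/

section Limit

variable {d : ℕ} {Ω : Type*} [MeasurableSpace Ω] {P : Measure Ω}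
  {S : ℕ → ℝ≥0 → Ω → EuclideanSpace ℝ (Fin d)} {r : ℕ → ℝ}

/-- Processes that form a Cauchy sequence with respect to `E sup ‖·‖²` on compact time intervals
have a càdlàg limit along a subsequence. -/
lemma exists_cadlag_limit_process (hm : ∀ m t, Measurable (S m t))
    (hc : ∀ m, ∀ᵐ ω ∂P, IsCadlag fun t => S m t ω) (hr : Tendsto r atTop (𝓝 0))
    (hS : ∀ m n, m ≤ n → ∀ T : ℝ≥0, ∃ g : Ω → ℝ≥0∞, Measurable g ∧
      (∀ᵐ ω ∂P, ∀ t ≤ T, ‖S n t ω - S m t ω‖ₑ ^ 2 ≤ g ω) ∧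
      ∫⁻ ω, g ω ∂P ≤ ENNReal.ofReal (T * r m)) :
    ∃ (X : ℝ≥0 → Ω → EuclideanSpace ℝ (Fin d)) (φ : ℕ → ℕ), StrictMono φ ∧
      (∀ t, Measurable (X t)) ∧ (∀ ω, IsCadlag fun t => X t ω) ∧
      (∀ᵐ ω ∂P, ∀ t, Tendsto (fun j => S (φ j) t ω) atTop (𝓝 (X t ω))) ∧
      ∀ T : ℝ≥0, Tendsto (fun m => ∫⁻ ω, ⨆ t : Set.Iic T, ‖X t ω - S m t ω‖ₑ ^ 2 ∂P)
        atTop (𝓝 0) := by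
  classical
  -- The rate `8 ^ (-j)` against the weights `4 ^ j` leaves a summable `2 ^ (-j)`, and a finite
  -- weighted sum forces path differences of order `2 ^ (-j)`. The horizon `j` grows along the
  -- subsequence and exhausts all times.
  obtain ⟨φ, hφ, hφr⟩ : ∃ φ : ℕ → ℕ, StrictMono φ ∧ ∀ j : ℕ, j * r (φ j) < (1 / 8) ^ j := by
    refine extraction_forall_of_eventually (P := fun j n => (j : ℝ) * r n < (1 / 8) ^ j)
      fun j => ?_
    have : Tendsto (fun m => (j : ℝ) * r m) atTop (𝓝 0) := by simpa using hr.const_mul (j : ℝ)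
    exact this.eventually_lt_const (by positivity)
  choose g hgm hg hgi using fun j : ℕ =>
    hS (φ j) (φ (j + 1)) (hφ.monotone (Nat.le_succ j)) (j : ℝ≥0)
  have hsum : ∫⁻ ω, ∑' j : ℕ, ENNReal.ofReal (4 ^ j) * g j ω ∂P < ∞ := by
    rw [lintegral_tsum fun j => ((hgm j).const_mul _).aemeasurable]
    have hle (j : ℕ) : ∫⁻ ω, ENNReal.ofReal (4 ^ j) * g j ω ∂P
        ≤ ENNReal.ofReal ((1 / 2) ^ j) := by
      rw [lintegral_const_mul _ (hgm j)]
      refine (mul_le_mul_right ((hgi j).trans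
        (ENNReal.ofReal_le_ofReal (by simpa using (hφr j).le))) _).trans_eq ?_
      rw [← ENNReal.ofReal_mul (by positivity), ← inv_pow, ← mul_pow]
      norm_num
    refine (ENNReal.tsum_le_tsum hle).trans_lt ?_
    rw [← ENNReal.ofReal_tsum_of_nonneg (fun n => by positivity)
      (summable_geometric_of_lt_one (by norm_num) (by norm_num))]
    exact ENNReal.ofReal_lt_top
  have hgood : ∀ᵐ ω ∂P, (∀ j, IsCadlag fun t => S (φ j) t ω) ∧ ∃ K : ℝ, ∀ (j : ℕ) (t : ℝ≥0),
      t ≤ j → dist (S (φ j) t ω) (S (φ (j + 1)) t ω) ≤ K * (1 / 2) ^ j := by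
    have h1 := ae_lt_top (Measurable.tsum fun j => (hgm j).const_mul (ENNReal.ofReal (4 ^ j)))
      hsum.ne
    filter_upwards [ae_all_iff.2 fun j => hc (φ j), ae_all_iff.2 hg, h1] with ω hω1 hω2 hω3
    refine ⟨hω1, (∑' j : ℕ, ENNReal.ofReal (4 ^ j) * g j ω).toReal + 1, fun j t ht => ?_⟩
    set A := (∑' j : ℕ, ENNReal.ofReal (4 ^ j) * g j ω).toReal
    have hA : 0 ≤ A := ENNReal.toReal_nonneg
    have h4 : ENNReal.ofReal (4 ^ j) * ‖S (φ (j + 1)) t ω - S (φ j) t ω‖ₑ ^ 2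
        ≤ ∑' j : ℕ, ENNReal.ofReal (4 ^ j) * g j ω :=
      (mul_le_mul_right (hω2 j t ht) _).trans (ENNReal.le_tsum j)
    rw [← ofReal_norm, ← ENNReal.ofReal_pow (norm_nonneg _), ← ENNReal.ofReal_mul (by positivity),
      ENNReal.ofReal_le_iff_le_toReal hω3.ne, ← dist_eq_norm, dist_comm] at h4
    set D := dist (S (φ j) t ω) (S (φ (j + 1)) t ω)
    have h5 : (2 : ℝ) ^ j * D ≤ A + 1 := by
      have e : (4 : ℝ) ^ j * D ^ 2 = (2 ^ j * D) ^ 2 := by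
        rw [mul_pow, ← pow_mul, mul_comm j 2, pow_mul]
        norm_num
      rw [e] at h4
      nlinarith
    have h6 : (2 : ℝ) ^ j * (1 / 2) ^ j = 1 := by rw [← mul_pow]; norm_num
    calc D = 2 ^ j * D * (1 / 2) ^ j := by linear_combination -D * h6
      _ ≤ (A + 1) * (1 / 2) ^ j := by gcongr
  -- A measurable null hull of the bad set; setting paths to zero there keeps `X` measurable and
  -- makes every path càdlàg.
  set N := toMeasurable P {ω | ¬ ((∀ j, IsCadlag fun t => S (φ j) t ω) ∧
    ∃ K : ℝ, ∀ (j : ℕ) (t : ℝ≥0), t ≤ j →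
      dist (S (φ j) t ω) (S (φ (j + 1)) t ω) ≤ K * (1 / 2) ^ j)}
  have hN : MeasurableSet N := measurableSet_toMeasurable _ _
  have hN0 : ∀ᵐ ω ∂P, ω ∈ Nᶜ := by
    rw [ae_iff]
    simpa [N, measure_toMeasurable] using ae_iff.1 hgood
  have hex (ω : Ω) : ∃ f : ℝ≥0 → EuclideanSpace ℝ (Fin d), IsCadlag f ∧
      ∀ t, Tendsto (fun j => Nᶜ.indicator (S (φ j) t) ω) atTop (𝓝 (f t)) := by
    by_cases hω : ω ∈ Nᶜ
    · have h := not_not.1 fun h => hω (subset_toMeasurable P _ h)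
      obtain ⟨h1, K, h2⟩ := h
      simpa only [Set.indicator_of_mem hω] using exists_isCadlag_limit h1 h2
    · exact ⟨fun _ => 0, isCadlag_const 0, fun t => by simp [Set.indicator_of_notMem hω]⟩
  choose X hX hXt using hex
  have hlim : ∀ᵐ ω ∂P, ∀ t, Tendsto (fun j => S (φ j) t ω) atTop (𝓝 (X ω t)) := by
    filter_upwards [hN0] with ω hω t
    simpa only [Set.indicator_of_mem hω] using hXt ω t
  refine ⟨fun t ω => X ω t, φ, hφ, fun t => ?_, hX, hlim, fun T => ?_⟩
  · exact measurable_of_tendsto_metrizable (fun j => (hm (φ j) t).indicator hN.compl)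
      (tendsto_pi_nhds.2 fun ω => hXt ω t)
  · refine tendsto_of_tendsto_of_tendsto_of_le_of_le tendsto_const_nhds
      (h := fun m => ENNReal.ofReal (T * r m)) ?_ (fun _ => bot_le) fun m => ?_
    · have : Tendsto (fun m => (T : ℝ) * r m) atTop (𝓝 0) := by simpa using hr.const_mul (T : ℝ)
      simpa using ENNReal.tendsto_ofReal this
    -- For the full sequence, compare `S m` with the later members `S (φ (m + j))` and let `j → ∞`
    -- by Fatou; the index is at least `m`, so the bound `r m` is uniform in `j`.
    · choose q hqm hq hqi using fun j : ℕ => hS m (φ (m + j))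
        ((Nat.le_add_right m j).trans (hφ.id_le _)) T
      calc ∫⁻ ω, ⨆ t : Set.Iic T, ‖X ω t - S m t ω‖ₑ ^ 2 ∂P
          ≤ ∫⁻ ω, liminf (fun j => q j ω) atTop ∂P := by
            refine lintegral_mono_ae ?_
            filter_upwards [hlim, ae_all_iff.2 hq] with ω h1 h2
            refine iSup_le fun t => ?_
            have h3 : Tendsto (fun j => ‖S (φ (m + j)) t ω - S m t ω‖ₑ ^ 2) atTop
                (𝓝 (‖X ω t - S m t ω‖ₑ ^ 2)) := by
              have h4 : Tendsto (fun j => S (φ (m + j)) t ω) atTop (𝓝 (X ω t)) := by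
                have := (tendsto_add_atTop_iff_nat m).2 (h1 t)
                simpa only [add_comm] using this
              exact ((ENNReal.continuous_pow 2).tendsto _).comp (h4.sub_const _).enorm
            rw [← h3.liminf_eq]
            exact liminf_le_liminf (.of_forall fun j => h2 j t t.2)
        _ ≤ liminf (fun j => ∫⁻ ω, q j ω ∂P) atTop := lintegral_liminf_le hqm
        _ ≤ ENNReal.ofReal (T * r m) := by
            refine liminf_le_of_le ?_ fun b hb => ?_
            · isBoundedDefault
            · obtain ⟨j, hj⟩ := hb.exists
              exact hj.trans (hqi j)

end Limit


/-! ### Pythagoras for independent centred variables, and adding a drift -/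

lemma integral_norm_sum_sq {ι E Ω : Type*} [NormedAddCommGroup E] [InnerProductSpace ℝ E]
    [MeasurableSpace E] [BorelSpace E] [SecondCountableTopology E] [CompleteSpace E]
    [MeasurableSpace Ω] {P : Measure Ω} {Z : ι → Ω → E} (hm : ∀ j, Measurable (Z j))
    (hind : iIndepFun Z P) {s : Finset ι} (hL : ∀ j ∈ s, MemLp (Z j) 2 P)
    (h0 : ∀ j ∈ s, ∫ ω, Z j ω ∂P = 0) :
    ∫ ω, ‖∑ j ∈ s, Z j ω‖ ^ 2 ∂P = ∑ j ∈ s, ∫ ω, ‖Z j ω‖ ^ 2 ∂P := by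
  classical
  have := hind.isProbabilityMeasure
  induction s using Finset.induction_on with
  | empty => simp
  | insert j s hj ih =>
    have hLj := hL j (by simp)
    have hLs : MemLp (fun ω => ∑ i ∈ s, Z i ω) 2 P :=
      memLp_finsetSum s fun i hi => hL i (by simp [hi])
    have hI : IndepFun (fun ω => ∑ i ∈ s, Z i ω) (Z j) P := by
      refine (hind.indepFun_finsetSum_of_notMem hm hj).congr (.of_forall fun ω => ?_)
        (.of_forall fun ω => rfl)
      simp
    have hcross : ∫ ω, ⟪∑ i ∈ s, Z i ω, Z j ω⟫ ∂P = 0 := by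
      have := hI.integral_bilin (hLs.integrable one_le_two) (hLj.integrable one_le_two)
        (innerSL ℝ)
      rw [h0 j (by simp), map_zero] at this
      exact this
    have e (ω : Ω) : ‖∑ i ∈ insert j s, Z i ω‖ ^ 2
        = ‖∑ i ∈ s, Z i ω‖ ^ 2 + 2 * ⟪∑ i ∈ s, Z i ω, Z j ω⟫ + ‖Z j ω‖ ^ 2 := by
      rw [Finset.sum_insert hj, add_comm, norm_add_sq_real]
    have i1 : Integrable (fun ω => ‖∑ i ∈ s, Z i ω‖ ^ 2) P := hLs.norm.integrable_sq
    have i2 : Integrable (fun ω => 2 * ⟪∑ i ∈ s, Z i ω, Z j ω⟫) P :=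
      (integrable_inner_of_memLp hLs hLj).const_mul 2
    have i3 : Integrable (fun ω => ‖Z j ω‖ ^ 2) P := hLj.norm.integrable_sq
    simp only [e]
    rw [integral_add (i1.fun_add i2) i3, integral_add i1 i2, integral_const_mul, hcross,
      ih (fun i hi => hL i (by simp [hi])) fun i hi => h0 i (by simp [hi]), Finset.sum_insert hj]
    ring

lemma HasLevyIncrements.add_drift {E Ω : Type*} [NormedAddCommGroup E] [InnerProductSpace ℝ E]
    [MeasurableSpace E] [BorelSpace E] [SecondCountableTopology E] [MeasurableSpace Ω]
    {P : Measure Ω} [IsProbabilityMeasure P] {Y : ℝ≥0 → Ω → E} {ψ : E → ℂ}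
    (h : HasLevyIncrements Y P ψ) (v : E) :
    HasLevyIncrements (fun t ω => Y t ω + (t : ℝ) • v) P
      (fun ξ => ψ ξ + -(Complex.I * (⟪v, ξ⟫ : ℝ))) :=
  h.add (hasLevyIncrements_drift v) (indepFun_const_right _ _)

lemma HasLevyIncrements.hasCharExponent {d : ℕ} {Ω : Type*} [MeasurableSpace Ω] {P : Measure Ω}
    [IsProbabilityMeasure P] {X : ℝ≥0 → Ω → EuclideanSpace ℝ (Fin d)}
    {ψ : EuclideanSpace ℝ (Fin d) → ℂ} (h : HasLevyIncrements X P ψ)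
    (h0 : ∀ᵐ ω ∂P, X 0 ω = 0) (hψ : Continuous ψ) : HasCharExponent X P ψ := by
  refine ⟨hψ, fun t ξ => ?_⟩
  have := h.integral_increment (zero_le : (0 : ℝ≥0) ≤ t) ξ
  simp only [NNReal.coe_zero, sub_zero] at this
  rw [← this]
  refine integral_congr_ae ?_
  filter_upwards [h0] with ω hω
  rw [hω, sub_zero, real_inner_comm, mul_comm]

/-! ### Compensated jumps in a shell -/

section JumpPart

variable {d : ℕ} {ν : Measure (EuclideanSpace ℝ (Fin d))} {Ω : Type*} [MeasurableSpace Ω]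
  {P : Measure Ω} [IsProbabilityMeasure P] {C : ℕ → ℝ≥0 → Ω → EuclideanSpace ℝ (Fin d)}

/-- The jumps in the `n`-th shell, compensated for `n ≥ 1`. -/
noncomputable def jumpPart (ν : Measure (EuclideanSpace ℝ (Fin d)))
    (C : ℕ → ℝ≥0 → Ω → EuclideanSpace ℝ (Fin d)) (n : ℕ) (t : ℝ≥0) (ω : Ω) :
    EuclideanSpace ℝ (Fin d) :=
  C n t ω + (t : ℝ) • -compensator ν n

lemma jumpPart_zero_index (t : ℝ≥0) (ω : Ω) : jumpPart ν C 0 t ω = C 0 t ω := by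
  simp [jumpPart, compensator]

lemma jumpPart_eq_compensated {n : ℕ} (hn : n ≠ 0) (t : ℝ≥0) (ω : Ω) :
    jumpPart ν C n t ω = compensated ν (shell d n) (C n) t ω := by
  simp [jumpPart, compensator, compensated, hn, sub_eq_add_neg]

lemma hasLevyIncrements_jumpPart (hν : IsLevyMeasure ν)
    (hC : ∀ n, IsCompoundModel (C n) (ν.restrict (shell d n)) P) (n : ℕ) :
    HasLevyIncrements (jumpPart ν C n) P
      (fun ξ => ∫ y in shell d n, levyKhintchineIntegrand ξ y ∂ν) := by
  have h := (hC n).incr.add_drift (-compensator ν n)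
  refine Eq.mp ?_ h
  congr 1
  ext ξ
  rw [hν.setIntegral_integrand, inner_neg_left]
  push_cast
  ring

lemma isCadlag_jumpPart (hC : ∀ n, IsCompoundModel (C n) (ν.restrict (shell d n)) P) (n : ℕ) :
    ∀ᵐ ω ∂P, IsCadlag fun t => jumpPart ν C n t ω := by
  filter_upwards [(hC n).cadlag] with ω hω
  exact hω.add (isCadlag_of_continuous (by fun_prop))

lemma memLp_jumpPart (hν : IsLevyMeasure ν)
    (hC : ∀ n, IsCompoundModel (C n) (ν.restrict (shell d n)) P) {n : ℕ} (hn : n ≠ 0) (t : ℝ≥0) :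
    MemLp (jumpPart ν C n t) 2 P :=
  ((hC n).memLp (hν.memLp_shell hn) t).add (memLp_const _)

lemma integral_jumpPart (hν : IsLevyMeasure ν)
    (hC : ∀ n, IsCompoundModel (C n) (ν.restrict (shell d n)) P) {n : ℕ} (hn : n ≠ 0) (t : ℝ≥0) :
    ∫ ω, jumpPart ν C n t ω ∂P = 0 := by
  have hL := (hC n).memLp (hν.memLp_shell hn) t
  unfold jumpPart
  rw [integral_add (hL.integrable one_le_two) (integrable_const _),
    (hC n).integral_eq (hν.memLp_shell hn)]
  simp [compensator, hn]

lemma integral_norm_jumpPart_sq (hν : IsLevyMeasure ν)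
    (hC : ∀ n, IsCompoundModel (C n) (ν.restrict (shell d n)) P) {n : ℕ} (hn : n ≠ 0) (t : ℝ≥0) :
    ∫ ω, ‖jumpPart ν C n t ω‖ ^ 2 ∂P = t * ∫ y in shell d n, ‖y‖ ^ 2 ∂ν := by
  rw [← (hC n).integral_sq (hν.memLp_shell hn)]
  simp [jumpPart, compensator, hn, sub_eq_add_neg]

/-- The sum is centred with independent increments, so Doob applies and supplies the factor `4`;
second moments add by independence. Shell `0` is excluded because its jumps are uncompensated and
may lack moments. -/
lemma exists_majorant_sum_jumpPart (hν : IsLevyMeasure ν)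
    (hC : ∀ n, IsCompoundModel (C n) (ν.restrict (shell d n)) P)
    (hind : iIndepFun (fun n ω t => jumpPart ν C n t ω) P) {s : Finset ℕ} (hs : 0 ∉ s) (T : ℝ≥0) :
    ∃ g : Ω → ℝ≥0∞, Measurable g ∧
      (∀ᵐ ω ∂P, ∀ t ≤ T, ‖∑ n ∈ s, jumpPart ν C n t ω‖ₑ ^ 2 ≤ g ω) ∧
      ∫⁻ ω, g ω ∂P ≤ ENNReal.ofReal (T * (4 * ∑ n ∈ s, ∫ y in shell d n, ‖y‖ ^ 2 ∂ν)) := by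
  have hs' : ∀ n ∈ s, n ≠ 0 := fun n hn h => hs (h ▸ hn)
  have hinc := HasLevyIncrements.sum (hasLevyIncrements_jumpPart hν hC) hind s
  have hL (t : ℝ≥0) : MemLp (fun ω => ∑ n ∈ s, jumpPart ν C n t ω) 2 P :=
    memLp_finsetSum s fun n hn => memLp_jumpPart hν hC (hs' n hn) t
  have hmean (t : ℝ≥0) : ∫ ω, ∑ n ∈ s, jumpPart ν C n t ω ∂P = 0 := by
    rw [integral_finsetSum _ fun n hn => (memLp_jumpPart hν hC (hs' n hn) t).integrable one_le_two]
    exact Finset.sum_eq_zero fun n hn => integral_jumpPart hν hC (hs' n hn) t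
  obtain ⟨g, hg, hle, hint⟩ := exists_majorant_lintegral_le hL hinc.measurable
    (fun u t hut => hinc.indepFun hut) (fun u t _ => by
      rw [integral_sub ((hL t).integrable one_le_two) ((hL u).integrable one_le_two), hmean, hmean,
        sub_zero]) (by
      filter_upwards [ae_all_iff.2 (isCadlag_jumpPart hC)] with ω hω
      exact (IsCadlag.sum fun n _ => hω n).1) T
  refine ⟨g, hg, hle, hint.trans_eq ?_⟩
  have hZ := integral_norm_sum_sq (fun n => (hasLevyIncrements_jumpPart hν hC n).measurable T)
    (hind.comp (fun _ f => f T) fun _ => measurable_pi_apply T) (s := s)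
    (fun n hn => memLp_jumpPart hν hC (hs' n hn) T)
    fun n hn => integral_jumpPart hν hC (hs' n hn) T
  have e : ∫⁻ ω, ‖∑ n ∈ s, jumpPart ν C n T ω‖ₑ ^ 2 ∂P
      = ENNReal.ofReal (T * ∑ n ∈ s, ∫ y in shell d n, ‖y‖ ^ 2 ∂ν) := by
    rw [Finset.mul_sum, ← Finset.sum_congr rfl fun n hn =>
      integral_norm_jumpPart_sq hν hC (hs' n hn) T, ← hZ,
      ofReal_integral_eq_lintegral_ofReal (hL T).norm.integrable_sq
        (.of_forall fun ω => by positivity)]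
    refine lintegral_congr fun ω => ?_
    rw [← ofReal_norm, ENNReal.ofReal_pow (norm_nonneg _)]
  rw [e, mul_left_comm, ENNReal.ofReal_mul (by norm_num)]
  norm_num

end JumpPart


/-! ### Partial sums of the decomposition -/

section PartialSums

variable {d : ℕ} {l : EuclideanSpace ℝ (Fin d)} {Q : Matrix (Fin d) (Fin d) ℝ}
  {ν : Measure (EuclideanSpace ℝ (Fin d))} {Ω : Type*} [MeasurableSpace Ω]
  {P : Measure Ω} [IsProbabilityMeasure P] {W : ℝ≥0 → Ω → EuclideanSpace ℝ (Fin d)}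
  {C : ℕ → ℝ≥0 → Ω → EuclideanSpace ℝ (Fin d)}

/-- Drift, Brownian part, and the jumps in the first `m + 1` shells. -/
noncomputable def levySum (l : EuclideanSpace ℝ (Fin d)) (Q : Matrix (Fin d) (Fin d) ℝ)
    (ν : Measure (EuclideanSpace ℝ (Fin d))) (W : ℝ≥0 → Ω → EuclideanSpace ℝ (Fin d))
    (C : ℕ → ℝ≥0 → Ω → EuclideanSpace ℝ (Fin d)) (m : ℕ) (t : ℝ≥0) (ω : Ω) :
    EuclideanSpace ℝ (Fin d) :=
  (Matrix.toEuclideanCLM (𝕜 := ℝ) (CFC.sqrt Q) (W t ω) + (t : ℝ) • l)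
    + ∑ n ∈ Finset.range (m + 1), jumpPart ν C n t ω

lemma levySum_eq (m : ℕ) (t : ℝ≥0) (ω : Ω) :
    levySum l Q ν W C m t ω
      = (t : ℝ) • l + Matrix.toEuclideanCLM (𝕜 := ℝ) (CFC.sqrt Q) (W t ω) + C 0 t ω
        + ∑ n ∈ Finset.Icc 1 m, compensated ν (shell d n) (C n) t ω := by
  have e : Finset.range (m + 1) = insert 0 (Finset.Icc 1 m) := by
    ext n
    simp only [Finset.mem_range, Finset.mem_insert, Finset.mem_Icc]
    omega
  rw [levySum, e, Finset.sum_insert (by simp), jumpPart_zero_index,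
    Finset.sum_congr rfl fun n hn => jumpPart_eq_compensated
      (by have := (Finset.mem_Icc.1 hn).1; omega) t ω, add_comm ((t : ℝ) • l), add_assoc _ (C 0 t ω)]

/-- Drift, Gaussian part and large jumps cancel, so the Cauchy estimate demands no moments of the
large jumps. -/
lemma levySum_sub {m n : ℕ} (h : m ≤ n) (t : ℝ≥0) (ω : Ω) :
    levySum l Q ν W C n t ω - levySum l Q ν W C m t ω
      = ∑ k ∈ Finset.Ico (m + 1) (n + 1), jumpPart ν C k t ω := by
  rw [levySum, levySum, add_sub_add_left_eq_sub, Finset.sum_Ico_eq_sub _ (by omega)]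

lemma hasLevyIncrements_levySum (hν : IsLevyMeasure ν)
    (hWi : HasLevyIncrements (fun t ω => Matrix.toEuclideanCLM (𝕜 := ℝ) (CFC.sqrt Q) (W t ω)) P
      (fun ξ => 1 / 2 * (⟪ξ, Matrix.toEuclideanCLM (𝕜 := ℝ) Q ξ⟫ : ℂ)))
    (hC : ∀ n, IsCompoundModel (C n) (ν.restrict (shell d n)) P)
    (hind : iIndepFun (fun (j : Option ℕ) (ω : Ω) (t : ℝ≥0) => j.elim W C t ω) P) (m : ℕ) :
    HasLevyIncrements (levySum l Q ν W C m) P (fun ξ =>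
      (1 / 2 * (⟪ξ, Matrix.toEuclideanCLM (𝕜 := ℝ) Q ξ⟫ : ℂ) + -(Complex.I * (⟪l, ξ⟫ : ℝ)))
        + ∑ n ∈ Finset.range (m + 1), ∫ y in shell d n, levyKhintchineIntegrand ξ y ∂ν) := by
  have h := HasLevyIncrements.sum (P := P)
    (Y := fun j : Option ℕ => j.elim
      (fun t ω => Matrix.toEuclideanCLM (𝕜 := ℝ) (CFC.sqrt Q) (W t ω) + (t : ℝ) • l)
      (jumpPart ν C))
    (ψ := fun j : Option ℕ => j.elim
      (fun ξ => 1 / 2 * (⟪ξ, Matrix.toEuclideanCLM (𝕜 := ℝ) Q ξ⟫ : ℂ)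
        + -(Complex.I * (⟪l, ξ⟫ : ℝ)))
      fun n ξ => ∫ y in shell d n, levyKhintchineIntegrand ξ y ∂ν)
    (fun j => by
      rcases j with _ | n
      · exact hWi.add_drift l
      · exact hasLevyIncrements_jumpPart hν hC n)
    (by
      have := hind.comp (fun (j : Option ℕ) (f : ℝ≥0 → EuclideanSpace ℝ (Fin d)) (t : ℝ≥0) =>
        j.elim (Matrix.toEuclideanCLM (𝕜 := ℝ) (CFC.sqrt Q) (f t) + (t : ℝ) • l)
          fun n => f t + (t : ℝ) • -compensator ν n) fun j => by
        rcases j with _ | n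
        · simp only [Option.elim]
          fun_prop
        · simp only [Option.elim]
          fun_prop
      refine Eq.mp ?_ this
      congr 1
      ext j ω t
      rcases j with _ | n <;> rfl)
    (Finset.insertNone (Finset.range (m + 1)))
  simp only [Finset.sum_insertNone] at h
  exact h

end PartialSums

end LevyConstruction

/-! ### Assembly of the Lévy process -/

open LevyConstruction in
theorem theorem7p6 (d : ℕ) (l : EuclideanSpace ℝ (Fin d)) (Q : Matrix (Fin d) (Fin d) ℝ)
    (hQ : Q.PosSemidef) (ν : Measure (EuclideanSpace ℝ (Fin d))) (hν : IsLevyMeasure ν) :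
    (∀ ξ : EuclideanSpace ℝ (Fin d), Integrable (levyKhintchineIntegrand ξ) ν) ∧
    ∃ (Ω : Type) (_ : MeasurableSpace Ω) (P : Measure Ω) (_ : IsProbabilityMeasure P)
      (X W : ℝ≥0 → Ω → EuclideanSpace ℝ (Fin d))
      (C : ℕ → ℝ≥0 → Ω → EuclideanSpace ℝ (Fin d)),
      IsLevyProcess X P ∧
      (∀ ω, IsCadlag (fun t => X t ω)) ∧
      HasCharExponent X P (levyKhintchineExponent l Q ν) ∧
      IsWienerProcess W P ∧
      (∀ n, IsCompoundPoissonOf (C n) (ν.restrict (shell d n)) P) ∧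
      iIndepFun (fun (j : Option ℕ) (ω : Ω) (t : ℝ≥0) => j.elim W C t ω) P ∧
      (∀ n, 1 ≤ n → ∀ t, MemLp (compensated ν (shell d n) (C n) t) 2 P) ∧
      ∀ T : ℝ≥0, Tendsto
        (fun m : ℕ => ∫⁻ ω, ⨆ t : Set.Iic T,
          ‖X t ω - ((t : ℝ) • l + Matrix.toEuclideanCLM (𝕜 := ℝ) (CFC.sqrt Q) (W t ω) + C 0 t ω
            + ∑ n ∈ Finset.Icc 1 m, compensated ν (shell d n) (C n) t ω)‖ₑ ^ 2 ∂P)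
        atTop (𝓝 0) := by
  refine ⟨hν.integrable_integrand, ?_⟩
  have hfin (n : ℕ) : IsFiniteMeasure (ν.restrict (shell d n)) :=
    ⟨by simpa using hν.measure_shell_lt_top n⟩
  obtain ⟨Ω, mΩ, P, hP, W, C, hW, hWc, hWi, hC, hind⟩ :=
    exists_independent_processes hQ fun n => ν.restrict (shell d n)
  have hindJ : iIndepFun (fun n ω t => jumpPart ν C n t ω) P :=
    (hind.precomp (Option.some_injective ℕ)).comp
      (fun n (f : ℝ≥0 → EuclideanSpace ℝ (Fin d)) t => f t + (t : ℝ) • -compensator ν n)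
      fun n => by fun_prop
  have hinc := hasLevyIncrements_levySum (l := l) hν hWi hC hind
  have hcad (m : ℕ) : ∀ᵐ ω ∂P, IsCadlag fun t => levySum l Q ν W C m t ω := by
    filter_upwards [ae_all_iff.2 (isCadlag_jumpPart hC)] with ω hω
    refine IsCadlag.add (isCadlag_of_continuous ?_) (IsCadlag.sum fun n _ => hω n)
    have := hWc ω
    fun_prop
  set a : ℕ → ℝ := fun n => ∫ y in shell d (n + 1), ‖y‖ ^ 2 ∂ν
  have ha : Summable a := hν.summable_setIntegral_norm_sq
  have ha0 (n : ℕ) : 0 ≤ a n := integral_nonneg fun y => by positivity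
  -- Doob's constant times the variance of all shells beyond `m`; since `a n` belongs to shell `n +
  -- 1`, the tail starts at `a m`.
  have hr : Tendsto (fun m => 4 * ∑' k, a (k + m)) atTop (𝓝 0) := by
    simpa using (tendsto_sum_nat_add a).const_mul 4
  obtain ⟨X, φ, hφ, hXm, hXc, hXl, hXs⟩ := exists_cadlag_limit_process
    (fun m => (hinc m).measurable) hcad hr fun m n hmn T => by
      obtain ⟨g, hg, hle, hint⟩ := exists_majorant_sum_jumpPart hν hC hindJ
        (s := Finset.Ico (m + 1) (n + 1)) (by simp) T
      refine ⟨g, hg, ?_, hint.trans ?_⟩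
      · filter_upwards [hle] with ω hω t ht
        rw [levySum_sub hmn]
        exact hω t ht
      · refine ENNReal.ofReal_le_ofReal ?_
        have e : ∑ k ∈ Finset.Ico (m + 1) (n + 1), ∫ y in shell d k, ‖y‖ ^ 2 ∂ν
            = ∑ k ∈ Finset.range (n - m), a (k + m) := by
          rw [Finset.sum_Ico_eq_sum_range, Nat.add_sub_add_right]
          exact Finset.sum_congr rfl fun k _ => by
            simp only [a]
            rw [show m + 1 + k = k + m + 1 by ring]
        rw [e]
        gcongr
        exact ((summable_nat_add_iff m).2 ha).sum_le_tsum _ fun k _ => ha0 _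
  have hψ (ξ : EuclideanSpace ℝ (Fin d)) : Tendsto (fun j =>
      (1 / 2 * (⟪ξ, Matrix.toEuclideanCLM (𝕜 := ℝ) Q ξ⟫ : ℂ) + -(Complex.I * (⟪l, ξ⟫ : ℝ)))
        + ∑ n ∈ Finset.range (φ j + 1), ∫ y in shell d n, levyKhintchineIntegrand ξ y ∂ν)
      atTop (𝓝 (levyKhintchineExponent l Q ν ξ)) := by
    -- The shells exhaust `ν` because `ν {0} = 0`, so the partial exponents converge to the full
    -- one, here along `φ`.
    have h1 := (hν.hasSum_setIntegral_shell (hν.integrable_integrand ξ)).tendsto_sum_nat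
    have h2 := (h1.comp ((tendsto_add_atTop_nat 1).comp hφ.tendsto_atTop)).const_add
      (1 / 2 * (⟪ξ, Matrix.toEuclideanCLM (𝕜 := ℝ) Q ξ⟫ : ℂ) + -(Complex.I * (⟪l, ξ⟫ : ℝ)))
    rw [levyKhintchineExponent, add_comm (-_) (1 / 2 * _)]
    exact h2
  have hX := HasLevyIncrements.of_tendsto (fun j => hinc (φ j)) hXm hXl hψ
  have hX0 : ∀ᵐ ω ∂P, X 0 ω = 0 := by
    have hW0 : ∀ᵐ ω ∂P, ∀ i, W 0 ω i = 0 :=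
      ae_all_iff.2 fun i => (hW.brownian i).toIsPreBrownianReal.eval_zero_ae_eq_zero
    filter_upwards [hW0, ae_all_iff.2 fun n => (hC n).zero, hXl] with ω h1 h2 h3
    have h4 : W 0 ω = 0 := by
      ext i
      exact h1 i
    refine tendsto_nhds_unique (h3 0) (tendsto_const_nhds.congr fun j => ?_)
    simp [levySum, jumpPart, h2, h4]
  refine ⟨Ω, mΩ, P, hP, X, W, C, hX.isLevyProcess hX0 (.of_forall fun ω => (hXc ω).1 0), hXc,
    hX.hasCharExponent hX0 (hν.continuous_exponent l Q), hW, fun n => (hC n).isCompound, hind,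
    fun n hn t => ?_, fun T => ?_⟩
  · have hn' : n ≠ 0 := by omega
    refine (memLp_jumpPart hν hC hn' t).ae_eq (.of_forall fun ω => ?_)
    exact jumpPart_eq_compensated hn' t ω
  · simpa only [levySum_eq] using hXs T
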